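/- **Definitions.** For vectors $V=(v_1,\dots,v_n)$ in $\mathbb{R}^r$ the chirotope is $\chi^V(i_1,\dots,i_r)=\operatorname{sign}\det(v_{i_1},\dots,v_{i_r})$; two vector configurations have the same oriented matroid if their chirotopes agree up to a global sign. For a configuration $A=(a_1,\dots,a_n)$ of labelled points in $\mathbb{R}^d$, let $\bar A$ consist of the vectors $\bar a_i=(a_i,1)\in\mathbb{R}^{d+1}$. The realization space of (the oriented matroid of) $A$ is the quotient space $$\mathcal{R}_{\mathrm{om}}(A)=\{V\in(\mathbb{R}^{d+1})^n : V \text{ has the same oriented matroid as } \bar A\}\,/\,GL(\mathbb{R}^{d+1}).$$ $A$ is in general position if no $d+1$ of its points lie in a common hyperplane of $\mathbb{R}^d$ (that is, every $d+1$ of its points are affinely independent). For a full-dimensional polytope $P\subset\mathbb{R}^D$ with labelled vertices $p_1,\dots,p_N$, identify each face $F$ with the label set $\{i : p_i\in F\}$; the face lattice of $P$ is the resulting family of subsets of $\{1,\dots,N\}$. $P$ is inscribed if all its vertices lie on the unit sphere $S^{D-1}$, and neighborly if every set of at most $\lfloor D/2\rfloor$ vertices is the vertex set of a face. For $B=(b_1,\dots,b_N)\in(S^{D-1})^N$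 the face lattice of $\operatorname{conv}(B)$ is likewise the family of sets $\{i : b_i\in F\}$, $F$ a face of $\operatorname{conv}(B)$. The inscribed realization space of $P$ is the quotient space $$\mathcal{R}_{\mathrm{ins}}(P)=\{B\in(S^{D-1})^N : \operatorname{conv}(B)\text{ has the same face lattice as }P\}\,/\,\text{Möb}(S^{D-1}),$$ where $\text{Möb}(S^{D-1})$ is the group of Möbius transformations of $S^{D-1}$ (generated by the reflections in codimension-one subspheres). A topological space $Y$ is a retract of $X$ if there are continuous maps $f:X\to Y$ and $g:Y\to X$ with $f\circ g=\mathrm{id}_Y$. **Lemma.** Let $n\ge 4$ and let $A$ be a configuration of $n$ labelled points in general position in $\mathbb{R}^{n-4}$. Then there are an inscribed neighborly (full-dimensional) polytope $P$ with $2n+2$ vertices in $\mathbb{R}^{2n-2}$ and topological spaces $X$ and $Y$ such that $X$ is homotopy equivalent to $\mathcal{R}_{\mathrm{ins}}(P)$, $Y$ is homotopy equivalent to $\mathcal{R}_{\mathrm{om}}(A)$, and $Y$ is a retract of $X$. -/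

import Mathlib

open scoped ContinuousMap Matrix

/-! ### Oriented matroids of vector and point configurations -/

/-- The chirotope of a configuration `V` of labelled vectors in `ℝ^r`. -/
noncomputable def chirotope {ι : Type} {r : ℕ} (V : ι → Fin r → ℝ) (t : Fin r → ι) : SignType :=
  SignType.sign (Matrix.det (Matrix.of fun k : Fin r => V (t k)))

/-- `V` realizes the oriented matroid with chirotope `χ`. A chirotope is determined by its
oriented matroid only up to a global sign. -/
def RealizesOM {ι : Type} {r : ℕ} (χ : (Fin r → ι) → SignType) (V : ι → Fin r → ℝ) : Prop :=
  chirotope V = χ ∨ chirotope V = fun t => -χ t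

/-- The homogenization of a point configuration in `ℝ^d`: append `1` as last coordinate. -/
def homogenization {ι : Type} {d : ℕ} (A : ι → EuclideanSpace ℝ (Fin d)) :
    ι → Fin (d + 1) → ℝ :=
  fun i => Fin.snoc (α := fun _ => ℝ) (fun k => A i k) 1

/-- No `d + 1` points of the configuration lie in a common hyperplane of `ℝ^d`. -/
def InGeneralPosition {ι : Type} {d : ℕ} (A : ι → EuclideanSpace ℝ (Fin d)) : Prop :=
  ∀ s : Finset ι, s.card = d + 1 → AffineIndependent ℝ (fun i : s => A i)

/-- Two realizations of an oriented matroid are identified when they differ by an element of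
`GL(ℝ^r)`. -/
def omSetoid {ι : Type} {r : ℕ} (χ : (Fin r → ι) → SignType) :
    Setoid {V : ι → Fin r → ℝ // RealizesOM χ V} where
  r V W := ∃ g : GL (Fin r) ℝ, ∀ i, (g : Matrix (Fin r) (Fin r) ℝ) *ᵥ V.1 i = W.1 i
  iseqv :=
    { refl := fun V => ⟨1, fun i => by simp⟩
      symm := by
        rintro V W ⟨g, hg⟩
        refine ⟨g⁻¹, fun i => ?_⟩
        rw [← hg i, Matrix.mulVec_mulVec, ← Units.val_mul, inv_mul_cancel]
        simp
      trans := by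
        rintro U V W ⟨g, hg⟩ ⟨h, hh⟩
        refine ⟨h * g, fun i => ?_⟩
        rw [Units.val_mul, ← Matrix.mulVec_mulVec, hg i, hh i] }

/-- The realization space of the oriented matroid of a point configuration `A` in `ℝ^d`: all
vector configurations in `ℝ^(d+1)` with the oriented matroid of `A`, modulo linear
transformations, with the quotient topology. -/
abbrev RealizationSpaceOM {ι : Type} {d : ℕ} (A : ι → EuclideanSpace ℝ (Fin d)) : Type :=
  Quotient (omSetoid (chirotope (homogenization A)))

/-! ### Polytopes with labelled vertices -/

/-- `p` lists, without repetition, the vertices of a full-dimensional polytope in `ℝ^D`,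
namely of the convex hull of `p`. -/
structure IsVertexConfiguration {ι : Type} {D : ℕ} (p : ι → EuclideanSpace ℝ (Fin D)) :
    Prop where
  injective : Function.Injective p
  extremePoints_eq : (convexHull ℝ (Set.range p)).extremePoints ℝ = Set.range p
  affineSpan_eq : affineSpan ℝ (Set.range p) = ⊤

/-- The face lattice of `conv p`, as a family (ordered by inclusion) of sets of labels. The
faces are the exposed ones, `∅` and the polytope itself included. -/
def faceLattice {ι : Type} {D : ℕ} (p : ι → EuclideanSpace ℝ (Fin D)) : Set (Set ι) :=
  {S | ∃ F, IsExposed ℝ (convexHull ℝ (Set.range p)) F ∧ S = {i | p i ∈ F}}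

/-- All points lie on the unit sphere. -/
def IsInscribed {ι : Type} {D : ℕ} (p : ι → EuclideanSpace ℝ (Fin D)) : Prop :=
  ∀ i, p i ∈ Metric.sphere (0 : EuclideanSpace ℝ (Fin D)) 1

/-- A `D`-polytope is neighborly if every set of at most `⌊D/2⌋` of its vertices is the vertex
set of a face. -/
def IsNeighborly {ι : Type} {D : ℕ} (p : ι → EuclideanSpace ℝ (Fin D)) : Prop :=
  ∀ S : Finset ι, S.card ≤ D / 2 → (S : Set ι) ∈ faceLattice p

/-! ### Möbius transformations and inscribed realizations -/

/-- The unit sphere `S^(D-1)` in `ℝ^D`. -/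
abbrev USphere (D : ℕ) : Type := Metric.sphere (0 : EuclideanSpace ℝ (Fin D)) 1

/-- `f` is the reflection of the unit sphere in one of its codimension-one subspheres: either
the restriction of an orthogonal reflection in a linear hyperplane, or the restriction of an
inversion of `ℝ^D` in a sphere orthogonal to the unit sphere. -/
def IsSphereReflection {D : ℕ} (f : Equiv.Perm (USphere D)) : Prop :=
  (∃ v : EuclideanSpace ℝ (Fin D), v ≠ 0 ∧
    ∀ x : USphere D, (f x : EuclideanSpace ℝ (Fin D)) = (ℝ ∙ v)ᗮ.reflection x) ∨
  (∃ (c : EuclideanSpace ℝ (Fin D)) (R : ℝ), 0 < R ∧ ‖c‖ ^ 2 = 1 + R ^ 2 ∧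
    ∀ x : USphere D, (f x : EuclideanSpace ℝ (Fin D)) = EuclideanGeometry.inversion c R x)

/-- The group of (orientation preserving or reversing) Möbius transformations of the unit
sphere, generated by the reflections in subspheres. -/
def moebiusGroup (D : ℕ) : Subgroup (Equiv.Perm (USphere D)) :=
  Subgroup.closure {f | IsSphereReflection f}

/-- Two inscribed realizations of the face lattice of `p` are identified when they differ by a
Möbius transformation of the sphere. -/
def inscribedSetoid {ι : Type} {D : ℕ} (p : ι → EuclideanSpace ℝ (Fin D)) :
    Setoid {B : ι → USphere D //
      faceLattice (fun i => (B i : EuclideanSpace ℝ (Fin D))) = faceLattice p} where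
  r B C := ∃ g ∈ moebiusGroup D, ∀ i, g (B.1 i) = C.1 i
  iseqv :=
    { refl := fun B => ⟨1, one_mem _, fun i => rfl⟩
      symm := by
        rintro B C ⟨g, hg, h⟩
        refine ⟨g⁻¹, inv_mem hg, fun i => ?_⟩
        rw [← h i]; exact g.symm_apply_apply _
      trans := by
        rintro B C E ⟨g, hg, h⟩ ⟨k, hk, h'⟩
        refine ⟨k * g, mul_mem hk hg, fun i => ?_⟩
        rw [Equiv.Perm.mul_apply, h i, h' i] }

/-- The realization space of the inscribed polytope with vertices `p`: all configurations on
the unit sphere whose convex hull has the same (labelled) face lattice, modulo Möbius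
transformations, with the quotient topology. -/
abbrev RealizationSpaceInscribed {ι : Type} {D : ℕ} (p : ι → EuclideanSpace ℝ (Fin D)) : Type :=
  Quotient (inscribedSetoid p)

/-! ### Retracts -/

/-- `Y` is a retract of `X`: there is a continuous `f : X → Y` with a continuous right inverse. -/
def IsRetractOf (Y X : Type) [TopologicalSpace Y] [TopologicalSpace X] : Prop :=
  ∃ (f : C(X, Y)) (g : C(Y, X)), f.comp g = ContinuousMap.id Y

/-!
Everything is read in Gale duals, which live in `ℝ³` on both sides.

A configuration of `r + 3` vectors in `ℝ^r` whose first `r` vectors form a basis is determined,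
up to `GL(ℝ^r)`, by the matrix `M` for which `stdDual M` (the rows of `M`, then the standard basis
of `ℝ³`) is a Gale dual. For a uniform oriented matroid of corank three the realization space is thus
homeomorphic to the set `chirotopeSet M₀` of matrices with a prescribed dual chirotope
(`realizationSpaceHomeomorph`; the exchange argument `eq_of_exchange_invariant` relates the signs of
complementary minors). Positive row and column factors can be normalized away along powers of
the factors, so this set is homotopy equivalent to the set `Y` of its normalized matrices
(`normalizedHomotopyEquiv`).

For the polytope, every vector `y i` of `stdDual M` is doubled to a pair `y i`, `-(y i + ε S)`,
and a last pair `S ± T` is added (`balancedConfig`), with `0 < ε ≪ ‖T‖ ≪ ‖S‖`. Every open half-space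
then contains at least as many of these vectors as there are pairs `y i`, `-(y i + ε S)`, and one
more if it contains such a pair (`IsGood.card_neg`). By Gale duality the polytope with this dual is
neighborly (`IsBalanced.hasBalancedFaces`). It is made inscribed by exhibiting vectors on the
light cone of `ℝ^(D+1)` with this Gale dual up to positive factors (`IsAdmissible.isGaleDual`). The
parameters can be chosen continuously in `M` with constant signs of all the determinants that occur
(`exists_admissible`), hence with constant face lattice (`IsAdmissible.faceLattice_subset`). This
is a continuous map from `Y` to the inscribed realization space.

Conversely, the faces provided by `HasBalancedFaces` make the dual of any realization balanced, and
a balanced configuration is rigid: its dual faces determine the chirotope of the first members of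
the pairs up to a global sign (`IsBalanced.sign_det3Of_mul_eq`). Their coordinates with respect to
the last three of them form a matrix in `chirotopeSet M₀` (`sphereMatrix_mem`). Möbius
transformations act linearly on homogeneous coordinates up to positive factors
(`isProjective_of_mem_moebiusGroup`), so they change this matrix only by positive row and column
factors. Its normalization is a continuous map from the inscribed realization space to `Y`, and
the composite on `Y` is the identity (`normalized_sphereMatrix_lightPoint`).
-/

/-! ### Determinants of triples of vectors in `ℝ³` -/

/-- The determinant of three vectors in `ℝ³`, written out so that identities between such
determinants are polynomial identities. -/
def det3 (a b c : Fin 3 → ℝ) : ℝ :=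
  a 0 * (b 1 * c 2 - b 2 * c 1) - a 1 * (b 0 * c 2 - b 2 * c 0) + a 2 * (b 0 * c 1 - b 1 * c 0)

theorem det3_self_left (a b : Fin 3 → ℝ) : det3 a a b = 0 := by simp only [det3]; ring
theorem det3_self_right (a b : Fin 3 → ℝ) : det3 a b b = 0 := by simp only [det3]; ring
theorem det3_self_mid (a b : Fin 3 → ℝ) : det3 a b a = 0 := by simp only [det3]; ring
theorem det3_swap_left (a b c : Fin 3 → ℝ) : det3 b a c = -det3 a b c := by
  simp only [det3]; ring
theorem det3_swap_right (a b c : Fin 3 → ℝ) : det3 a c b = -det3 a b c := by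
  simp only [det3]; ring
theorem det3_rotate (a b c : Fin 3 → ℝ) : det3 b c a = det3 a b c := by
  simp only [det3]; ring
theorem det3_smul (l m n : ℝ) (a b c : Fin 3 → ℝ) :
    det3 (l • a) (m • b) (n • c) = l * m * n * det3 a b c := by
  simp only [det3, Pi.smul_apply, smul_eq_mul]; ring
theorem det3_zero (b c : Fin 3 → ℝ) : det3 0 b c = 0 := by simp [det3]

/-- Cramer's rule in `ℝ³`. -/
theorem det3_cramer (a b c v : Fin 3 → ℝ) :
    det3 a b c • v = det3 v b c • a + det3 a v c • b + det3 a b v • c := by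
  funext k
  fin_cases k <;> simp [det3] <;> ring

theorem det3_sum {κ : Type} (s : Finset κ) (w : κ → ℝ) (x : κ → Fin 3 → ℝ) (b c : Fin 3 → ℝ) :
    det3 (∑ k ∈ s, w k • x k) b c = ∑ k ∈ s, w k * det3 (x k) b c := by
  classical
  induction s using Finset.induction_on with
  | empty => simp [det3]
  | insert k s hk ih =>
    rw [Finset.sum_insert hk, Finset.sum_insert hk, ← ih]
    simp only [det3, Pi.add_apply, Pi.smul_apply, smul_eq_mul]; ring

/-- The cross product `b × c`, as a linear functional: it computes `det3 · b c`. -/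
theorem exists_dot_eq_det3 (b c : Fin 3 → ℝ) :
    ∃ ξ : Fin 3 → ℝ, ∀ a, ξ ⬝ᵥ a = det3 a b c := by
  refine ⟨![b 1 * c 2 - b 2 * c 1, -(b 0 * c 2 - b 2 * c 0), b 0 * c 1 - b 1 * c 0], fun a => ?_⟩
  simp [det3, dotProduct, Fin.sum_univ_three]; ring

theorem eq_zero_of_dot_eq_zero {a b c ξ : Fin 3 → ℝ} (h : det3 a b c ≠ 0)
    (ha : ξ ⬝ᵥ a = 0) (hb : ξ ⬝ᵥ b = 0) (hc : ξ ⬝ᵥ c = 0) : ξ = 0 := by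
  have key : det3 a b c * (ξ ⬝ᵥ ξ) = 0 := by
    have := congrArg (fun v => ξ ⬝ᵥ v) (det3_cramer a b c ξ)
    simpa [dotProduct_add, ha, hb, hc] using this
  rcases mul_eq_zero.1 key with h' | h'
  · exact absurd h' h
  · exact dotProduct_self_eq_zero.1 h'

theorem exists_dot_eq_zero {a b c : Fin 3 → ℝ} (h : det3 a b c = 0) :
    ∃ ξ : Fin 3 → ℝ, ξ ≠ 0 ∧ ξ ⬝ᵥ a = 0 ∧ ξ ⬝ᵥ b = 0 ∧ ξ ⬝ᵥ c = 0 := by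
  have hdet : (Matrix.of ![a, b, c]).det = 0 := by
    rw [Matrix.det_fin_three, ← h]; simp [det3]; ring
  obtain ⟨ξ, h0, h1⟩ := Matrix.exists_mulVec_eq_zero_iff.2 hdet
  refine ⟨ξ, h0, ?_, ?_, ?_⟩
  · simpa [Matrix.mulVec, dotProduct_comm] using congrFun h1 0
  · simpa [Matrix.mulVec, dotProduct_comm] using congrFun h1 1
  · simpa [Matrix.mulVec, dotProduct_comm] using congrFun h1 2

/-! ### Connectedness of the basis exchange graph -/

theorem injective_vec3 {α : Type} {a b c : α} (hab : a ≠ b) (hac : a ≠ c) (hbc : b ≠ c) :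
    Function.Injective ![a, b, c] := by
  have := hab.symm
  have := hac.symm
  have := hbc.symm
  intro i j hij
  fin_cases i <;> fin_cases j <;> simp_all

/-- A function of tuples that does not change when one entry of an injective tuple is replaced by
a new label takes a single value on the injective tuples, provided that there are more labels
than entries. -/
theorem eq_of_exchange_invariant {ι α : Type} [Fintype ι] {r : ℕ}
    (hr : r < Fintype.card ι) (σ : (Fin r → ι) → α)
    (h : ∀ t k m, Function.Injective t → m ∉ Set.range t → σ (Function.update t k m) = σ t)
    {t t' : Fin r → ι} (ht : Function.Injective t) (ht' : Function.Injective t') :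
    σ t = σ t' := by
  classical
  have hinj : ∀ (t : Fin r → ι) k m, Function.Injective t → m ∉ Set.range t →
      Function.Injective (Function.update t k m) := by
    intro t k m ht hm a b hab
    by_cases ha : a = k <;> by_cases hb : b = k
    · rw [ha, hb]
    · subst ha; simp [Function.update_of_ne hb] at hab; exact absurd ⟨b, hab.symm⟩ hm
    · subst hb; simp [Function.update_of_ne ha] at hab; exact absurd ⟨a, hab⟩ hm
    · simp [Function.update_of_ne ha, Function.update_of_ne hb] at hab; exact ht hab
  suffices H : ∀ (N : ℕ) (t : Fin r → ι), Function.Injective t →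
      (Finset.univ.filter fun k => t k ≠ t' k).card = N → σ t = σ t' from H _ t ht rfl
  intro N
  induction N using Nat.strong_induction_on with
  | _ N ih =>
  intro t ht hN
  by_cases hall : ∀ k, t k = t' k
  · rw [show t = t' from funext hall]
  push Not at hall
  obtain ⟨k, hk⟩ := hall
  -- First free the label `t' k`, if it is in use, by moving its position to an unused label.
  obtain ⟨t₁, ht₁, hσ, hk₁, hsub⟩ : ∃ t₁ : Fin r → ι, Function.Injective t₁ ∧ σ t₁ = σ t ∧
      t' k ∉ Set.range t₁ ∧ ∀ j, t₁ j ≠ t' j → t j ≠ t' j := by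
    by_cases hin : t' k ∈ Set.range t
    · obtain ⟨k', hk'⟩ := hin
      have hne : k' ≠ k := by rintro rfl; exact hk hk'
      obtain ⟨m, hm⟩ : ∃ m, m ∉ Set.range t := by
        by_contra hcon
        push Not at hcon
        have := Fintype.card_le_of_surjective t (fun m => hcon m)
        simp at this; omega
      refine ⟨Function.update t k' m, hinj t k' m ht hm, h t k' m ht hm, ?_, ?_⟩
      · rintro ⟨j, hj⟩
        by_cases hjk : j = k'
        · subst hjk; simp at hj; exact hm ⟨j, by rw [hk', hj]⟩
        · rw [Function.update_of_ne hjk] at hj; exact hjk (ht (hj.trans hk'.symm))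
      · intro j hj
        by_cases hjk : j = k'
        · subst hjk; rw [hk']; exact fun h' => hne (ht' h').symm
        · rwa [Function.update_of_ne hjk] at hj
    · exact ⟨t, ht, rfl, hin, fun _ => id⟩
  rw [← hσ, ← h t₁ k (t' k) ht₁ hk₁]
  refine ih _ ?_ _ (hinj t₁ k _ ht₁ hk₁) rfl
  rw [← hN]
  apply Finset.card_lt_card
  refine Finset.ssubset_iff_of_subset ?_ |>.2 ⟨k, by simp [hk], by simp⟩
  intro j hj
  simp only [Finset.mem_filter, Finset.mem_univ, true_and] at hj ⊢
  by_cases hjk : j = k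
  · subst hjk; simp at hj
  · rw [Function.update_of_ne hjk] at hj; exact hsub j hj

/-! ### Gale duality with dual rank three -/

/-- The vectors `x k ∈ ℝ³` are a Gale dual of the vector configuration `q`: the values of the
linear functionals on `q` are exactly the coefficients of the linear dependencies of `x`. -/
def IsGaleDual {κ γ : Type} [Fintype κ] [Fintype γ] (q : κ → γ → ℝ) (x : κ → Fin 3 → ℝ) : Prop :=
  ∀ w : κ → ℝ, (∃ u : γ → ℝ, ∀ k, w k = ∑ c, u c * q k c) ↔ ∑ k, w k • x k = 0

theorem det_update_eq_linear {κ : Type} {r : ℕ} (V : κ → Fin r → ℝ) (t : Fin r → κ)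
    (k₀ : Fin r) : ∃ u : Fin r → ℝ, ∀ q,
      Matrix.det (Matrix.of fun k => V (Function.update t k₀ q k)) = ∑ c, u c * V q c := by
  refine ⟨fun c => (Matrix.adjugate (Matrix.of fun k => V (t k))ᵀ) k₀ c, fun q => ?_⟩
  have h1 : (Matrix.of fun k => V (Function.update t k₀ q k))
      = (Matrix.of fun k => V (t k)).updateRow k₀ (V q) := by
    ext k c
    by_cases hk : k = k₀
    · subst hk; simp
    · simp [hk]
  rw [h1, ← Matrix.cramer_transpose_apply, Matrix.cramer_eq_adjugate_mulVec]
  rfl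

/-- An exchange step in a configuration and the complementary exchange in its Gale dual. -/
theorem IsGaleDual.exchange {κ : Type} [Fintype κ] [DecidableEq κ] {r : ℕ} {V : κ → Fin r → ℝ}
    {y : κ → Fin 3 → ℝ} (h : IsGaleDual V y) (t : Fin r → κ) (k₀ : Fin r)
    {m a b : κ} (hm : m ∉ Set.range t)
    (hall : ∀ q, q ∈ Set.range t ∨ q = m ∨ q = a ∨ q = b) :
    Matrix.det (Matrix.of fun k => V (t k)) * det3 (y (t k₀)) (y a) (y b)
      + Matrix.det (Matrix.of fun k => V (Function.update t k₀ m k)) * det3 (y m) (y a) (y b)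
      = 0 := by
  obtain ⟨u, hu⟩ := det_update_eq_linear V t k₀
  set w : κ → ℝ := fun q => Matrix.det (Matrix.of fun k => V (Function.update t k₀ q k)) with hw
  have h0 : ∑ q, w q • y q = 0 := (h w).1 ⟨u, hu⟩
  have h1 : ∑ q, w q * det3 (y q) (y a) (y b) = 0 := by
    rw [← det3_sum, h0, det3_zero]
  have hne : t k₀ ≠ m := fun h' => hm ⟨k₀, h'⟩
  have h2 : ∀ q, q ≠ t k₀ ∧ q ≠ m → w q * det3 (y q) (y a) (y b) = 0 := by
    rintro q ⟨hq1, hq2⟩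
    rcases hall q with ⟨j, hj⟩ | h' | h' | h'
    · have hjk : j ≠ k₀ := by rintro rfl; exact hq1 hj.symm
      have : w q = 0 := by
        simp only [hw]
        apply Matrix.det_zero_of_row_eq hjk
        ext c
        simp [Function.update_of_ne hjk, hj]
      rw [this, zero_mul]
    · exact absurd h' hq2
    · rw [h', det3_self_left, mul_zero]
    · rw [h', det3_self_mid, mul_zero]
  rw [Fintype.sum_eq_add (t k₀) m hne h2] at h1
  simpa [hw] using h1

/-! ### Signs of dual triples and chirotopes -/

/-- In two exchange relations with the same ratio of signs on one side of the duality, the ratios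
of signs on the other side agree. -/
theorem sign_mul_eq_of_exchange {a b c d a' b' c' d' : ℝ} (h : a * c + b * d = 0)
    (h' : a' * c' + b' * d' = 0) (hs : SignType.sign (a * a') = SignType.sign (b * b'))
    (h0 : a * a' ≠ 0) : SignType.sign (c * c') = SignType.sign (d * d') := by
  have h1 : (a * a') * (c * c') = (b * b') * (d * d') := by
    linear_combination a' * c' * h - b * d * h'
  have h2 := congrArg SignType.sign h1
  rw [sign_mul, sign_mul (b * b'), ← hs] at h2
  exact mul_left_cancel₀ (by rwa [ne_eq, sign_eq_zero_iff]) h2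

/-- `det3` of the vectors labelled by a triple. -/
def det3Of {κ : Type} (y : κ → Fin 3 → ℝ) (T : Fin 3 → κ) : ℝ :=
  det3 (y (T 0)) (y (T 1)) (y (T 2))

theorem det3Of_update {κ : Type} (T : Fin 3 → κ) (hT : Function.Injective T) (p : Fin 3) :
    ∃ a b, a ≠ b ∧ T p ≠ a ∧ T p ≠ b ∧ Set.range T = {T p, a, b} ∧
      ∀ (y : κ → Fin 3 → ℝ) m, det3Of y (Function.update T p m) = det3 (y m) (y a) (y b) := by
  have hr : Set.range T = {T 0, T 1, T 2} := by
    ext q; simp [Fin.exists_fin_succ, eq_comm]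
  fin_cases p
  · exact ⟨T 1, T 2, hT.ne (by decide), hT.ne (by decide), hT.ne (by decide), hr,
      fun y m => by simp [det3Of]⟩
  · refine ⟨T 2, T 0, hT.ne (by decide), hT.ne (by decide), hT.ne (by decide), ?_, fun y m => ?_⟩
    · rw [hr]; ext q; simp; tauto
    · rw [← det3_rotate]; simp [det3Of, det3]; ring
  · refine ⟨T 0, T 1, hT.ne (by decide), hT.ne (by decide), hT.ne (by decide), ?_, fun y m => ?_⟩
    · rw [hr]; ext q; simp; tauto
    · rw [← det3_rotate]; simp [det3Of, det3]

section
variable {κ : Type} [Fintype κ] [DecidableEq κ] {r : ℕ} {V V' : κ → Fin r → ℝ}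
  {y y' : κ → Fin 3 → ℝ}

/-- The exchange relation of `IsGaleDual.exchange`, indexed by an exchange in the dual. -/
theorem exists_exchange_of_triple (hκ : Fintype.card κ = r + 3) (T : Fin 3 → κ)
    (hT : Function.Injective T) (p : Fin 3) (m : κ) (hm : m ∉ Set.range T) :
    ∃ t t' : Fin r → κ, Function.Injective t ∧ Function.Injective t' ∧
      ∀ (V : κ → Fin r → ℝ) (y : κ → Fin 3 → ℝ), IsGaleDual V y →
      Matrix.det (Matrix.of fun k => V (t k)) * det3Of y T
      + Matrix.det (Matrix.of fun k => V (t' k)) * det3Of y (Function.update T p m) = 0 := by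
  obtain ⟨a, b, hab, ha, hb, hr, hD⟩ := det3Of_update T hT p
  rw [hr] at hm
  simp only [Set.mem_insert_iff, Set.mem_singleton_iff, not_or] at hm
  obtain ⟨hm1, hm2, hm3⟩ := hm
  have hc : (({m, a, b} : Finset κ)ᶜ).card = r := by
    rw [Finset.card_compl, hκ, Finset.card_eq_three.2 ⟨m, a, b, hm2, hm3, hab, rfl⟩]; omega
  let e := (({m, a, b} : Finset κ)ᶜ).equivFinOfCardEq hc
  let t : Fin r → κ := fun k => (e.symm k : κ)
  have htinj : Function.Injective t := Subtype.val_injective.comp e.symm.injective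
  have htr : ∀ q, q ∈ Set.range t ↔ q ≠ m ∧ q ≠ a ∧ q ≠ b := by
    intro q
    constructor
    · rintro ⟨k, rfl⟩
      have := (e.symm k).2
      simpa [-Subtype.coe_prop] using this
    · rintro ⟨h1, h2, h3⟩
      exact ⟨e ⟨q, by simp [h1, h2, h3]⟩, by simp [t]⟩
  obtain ⟨k₀, hk₀⟩ := (htr (T p)).2 ⟨fun h => hm1 h.symm, ha, hb⟩
  have hmt : m ∉ Set.range t := fun h => ((htr m).1 h).1 rfl
  refine ⟨t, Function.update t k₀ m, htinj, ?_, fun V y h => ?_⟩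
  · intro i j hij
    by_cases hi : i = k₀ <;> by_cases hj : j = k₀
    · rw [hi, hj]
    · subst hi; simp [Function.update_of_ne hj] at hij; exact absurd ⟨j, hij.symm⟩ hmt
    · subst hj; simp [Function.update_of_ne hi] at hij; exact absurd ⟨i, hij⟩ hmt
    · simp [Function.update_of_ne hi, Function.update_of_ne hj] at hij; exact htinj hij
  · have key := h.exchange t k₀ (a := a) (b := b) hmt (fun q => by
      by_cases hq : q ∈ Set.range t
      · exact Or.inl hq
      · rw [htr] at hq; tauto)
    have h0 := hD y (T p)
    rw [Function.update_eq_self] at h0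
    rwa [h0, hD y m, ← hk₀]

/-- The exchange relation of `IsGaleDual.exchange`, indexed by an exchange in the primal. -/
theorem exists_exchange_of_tuple (hκ : Fintype.card κ = r + 3) (t : Fin r → κ)
    (ht : Function.Injective t) (k₀ : Fin r) (m : κ) (hm : m ∉ Set.range t) :
    ∃ T T' : Fin 3 → κ, Function.Injective T ∧ Function.Injective T' ∧
      ∀ (V : κ → Fin r → ℝ) (y : κ → Fin 3 → ℝ), IsGaleDual V y →
      Matrix.det (Matrix.of fun k => V (t k)) * det3Of y T
      + Matrix.det (Matrix.of fun k => V (Function.update t k₀ m k)) * det3Of y T' = 0 := by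
  have hc : ((insert m (Finset.univ.image t))ᶜ).card = 2 := by
    rw [Finset.card_compl, hκ, Finset.card_insert_of_notMem (by simpa using hm),
      Finset.card_image_of_injective _ ht]
    simp
  obtain ⟨a, b, hab, hs⟩ := Finset.card_eq_two.1 hc
  have hmem : ∀ q, q ∈ Set.range t ∨ q = m ∨ q = a ∨ q = b := by
    intro q
    by_contra hcon
    push Not at hcon
    have : q ∈ (insert m (Finset.univ.image t))ᶜ := by
      simp only [Finset.mem_compl, Finset.mem_insert, Finset.mem_image, Finset.mem_univ, true_and]
      exact fun h => h.elim hcon.2.1 hcon.1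
    rw [hs] at this
    simp at this; tauto
  have hmem' : ∀ q, (q = a ∨ q = b) → q ≠ m ∧ q ∉ Set.range t := by
    intro q hq
    have : q ∈ (insert m (Finset.univ.image t))ᶜ := by rw [hs]; simpa using hq
    simpa only [Finset.mem_compl, Finset.mem_insert, Finset.mem_image, Finset.mem_univ, true_and,
      not_or, Set.mem_range, ne_eq] using this
  have hi : ∀ q, q ≠ a → q ≠ b → Function.Injective ![q, a, b] := by
    intro q h1 h2 i j hij
    fin_cases i <;> fin_cases j <;> simp_all
  refine ⟨![t k₀, a, b], ![m, a, b], hi _ ?_ ?_, hi _ ?_ ?_, fun V y h => ?_⟩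
  · rintro h; exact (hmem' a (Or.inl rfl)).2 ⟨k₀, h⟩
  · rintro h; exact (hmem' b (Or.inr rfl)).2 ⟨k₀, h⟩
  · exact (hmem' a (Or.inl rfl)).1.symm
  · exact (hmem' b (Or.inr rfl)).1.symm
  · simpa [det3Of] using h.exchange t k₀ (a := a) (b := b) hm hmem

theorem IsGaleDual.det3Of_ne_zero (h : IsGaleDual V y) (hκ : Fintype.card κ = r + 3)
    (hV : ∀ t : Fin r → κ, Function.Injective t → Matrix.det (Matrix.of fun k => V (t k)) ≠ 0)
    {T₀ : Fin 3 → κ} (hT₀ : Function.Injective T₀) (h₀ : det3Of y T₀ ≠ 0)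
    {T : Fin 3 → κ} (hT : Function.Injective T) (hr : 0 < r) : det3Of y T ≠ 0 := by
  have := eq_of_exchange_invariant (by omega) (fun T => det3Of y T = 0) ?_ hT hT₀
  · exact fun h' => h₀ (this ▸ h')
  · intro T p m hT hm
    obtain ⟨t, t', ht, ht', hrel⟩ := exists_exchange_of_triple hκ T hT p m hm
    have := hrel V y h
    apply propext
    constructor
    · intro h0; rw [h0, mul_zero, add_zero] at this
      exact (mul_eq_zero.1 this).resolve_left (hV t ht)
    · intro h0; rw [h0, mul_zero, zero_add] at this
      exact (mul_eq_zero.1 this).resolve_left (hV t' ht')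

/-- Configurations with the same chirotope up to sign have Gale duals with the same chirotope up
to sign. -/
theorem sign_det3Of_mul_eq (h : IsGaleDual V y) (h' : IsGaleDual V' y')
    (hκ : Fintype.card κ = r + 3) (hr : 0 < r) {s : SignType} (hs0 : s ≠ 0)
    (hs : ∀ t : Fin r → κ, Function.Injective t →
      SignType.sign (Matrix.det (Matrix.of fun k => V (t k)) *
        Matrix.det (Matrix.of fun k => V' (t k))) = s)
    {T T' : Fin 3 → κ} (hT : Function.Injective T) (hT' : Function.Injective T') :
    SignType.sign (det3Of y T * det3Of y' T) = SignType.sign (det3Of y T' * det3Of y' T') := by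
  refine eq_of_exchange_invariant (by omega)
    (fun T => SignType.sign (det3Of y T * det3Of y' T)) ?_ hT hT'
  intro T p m hT hm
  obtain ⟨t, t', ht, ht', hrel⟩ := exists_exchange_of_triple hκ T hT p m hm
  refine (sign_mul_eq_of_exchange (hrel V y h) (hrel V' y' h') ?_ ?_).symm
  · rw [hs t ht, hs t' ht']
  · intro h0; apply hs0; rw [← hs t ht, h0, sign_zero]

/-- Configurations whose Gale duals have the same chirotope up to sign have the same chirotope up
to sign. -/
theorem sign_det_mul_eq (h : IsGaleDual V y) (h' : IsGaleDual V' y')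
    (hκ : Fintype.card κ = r + 3) {s : SignType} (hs0 : s ≠ 0)
    (hs : ∀ T : Fin 3 → κ, Function.Injective T →
      SignType.sign (det3Of y T * det3Of y' T) = s)
    {t t' : Fin r → κ} (ht : Function.Injective t) (ht' : Function.Injective t') :
    SignType.sign (Matrix.det (Matrix.of fun k => V (t k)) *
        Matrix.det (Matrix.of fun k => V' (t k))) =
      SignType.sign (Matrix.det (Matrix.of fun k => V (t' k)) *
        Matrix.det (Matrix.of fun k => V' (t' k))) := by
  refine eq_of_exchange_invariant (by omega)
    (fun t => SignType.sign (Matrix.det (Matrix.of fun k => V (t k)) *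
        Matrix.det (Matrix.of fun k => V' (t k)))) ?_ ht ht'
  intro t p m ht hm
  obtain ⟨T, T', hT, hT', hrel⟩ := exists_exchange_of_tuple hκ t ht p m hm
  have e1 := hrel V y h
  have e2 := hrel V' y' h'
  rw [mul_comm, mul_comm _ (det3Of y T')] at e1
  rw [mul_comm, mul_comm _ (det3Of y' T')] at e2
  refine (sign_mul_eq_of_exchange e1 e2 ?_ ?_).symm
  · rw [hs T hT, hs T' hT']
  · intro h0; apply hs0; rw [← hs T hT, h0, sign_zero]

end

/-! ### Normalized Gale duals -/

section
variable {β : Type}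

/-- The dual configuration whose last three vectors are the standard basis of `ℝ³` and whose
other vectors are the rows of `M`. -/
def stdDual (M : β → Fin 3 → ℝ) : β ⊕ Fin 3 → Fin 3 → ℝ :=
  Sum.elim M (fun k => Pi.single k 1)

@[simp] theorem stdDual_inl (M : β → Fin 3 → ℝ) (j : β) : stdDual M (Sum.inl j) = M j := rfl
@[simp] theorem stdDual_inr (M : β → Fin 3 → ℝ) (k : Fin 3) :
    stdDual M (Sum.inr k) = Pi.single k 1 := rfl

theorem det3Of_stdDual_inr (M : β → Fin 3 → ℝ) : det3Of (stdDual M) Sum.inr = 1 := by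
  simp [det3Of, det3]

variable [Fintype β]

theorem sum_smul_stdDual (M : β → Fin 3 → ℝ) (w : β ⊕ Fin 3 → ℝ) (k : Fin 3) :
    (∑ q, w q • stdDual M q) k = ∑ j, w (Sum.inl j) * M j k + w (Sum.inr k) := by
  simp [Fintype.sum_sum_type, Finset.sum_apply, Pi.single_apply, Finset.sum_ite_eq]

variable [DecidableEq β]

/-- The vector configuration that is Gale dual to `stdDual M`: its first vectors are the standard
basis, and `M` holds the negated coordinates of the last three. -/
def stdConfig (M : β → Fin 3 → ℝ) : β ⊕ Fin 3 → β → ℝ :=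
  Sum.elim (fun j => Pi.single j 1) (fun k j => -M j k)

/-- If the last three vectors of `q` have coordinates `-M` with respect to the basis formed by the
others, then `stdDual M` is a Gale dual of `q`. -/
theorem isGaleDual_stdDual_of_basis {q : β ⊕ Fin 3 → β → ℝ} {M : β → Fin 3 → ℝ}
    (hdet : Matrix.det (Matrix.of fun m => q (Sum.inl m)) ≠ 0)
    (hq : ∀ k, q (Sum.inr k) = -∑ m, M m k • q (Sum.inl m)) : IsGaleDual q (stdDual M) := by
  have hval : ∀ (u : β → ℝ) k, ∑ c, u c * q (Sum.inr k) c
      = -∑ m, M m k * ∑ c, u c * q (Sum.inl m) c := by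
    intro u k
    rw [hq k]
    simp only [Pi.neg_apply, Finset.sum_apply, Pi.smul_apply, smul_eq_mul, mul_neg,
      Finset.sum_neg_distrib, Finset.mul_sum]
    rw [Finset.sum_comm]
    congr 1
    refine Finset.sum_congr rfl fun m _ => Finset.sum_congr rfl fun c _ => by ring
  intro w
  constructor
  · rintro ⟨u, hu⟩
    funext k
    rw [sum_smul_stdDual, hu (Sum.inr k), hval]
    simp only [hu, Pi.zero_apply]
    rw [add_neg_eq_zero]
    exact Finset.sum_congr rfl fun m _ => mul_comm _ _
  · intro h
    set B := Matrix.of fun m => q (Sum.inl m) with hB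
    have hu : ∀ m, ∑ c, (B⁻¹ *ᵥ fun m => w (Sum.inl m)) c * q (Sum.inl m) c = w (Sum.inl m) := by
      intro m
      have := congrFun (show B *ᵥ (B⁻¹ *ᵥ fun m => w (Sum.inl m)) = fun m => w (Sum.inl m) by
        rw [Matrix.mulVec_mulVec, Matrix.mul_nonsing_inv _ (isUnit_iff_ne_zero.2 hdet),
          Matrix.one_mulVec]) m
      rw [← this]
      simp only [Matrix.mulVec, dotProduct, hB, Matrix.of_apply]
      exact Finset.sum_congr rfl fun c _ => mul_comm _ _
    refine ⟨B⁻¹ *ᵥ fun m => w (Sum.inl m), ?_⟩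
    rintro (m | k)
    · exact (hu m).symm
    · rw [hval]
      simp only [hu]
      have := congrFun h k
      rw [sum_smul_stdDual] at this
      simp only [Pi.zero_apply] at this
      rw [eq_neg_iff_add_eq_zero, add_comm, ← this]
      congr 1
      exact Finset.sum_congr rfl fun m _ => mul_comm _ _

theorem of_stdConfig_inl {β : Type} [DecidableEq β] (M : β → Fin 3 → ℝ) :
    (Matrix.of fun m => stdConfig M (Sum.inl m)) = 1 := by
  ext a b
  simp [stdConfig, Matrix.one_apply, Pi.single_apply, eq_comm]

theorem isGaleDual_stdConfig (M : β → Fin 3 → ℝ) : IsGaleDual (stdConfig M) (stdDual M) := by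
  refine isGaleDual_stdDual_of_basis ?_ fun k => ?_
  · rw [of_stdConfig_inl, Matrix.det_one]; exact one_ne_zero
  · funext j
    simp [stdConfig, Finset.sum_apply, Pi.single_apply]

/-- The matrix `M` for which `stdDual M` is Gale dual to `q`. It is meaningful when the vectors
of `q` other than the last three form a basis. -/
noncomputable def dualCoords (q : β ⊕ Fin 3 → β → ℝ) : β → Fin 3 → ℝ :=
  fun m k => -(q (Sum.inr k) ᵥ* (Matrix.of fun m => q (Sum.inl m))⁻¹) m

theorem eq_neg_sum_dualCoords {q : β ⊕ Fin 3 → β → ℝ}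
    (hdet : Matrix.det (Matrix.of fun m => q (Sum.inl m)) ≠ 0) (k : Fin 3) :
    q (Sum.inr k) = -∑ m, dualCoords q m k • q (Sum.inl m) := by
  set B := Matrix.of fun m => q (Sum.inl m) with hB
  have : (q (Sum.inr k) ᵥ* B⁻¹) ᵥ* B = q (Sum.inr k) := by
    rw [Matrix.vecMul_vecMul, Matrix.nonsing_inv_mul _ (isUnit_iff_ne_zero.2 hdet),
      Matrix.vecMul_one]
  conv_lhs => rw [← this]
  rw [Matrix.vecMul_eq_sum]
  simp [dualCoords, hB]
  rfl

theorem isGaleDual_dualCoords {q : β ⊕ Fin 3 → β → ℝ}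
    (hdet : Matrix.det (Matrix.of fun m => q (Sum.inl m)) ≠ 0) :
    IsGaleDual q (stdDual (dualCoords q)) :=
  isGaleDual_stdDual_of_basis hdet (eq_neg_sum_dualCoords hdet)

theorem dualCoords_unique {q : β ⊕ Fin 3 → β → ℝ}
    (hdet : Matrix.det (Matrix.of fun m => q (Sum.inl m)) ≠ 0) {M : β → Fin 3 → ℝ}
    (hM : ∀ k, q (Sum.inr k) = -∑ m, M m k • q (Sum.inl m)) : dualCoords q = M := by
  set B := Matrix.of fun m => q (Sum.inl m) with hB
  funext m k
  have h1 : q (Sum.inr k) = (fun m => -M m k) ᵥ* B := by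
    rw [hM k, Matrix.vecMul_eq_sum]; simp [hB]; rfl
  simp only [dualCoords]
  rw [h1, Matrix.vecMul_vecMul, Matrix.mul_nonsing_inv _ (isUnit_iff_ne_zero.2 hdet),
    Matrix.vecMul_one, neg_neg]

theorem continuous_dualCoords {X : Type} [TopologicalSpace X] {q : X → β ⊕ Fin 3 → β → ℝ}
    (hq : Continuous q) (hdet : ∀ a, Matrix.det (Matrix.of fun m => q a (Sum.inl m)) ≠ 0) :
    Continuous fun a => dualCoords (q a) := by
  have hB : Continuous fun a => (Matrix.of fun m => q a (Sum.inl m) : Matrix β β ℝ) :=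
    continuous_pi fun m => continuous_pi fun c =>
      (continuous_apply c).comp ((continuous_apply (Sum.inl m)).comp hq)
  refine continuous_pi fun m => continuous_pi fun k => ?_
  simp only [dualCoords, Matrix.inv_def, Ring.inverse_eq_inv', Matrix.vecMul_smul, Pi.smul_apply]
  refine ((hB.matrix_det.inv₀ hdet).smul ?_).neg
  exact (continuous_apply m).comp
    (((continuous_apply (Sum.inr k)).comp hq).matrix_vecMul hB.matrix_adjugate)

/-- Rescaling the vectors of a configuration rescales its dual coordinates, and linear maps leave
them unchanged. -/
theorem dualCoords_rescale {q q' : β ⊕ Fin 3 → β → ℝ} (T : (β → ℝ) →ₗ[ℝ] (β → ℝ))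
    (μ : β ⊕ Fin 3 → ℝ) (hμ : ∀ k, μ k ≠ 0) (hq' : ∀ k, q' k = μ k • T (q k))
    (hdet : Matrix.det (Matrix.of fun m => q (Sum.inl m)) ≠ 0)
    (hdet' : Matrix.det (Matrix.of fun m => q' (Sum.inl m)) ≠ 0) (m : β) (k : Fin 3) :
    dualCoords q' m k = μ (Sum.inr k) / μ (Sum.inl m) * dualCoords q m k := by
  have : dualCoords q' = fun m k => μ (Sum.inr k) / μ (Sum.inl m) * dualCoords q m k := by
    refine dualCoords_unique hdet' fun k => ?_
    rw [hq', eq_neg_sum_dualCoords hdet k, map_neg, map_sum, smul_neg, Finset.smul_sum]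
    congr 1
    refine Finset.sum_congr rfl fun m _ => ?_
    rw [hq', map_smul, smul_smul, smul_smul]
    congr 1
    have := hμ (Sum.inl m)
    field_simp
  rw [this]

/-- The dual coordinates can be read off from any Gale dual. -/
theorem dualCoords_spec_of_isGaleDual {q : β ⊕ Fin 3 → β → ℝ} {x : β ⊕ Fin 3 → Fin 3 → ℝ}
    (hdet : Matrix.det (Matrix.of fun m => q (Sum.inl m)) ≠ 0) (h : IsGaleDual q x) (m : β) :
    x (Sum.inl m) = ∑ k, dualCoords q m k • x (Sum.inr k) := by
  have h0 := isGaleDual_dualCoords hdet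
  set w : β ⊕ Fin 3 → ℝ := Sum.elim (Pi.single m 1) (fun k => -dualCoords q m k) with hw
  have h1 : ∑ k, w k • stdDual (dualCoords q) k = 0 := by
    funext k
    rw [sum_smul_stdDual]
    simp [hw, Pi.single_apply]
  have h2 := (h w).1 ((h0 w).2 h1)
  rw [Fintype.sum_sum_type] at h2
  simp [hw, Pi.single_apply] at h2
  rw [← sub_eq_zero, sub_eq_add_neg]
  simpa using h2

end

/-! ### Faces in terms of a Gale dual -/

section
variable {κ : Type} [Fintype κ] {D : ℕ}

/-- A set of labels is a face exactly if it is the zero set of an affine functional that is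
nonnegative on the configuration. -/
theorem mem_faceLattice_iff {κ : Type} {D : ℕ} (p : κ → EuclideanSpace ℝ (Fin D)) (S : Set κ) :
    S ∈ faceLattice p ↔ ∃ (u : Fin D → ℝ) (c : ℝ), (∀ k, 0 ≤ ∑ i, u i * p k i + c) ∧
      S = {k | ∑ i, u i * p k i + c = 0} := by
  constructor
  · rintro ⟨F, hF, rfl⟩
    rcases F.eq_empty_or_nonempty with rfl | hne
    · exact ⟨0, 1, by simp, by simp⟩
    obtain ⟨l, hl⟩ := hF hne
    obtain ⟨x₀, hx₀⟩ := hne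
    have hx₀' := hx₀
    rw [hl] at hx₀'
    have hsum : ∀ x : EuclideanSpace ℝ (Fin D),
        l x = ∑ i, l (EuclideanSpace.single i 1) * x i := by
      intro x
      conv_lhs => rw [← (EuclideanSpace.basisFun (Fin D) ℝ).sum_repr x]
      rw [map_sum]
      refine Finset.sum_congr rfl fun i _ => ?_
      simp [mul_comm]
    have hval : ∀ x : EuclideanSpace ℝ (Fin D),
        ∑ i, (-l (EuclideanSpace.single i 1)) * x i + l x₀ = l x₀ - l x := by
      intro x; rw [hsum x]; simp only [neg_mul, Finset.sum_neg_distrib]; ring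
    refine ⟨fun i => -l (EuclideanSpace.single i 1), l x₀, fun k => ?_, ?_⟩
    · rw [hval]
      exact sub_nonneg.2 (hx₀'.2 _ (subset_convexHull ℝ _ ⟨k, rfl⟩))
    · ext k
      simp only [Set.mem_ofPred_eq, hval]
      rw [hl]
      constructor
      · intro h; exact sub_eq_zero.2 (le_antisymm (h.2 _ hx₀'.1) (hx₀'.2 _ h.1))
      · intro h
        refine ⟨subset_convexHull ℝ _ ⟨k, rfl⟩, fun y hy => ?_⟩
        rw [← sub_eq_zero.1 h]; exact hx₀'.2 y hy
  · rintro ⟨u, c, hnn, rfl⟩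
    set l : StrongDual ℝ (EuclideanSpace ℝ (Fin D)) :=
      innerSL ℝ (WithLp.toLp 2 fun i => -u i) with hl
    have hval : ∀ x, ∑ i, u i * x i + c = c - l x := by
      intro x
      simp [hl, PiLp.inner_apply, mul_comm]
      ring
    by_cases hk : ∃ k₀, ∑ i, u i * p k₀ i + c = 0
    · obtain ⟨k₀, hk₀⟩ := hk
      rw [hval] at hk₀
      have hhull : ∀ y ∈ convexHull ℝ (Set.range p), l y ≤ c := by
        intro y hy
        refine convexHull_min (t := {x | l x ≤ c}) ?_
          (convex_halfSpace_le l.toLinearMap.isLinear c) hy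
        rintro _ ⟨k, rfl⟩
        have := hnn k
        rw [hval] at this
        exact sub_nonneg.1 this
      refine ⟨{x ∈ convexHull ℝ (Set.range p) | ∀ y ∈ convexHull ℝ (Set.range p), l y ≤ l x},
        fun _ => ⟨l, rfl⟩, ?_⟩
      ext k
      simp only [Set.mem_ofPred_eq, hval]
      constructor
      · intro h
        refine ⟨subset_convexHull ℝ _ ⟨k, rfl⟩, fun y hy => ?_⟩
        rw [← sub_eq_zero.1 h]; exact hhull y hy
      · rintro ⟨h1, h2⟩
        have := h2 _ (subset_convexHull ℝ _ ⟨k₀, rfl⟩)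
        have := hhull _ h1
        linarith
    · refine ⟨∅, fun h => absurd h (by simp), ?_⟩
      push Not at hk
      ext k; simp [hk k]

theorem mem_faceLattice_comp {κ κ' : Type} {D : ℕ} (p : κ → EuclideanSpace ℝ (Fin D))
    (ψ : κ' ≃ κ) (S : Set κ') : S ∈ faceLattice (p ∘ ψ) ↔ ψ '' S ∈ faceLattice p := by
  rw [mem_faceLattice_iff, mem_faceLattice_iff]
  refine exists_congr fun u => exists_congr fun c => and_congr ?_ ?_
  · exact ⟨fun h k => by simpa using h (ψ.symm k), fun h k => h (ψ k)⟩
  · rw [Equiv.image_eq_preimage_symm]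
    constructor
    · rintro rfl; ext k; simp
    · intro h
      ext k
      have := congrArg (fun T : Set κ => ψ k ∈ T) h
      simpa using this

theorem faceLattice_comp_eq_iff {κ κ' : Type} {D : ℕ} (p p' : κ → EuclideanSpace ℝ (Fin D))
    (ψ : κ' ≃ κ) : faceLattice (p ∘ ψ) = faceLattice (p' ∘ ψ) ↔ faceLattice p = faceLattice p' := by
  constructor
  · intro h
    ext S
    have := congrArg (fun F : Set (Set κ') => ψ.symm '' S ∈ F) h
    simpa [mem_faceLattice_comp, ← Set.image_comp] using this
  · intro h
    ext S
    rw [mem_faceLattice_comp, mem_faceLattice_comp, h]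

/-- The vectors `x k ∈ ℝ³` are a Gale dual of the point configuration `p`: the values of the
affine functionals on `p` are exactly the coefficients of the linear dependencies of `x`. -/
def IsAffineGaleDual (p : κ → EuclideanSpace ℝ (Fin D)) (x : κ → Fin 3 → ℝ) : Prop :=
  ∀ w : κ → ℝ, (∃ (u : Fin D → ℝ) (c : ℝ), ∀ k, w k = ∑ i, u i * p k i + c) ↔
    ∑ k, w k • x k = 0

/-- The set of labels `S` is the zero set of a nonnegative linear dependency of `x`. -/
def IsDualFace (x : κ → Fin 3 → ℝ) (S : Set κ) : Prop :=
  ∃ w : κ → ℝ, (∀ k, 0 ≤ w k) ∧ ∑ k, w k • x k = 0 ∧ S = {k | w k = 0}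

theorem IsAffineGaleDual.mem_faceLattice {p : κ → EuclideanSpace ℝ (Fin D)} {x : κ → Fin 3 → ℝ}
    (h : IsAffineGaleDual p x) (S : Set κ) : S ∈ faceLattice p ↔ IsDualFace x S := by
  rw [mem_faceLattice_iff]
  constructor
  · rintro ⟨u, c, h1, h2⟩
    exact ⟨fun k => ∑ i, u i * p k i + c, h1, (h _).1 ⟨u, c, fun _ => rfl⟩, h2⟩
  · rintro ⟨w, h1, h2, h3⟩
    obtain ⟨u, c, hu⟩ := (h w).2 h2
    refine ⟨u, c, fun k => hu k ▸ h1 k, ?_⟩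
    rw [h3]; ext k; simp [hu k]

/-- The total weight that the labelled family `k` of weights `c` puts on each label. -/
noncomputable def pushWeight {ι κ : Type} [Fintype ι] [DecidableEq κ] (k : ι → κ) (c : ι → ℝ) :
    κ → ℝ := fun l => ∑ i, if k i = l then c i else 0

theorem sum_pushWeight {ι : Type} [Fintype ι] [DecidableEq κ] (k : ι → κ) (c : ι → ℝ)
    (x : κ → Fin 3 → ℝ) : ∑ l, pushWeight k c l • x l = ∑ i, c i • x (k i) := by
  simp only [pushWeight, Finset.sum_smul, ite_smul, zero_smul]
  rw [Finset.sum_comm]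
  simp

theorem pushWeight_apply {ι κ : Type} [Fintype ι] [DecidableEq κ] {k : ι → κ}
    (hk : Function.Injective k) (c : ι → ℝ) (i : ι) : pushWeight k c (k i) = c i := by
  classical
  simp [pushWeight, hk.eq_iff]

theorem pushWeight_of_notMem {ι κ : Type} [Fintype ι] [DecidableEq κ] {k : ι → κ}
    (c : ι → ℝ) {l : κ} (hl : l ∉ Set.range k) : pushWeight k c l = 0 := by
  refine Finset.sum_eq_zero fun i _ => if_neg fun h => hl ⟨i, h⟩

/-- At most three vectors of a configuration in general position are linearly independent. -/
theorem eq_zero_of_sum_eq_zero [DecidableEq κ] {x : κ → Fin 3 → ℝ}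
    (hx : ∀ T : Fin 3 → κ, Function.Injective T → det3Of x T ≠ 0) (hκ : 3 ≤ Fintype.card κ)
    {ι : Type} [Fintype ι] (k : ι → κ) (hk : Function.Injective k) (hι : Fintype.card ι ≤ 3)
    (c : ι → ℝ) (h : ∑ i, c i • x (k i) = 0) (i : ι) : c i = 0 := by
  obtain ⟨T, hT, -, hTc⟩ := Finset.exists_subsuperset_card_eq
    (Finset.subset_univ (Finset.univ.image k)) (n := 3)
    (by rw [Finset.card_image_of_injective _ hk]; simpa using hι) (by simpa using hκ)
  have hiT : k i ∈ T := hT (by simp)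
  obtain ⟨a, b, hab, hTab⟩ := Finset.card_eq_two.1
    (show (T.erase (k i)).card = 2 by rw [Finset.card_erase_of_mem hiT, hTc])
  have ha : a ∈ T.erase (k i) := by rw [hTab]; simp
  have hb : b ∈ T.erase (k i) := by rw [hTab]; simp
  have h1 : ∑ j, c j * det3 (x (k j)) (x a) (x b) = 0 := by
    rw [← det3_sum Finset.univ c (fun j => x (k j)), h, det3_zero]
  rw [Finset.sum_eq_single i] at h1
  · refine (mul_eq_zero.1 h1).resolve_right (hx ![k i, a, b] ?_)
    intro p q hpq
    have h2 := Finset.ne_of_mem_erase ha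
    have h3 := Finset.ne_of_mem_erase hb
    fin_cases p <;> fin_cases q <;> simp_all
  · intro j _ hj
    have : k j ∈ T.erase (k i) := Finset.mem_erase.2 ⟨hk.ne hj, hT (by simp)⟩
    rw [hTab] at this
    simp only [Finset.mem_insert, Finset.mem_singleton] at this
    rcases this with h' | h' <;> rw [h']
    · rw [det3_self_left, mul_zero]
    · rw [det3_self_mid, mul_zero]
  · simp

/-- Carathéodory's theorem for a configuration in general position: a nonnegative dependency is
supported around a positive dependency of four vectors. -/
theorem exists_positive_quadruple [DecidableEq κ] {x : κ → Fin 3 → ℝ}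
    (hx : ∀ T : Fin 3 → κ, Function.Injective T → det3Of x T ≠ 0) (hκ : 3 ≤ Fintype.card κ)
    {w : κ → ℝ} (hw : ∀ k, 0 ≤ w k) (h : ∑ k, w k • x k = 0) (hne : ∃ k, w k ≠ 0) :
    ∃ (Q : Fin 4 → κ) (c : Fin 4 → ℝ), Function.Injective Q ∧ (∀ i, 0 < c i) ∧
      ∑ i, c i • x (Q i) = 0 ∧ ∀ i, w (Q i) ≠ 0 := by
  obtain ⟨k₀, hk₀⟩ := hne
  have hmem : (0 : Fin 3 → ℝ) ∈ convexHull ℝ (x '' {k | w k ≠ 0}) := by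
    have hpos : 0 < ∑ k ∈ Finset.univ.filter (fun k => w k ≠ 0), w k := by
      refine Finset.sum_pos (fun k hk => ?_) ⟨k₀, by simp [hk₀]⟩
      simp only [Finset.mem_filter] at hk
      exact lt_of_le_of_ne (hw k) hk.2.symm
    have := Finset.centerMass_mem_convexHull (R := ℝ) (Finset.univ.filter (fun k => w k ≠ 0))
      (fun k _ => hw k) hpos (z := x) (s := x '' {k | w k ≠ 0})
      (fun k hk => ⟨k, by simpa using hk, rfl⟩)
    rw [Finset.centerMass] at this
    have hfil : ∑ k ∈ Finset.univ.filter (fun k => w k ≠ 0), w k • x k = 0 := by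
      rw [Finset.sum_filter_of_ne, h]
      intro k _ hk h0
      exact hk (by rw [h0, zero_smul])
    rwa [hfil, smul_zero] at this
  obtain ⟨ι, _, z, c, hz, hind, hc, hc1, hsum⟩ := eq_pos_convex_span_of_mem_convexHull hmem
  have hz' : ∀ i, ∃ k, w k ≠ 0 ∧ x k = z i := fun i => hz ⟨i, rfl⟩
  choose k hkw hkz using hz'
  have hkinj : Function.Injective k := fun i j hij => hind.injective (by rw [← hkz, ← hkz, hij])
  have hsum' : ∑ i, c i • x (k i) = 0 := by simpa [hkz] using hsum
  have hle : Fintype.card ι ≤ 4 := by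
    have h1 := hind.card_le_finrank_succ
    have h2 := Submodule.finrank_le (vectorSpan ℝ (Set.range z))
    simp at h2
    omega
  have hnot : ¬ Fintype.card ι ≤ 3 := by
    intro h3
    have hι : Nonempty ι := by
      by_contra hcon
      rw [not_nonempty_iff] at hcon
      simp at hc1
    obtain ⟨i⟩ := hι
    exact (hc i).ne' (eq_zero_of_sum_eq_zero hx hκ k hkinj h3 c hsum' i)
  have e := Fintype.equivFinOfCardEq (show Fintype.card ι = 4 by omega)
  refine ⟨k ∘ e.symm, c ∘ e.symm, hkinj.comp e.symm.injective, fun i => hc _, ?_, fun i => hkw _⟩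
  rw [← hsum']
  exact Equiv.sum_comp e.symm (fun i => c i • x (k i))

theorem mul_neg_of_sign_eq {a b a' b' : ℝ} (ha : SignType.sign a = SignType.sign a')
    (hb : SignType.sign b = SignType.sign b') (h : a * b < 0) : a' * b' < 0 := by
  rw [← sign_eq_neg_one_iff] at h ⊢
  rw [← h, sign_mul, sign_mul, ha, hb]

theorem mul_pos_of_sign_eq {a b a' b' : ℝ} (ha : SignType.sign a = SignType.sign a')
    (hb : SignType.sign b = SignType.sign b') (h : 0 < a * b) : 0 < a' * b' := by
  rw [← sign_eq_one_iff] at h ⊢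
  rw [← h, sign_mul, sign_mul, ha, hb]

/-- The signs of the maximal minors decide which quadruples have a positive dependency. -/
theorem exists_positive_quadruple_transfer {x x' : Fin 4 → Fin 3 → ℝ}
    (hx : ∀ T : Fin 3 → Fin 4, Function.Injective T → det3Of x T ≠ 0)
    (hs : ∀ T : Fin 3 → Fin 4, Function.Injective T →
      SignType.sign (det3Of x T) = SignType.sign (det3Of x' T))
    {c : Fin 4 → ℝ} (hc : ∀ i, 0 < c i) (h : ∑ i, c i • x i = 0) :
    ∃ c' : Fin 4 → ℝ, (∀ i, 0 < c' i) ∧ ∑ i, c' i • x' i = 0 := by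
  have hrel : ∀ a b, c 0 * det3 (x 0) a b + c 1 * det3 (x 1) a b + c 2 * det3 (x 2) a b
      + c 3 * det3 (x 3) a b = 0 := by
    intro a b
    have := det3_sum Finset.univ c x a b
    rw [h, det3_zero, Fin.sum_univ_four] at this
    exact this.symm
  have i0 : Function.Injective (![1, 2, 3] : Fin 3 → Fin 4) := by decide
  have i1 : Function.Injective (![0, 2, 3] : Fin 3 → Fin 4) := by decide
  have i2 : Function.Injective (![0, 1, 3] : Fin 3 → Fin 4) := by decide
  have i3 : Function.Injective (![0, 1, 2] : Fin 3 → Fin 4) := by decide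
  have e0 : ∀ x : Fin 4 → Fin 3 → ℝ, det3Of x ![1, 2, 3] = det3 (x 1) (x 2) (x 3) := fun _ => rfl
  have e1 : ∀ x : Fin 4 → Fin 3 → ℝ, det3Of x ![0, 2, 3] = det3 (x 0) (x 2) (x 3) := fun _ => rfl
  have e2 : ∀ x : Fin 4 → Fin 3 → ℝ, det3Of x ![0, 1, 3] = det3 (x 0) (x 1) (x 3) := fun _ => rfl
  have e3 : ∀ x : Fin 4 → Fin 3 → ℝ, det3Of x ![0, 1, 2] = det3 (x 0) (x 1) (x 2) := fun _ => rfl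
  have n0 := hx _ i0
  have s0 := hs _ i0
  have s1 := hs _ i1
  have s2 := hs _ i2
  have s3 := hs _ i3
  rw [e0] at n0
  rw [e0, e0] at s0
  rw [e1, e1] at s1
  rw [e2, e2] at s2
  rw [e3, e3] at s3
  have sq : 0 < det3 (x 1) (x 2) (x 3) * det3 (x 1) (x 2) (x 3) := mul_self_pos.2 n0
  have r1 : c 0 * det3 (x 0) (x 2) (x 3) = -(c 1 * det3 (x 1) (x 2) (x 3)) := by
    have := hrel (x 2) (x 3)
    rw [det3_self_left, det3_self_mid] at this; linarith
  have r2 : c 0 * det3 (x 0) (x 1) (x 3) = c 2 * det3 (x 1) (x 2) (x 3) := by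
    have := hrel (x 1) (x 3)
    rw [det3_self_left, det3_self_mid, det3_swap_left (x 1) (x 2)] at this; linarith
  have r3 : c 0 * det3 (x 0) (x 1) (x 2) = -(c 3 * det3 (x 1) (x 2) (x 3)) := by
    have := hrel (x 1) (x 2)
    rw [det3_self_left, det3_self_mid, ← det3_rotate (x 3)] at this; linarith
  have p1 : det3 (x 1) (x 2) (x 3) * det3 (x 0) (x 2) (x 3) < 0 := by
    have : c 0 * (det3 (x 1) (x 2) (x 3) * det3 (x 0) (x 2) (x 3)) < 0 := by
      have := mul_pos (hc 1) sq
      linear_combination this + det3 (x 1) (x 2) (x 3) * r1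
    exact (pos_iff_neg_of_mul_neg this).1 (hc 0)
  have p2 : 0 < det3 (x 1) (x 2) (x 3) * det3 (x 0) (x 1) (x 3) := by
    have : 0 < c 0 * (det3 (x 1) (x 2) (x 3) * det3 (x 0) (x 1) (x 3)) := by
      have := mul_pos (hc 2) sq
      linear_combination this - det3 (x 1) (x 2) (x 3) * r2
    exact (pos_iff_pos_of_mul_pos this).1 (hc 0)
  have p3 : det3 (x 1) (x 2) (x 3) * det3 (x 0) (x 1) (x 2) < 0 := by
    have : c 0 * (det3 (x 1) (x 2) (x 3) * det3 (x 0) (x 1) (x 2)) < 0 := by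
      have := mul_pos (hc 3) sq
      linear_combination this + det3 (x 1) (x 2) (x 3) * r3
    exact (pos_iff_neg_of_mul_neg this).1 (hc 0)
  -- The coefficients of Cramer's rule, multiplied by the first one.
  refine ⟨![det3 (x' 1) (x' 2) (x' 3) * det3 (x' 1) (x' 2) (x' 3),
    -(det3 (x' 1) (x' 2) (x' 3) * det3 (x' 0) (x' 2) (x' 3)),
    det3 (x' 1) (x' 2) (x' 3) * det3 (x' 0) (x' 1) (x' 3),
    -(det3 (x' 1) (x' 2) (x' 3) * det3 (x' 0) (x' 1) (x' 2))], ?_, ?_⟩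
  · intro i
    fin_cases i
    · exact mul_pos_of_sign_eq s0 s0 sq
    · exact neg_pos.2 (mul_neg_of_sign_eq s0 s1 p1)
    · exact mul_pos_of_sign_eq s0 s2 p2
    · exact neg_pos.2 (mul_neg_of_sign_eq s0 s3 p3)
  · rw [Fin.sum_univ_four]
    funext k
    fin_cases k <;> simp [det3] <;> ring

/-- In general position, the signs of the maximal minors determine the dual faces. -/
theorem IsDualFace.of_sign_eq [DecidableEq κ] {x x' : κ → Fin 3 → ℝ}
    (hx : ∀ T : Fin 3 → κ, Function.Injective T → det3Of x T ≠ 0) (hκ : 3 ≤ Fintype.card κ)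
    (hs : ∀ T : Fin 3 → κ, Function.Injective T →
      SignType.sign (det3Of x T) = SignType.sign (det3Of x' T)) {S : Set κ}
    (h : IsDualFace x S) : IsDualFace x' S := by
  obtain ⟨w, hw, hsum, rfl⟩ := h
  by_cases hne : ∃ k, w k ≠ 0
  swap
  · push Not at hne
    exact ⟨0, by simp, by simp, by simp [hne]⟩
  obtain ⟨Q, c, hQ, hc, hcs, hQw⟩ := exists_positive_quadruple hx hκ hw hsum hne
  obtain ⟨c', hc', hcs'⟩ := exists_positive_quadruple_transfer (x := fun i => x (Q i))
    (x' := fun i => x' (Q i)) (fun T hT => hx _ (hQ.comp hT)) (fun T hT => hs _ (hQ.comp hT))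
    hc hcs
  have hD : det3Of x' ![Q 0, Q 1, Q 2] ≠ 0 := by
    have hinj : Function.Injective (![Q 0, Q 1, Q 2] : Fin 3 → κ) := by
      have : (![Q 0, Q 1, Q 2] : Fin 3 → κ) = Q ∘ ![0, 1, 2] := by
        funext i; fin_cases i <;> rfl
      rw [this]; exact hQ.comp (by decide)
    have h1 := hx _ hinj
    rw [← sign_ne_zero, hs _ hinj, sign_ne_zero] at h1
    exact h1
  -- A dependency of `x'` that is positive on the support of `w` outside `Q`.
  set v : κ → ℝ := fun k => if w k = 0 ∨ k ∈ Set.range Q then 0 else 1 with hv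
  set b := ∑ k, v k • x' k with hb
  set D := det3 (x' (Q 0)) (x' (Q 1)) (x' (Q 2)) with hDdef
  set α : Fin 4 → ℝ := ![-(D⁻¹ * det3 b (x' (Q 1)) (x' (Q 2))),
    -(D⁻¹ * det3 (x' (Q 0)) b (x' (Q 2))), -(D⁻¹ * det3 (x' (Q 0)) (x' (Q 1)) b), 0] with hα
  have hαs : ∑ i, α i • x' (Q i) = -b := by
    have hcr := det3_cramer (x' (Q 0)) (x' (Q 1)) (x' (Q 2)) b
    rw [Fin.sum_univ_four]
    simp only [hα, Matrix.cons_val]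
    have hD' : D ≠ 0 := hD
    have : b = D⁻¹ • (D • b) := by rw [smul_smul, inv_mul_cancel₀ hD', one_smul]
    conv_rhs => rw [this, hcr]
    module
  -- A large multiple of the positive dependency on `Q` makes it positive there as well.
  set K : ℝ := ∑ i, |α i| / c' i + 1 with hK
  have hpos : ∀ i, 0 < α i + K * c' i := by
    intro i
    have h1 : |α i| / c' i ≤ ∑ i, |α i| / c' i :=
      Finset.single_le_sum (f := fun i => |α i| / c' i)
        (fun j _ => div_nonneg (abs_nonneg _) (hc' j).le) (Finset.mem_univ i)
    have h2 : |α i| = |α i| / c' i * c' i := by rw [div_mul_cancel₀ _ (hc' i).ne']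
    have h3 := neg_abs_le (α i)
    have h4 : |α i| / c' i * c' i < K * c' i := mul_lt_mul_of_pos_right (by linarith) (hc' i)
    linarith
  refine ⟨fun k => v k + pushWeight Q (fun i => α i + K * c' i) k, fun k => ?_, ?_, ?_⟩
  · refine add_nonneg ?_ (Finset.sum_nonneg fun i _ => ?_)
    · simp only [hv]; split_ifs <;> norm_num
    · split_ifs
      · exact (hpos i).le
      · exact le_rfl
  · simp only [add_smul, Finset.sum_add_distrib]
    rw [sum_pushWeight, ← hb]
    simp only [add_smul, Finset.sum_add_distrib, mul_smul, ← Finset.smul_sum]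
    rw [hαs, hcs']; simp
  · ext k
    simp only [Set.mem_ofPred_eq]
    by_cases hk : k ∈ Set.range Q
    · obtain ⟨i, rfl⟩ := hk
      rw [pushWeight_apply hQ]
      have : v (Q i) = 0 := by simp [hv]
      rw [this, zero_add]
      exact iff_of_false (hQw i) (hpos i).ne'
    · rw [pushWeight_of_notMem _ hk, add_zero]
      simp only [hv, hk, or_false]
      by_cases h0 : w k = 0 <;> simp [h0]

/-- A form of Stiemke's theorem: `S` is a dual face if every open half-space contains a vector
with label outside `S`. -/
theorem isDualFace_of_forall_exists_neg {x : κ → Fin 3 → ℝ} {S : Set κ}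
    (h : ∀ ξ : Fin 3 → ℝ, ξ ≠ 0 → ∃ k, k ∉ S ∧ ξ ⬝ᵥ x k < 0) : IsDualFace x S := by
  classical
  -- `g` measures how far the vectors with label outside `S` reach into the half-space of `ξ`.
  set g : (Fin 3 → ℝ) → ℝ := fun ξ => ∑ k, if k ∈ S then 0 else max 0 (-(ξ ⬝ᵥ x k)) with hg
  have hdot : ∀ k, Continuous fun ξ : Fin 3 → ℝ => ξ ⬝ᵥ x k := fun k => by fun_prop
  have hgc : Continuous g := by
    refine continuous_finsetSum _ fun k _ => ?_
    split_ifs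
    · exact continuous_const
    · exact continuous_const.max (hdot k).neg
  have hgterm : ∀ ξ k, 0 ≤ (if k ∈ S then (0 : ℝ) else max 0 (-(ξ ⬝ᵥ x k))) := by
    intro ξ k; split_ifs
    · exact le_rfl
    · exact le_max_left _ _
  have hgpos : ∀ ξ, ξ ≠ 0 → 0 < g ξ := by
    intro ξ hξ
    obtain ⟨k, hk, hneg⟩ := h ξ hξ
    refine Finset.sum_pos' (fun k _ => hgterm ξ k) ⟨k, Finset.mem_univ k, ?_⟩
    rw [if_neg hk]
    exact lt_max_of_lt_right (neg_pos.2 hneg)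
  have hsne : (Metric.sphere (0 : Fin 3 → ℝ) 1).Nonempty :=
    NormedSpace.sphere_nonempty.2 zero_le_one
  obtain ⟨ξ₀, hξ₀, hmin⟩ := (isCompact_sphere (0 : Fin 3 → ℝ) 1).exists_isMinOn hsne
    hgc.continuousOn
  set m := g ξ₀ with hm
  have hmpos : 0 < m := hgpos ξ₀ (by rintro rfl; simp at hξ₀)
  -- By compactness, small vectors lie in the convex hull of the vectors with label outside `S`.
  set C := convexHull ℝ (x '' Sᶜ) with hC
  have hCclosed : IsClosed C := (Set.toFinite (x '' Sᶜ)).isClosed_convexHull ℝ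
  set N : ℝ := (Fintype.card κ : ℝ) with hN
  have hnear : ∀ q : Fin 3 → ℝ, N * (3 * ‖q‖) < m → q ∈ C := by
    intro q hq
    by_contra hcon
    obtain ⟨f, u, hfq, hfC⟩ := geometric_hahn_banach_point_closed (convex_convexHull ℝ _)
      hCclosed hcon
    set ξ : Fin 3 → ℝ := fun i => f (Pi.single i 1) with hξ
    have hf : ∀ v, f v = ξ ⬝ᵥ v := by
      intro v
      conv_lhs => rw [pi_eq_sum_univ' v]
      simp [hξ, dotProduct, mul_comm]
    have hlt : ∀ k, k ∉ S → ξ ⬝ᵥ q < ξ ⬝ᵥ x k := by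
      intro k hk
      rw [← hf, ← hf]
      exact hfq.trans (hfC _ (subset_convexHull ℝ _ ⟨k, hk, rfl⟩))
    have hξ0 : ξ ≠ 0 := by
      intro h0
      obtain ⟨k, hk, -⟩ := h (Pi.single 0 1) (by simp)
      simpa [h0] using hlt k hk
    have hnorm : 0 < ‖ξ‖ := norm_pos_iff.2 hξ0
    set ξ' := ‖ξ‖⁻¹ • ξ with hξ'
    have hξ'n : ‖ξ'‖ = 1 := by rw [hξ', norm_smul, norm_inv, norm_norm, inv_mul_cancel₀ hnorm.ne']
    have hb : m ≤ g ξ' := hmin (by simp [hξ'n])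
    have hdq : -(ξ' ⬝ᵥ q) ≤ 3 * ‖q‖ := by
      have h1 : ∀ i, -(ξ' i * q i) ≤ ‖q‖ := by
        intro i
        calc -(ξ' i * q i) ≤ |ξ' i * q i| := neg_le_abs _
          _ = |ξ' i| * |q i| := abs_mul _ _
          _ ≤ 1 * ‖q‖ := by
            refine mul_le_mul ?_ (norm_le_pi_norm q i) (abs_nonneg _) zero_le_one
            rw [← hξ'n]; exact norm_le_pi_norm ξ' i
          _ = ‖q‖ := one_mul _
      have h2 : -(ξ' ⬝ᵥ q) = ∑ i, -(ξ' i * q i) := by simp [dotProduct]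
      rw [h2, Fin.sum_univ_three]
      have := h1 0; have := h1 1; have := h1 2
      linarith
    have hle : g ξ' ≤ ∑ _k : κ, 3 * ‖q‖ := by
      refine Finset.sum_le_sum fun k _ => ?_
      split_ifs with hk
      · positivity
      · refine max_le (by positivity) ?_
        have h1 : ξ' ⬝ᵥ q < ξ' ⬝ᵥ x k := by
          rw [hξ', smul_dotProduct, smul_dotProduct]
          exact mul_lt_mul_of_pos_left (hlt k hk) (inv_pos.2 hnorm)
        linarith
    simp at hle
    linarith
  set s := ∑ k, (if k ∈ S then 0 else 1 : ℝ) • x k with hs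
  obtain ⟨η, hη, hηs⟩ : ∃ η : ℝ, 0 < η ∧ -(η • s) ∈ C := by
    refine ⟨m / (N * (3 * ‖s‖) + 1), by positivity, hnear _ ?_⟩
    rw [norm_neg, norm_smul, Real.norm_of_nonneg (by positivity)]
    have hd : 0 < N * (3 * ‖s‖) + 1 := by positivity
    rw [show N * (3 * (m / (N * (3 * ‖s‖) + 1) * ‖s‖)) = m * (N * (3 * ‖s‖)) / (N * (3 * ‖s‖) + 1)
      by ring, div_lt_iff₀ hd]
    linarith
  rw [hC, mem_convexHull_iff_exists_fintype] at hηs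
  obtain ⟨ι, _, c, z, hc, -, hz, hsum⟩ := hηs
  choose k hkS hkz using hz
  have hpw : ∀ l, 0 ≤ pushWeight k c l := fun l => Finset.sum_nonneg fun i _ => by
    split_ifs
    · exact hc i
    · exact le_rfl
  refine ⟨fun l => η * (if l ∈ S then 0 else 1) + pushWeight k c l, fun l => ?_, ?_, ?_⟩
  · refine add_nonneg (mul_nonneg hη.le ?_) (hpw l)
    split_ifs <;> norm_num
  · simp only [add_smul, Finset.sum_add_distrib, mul_smul, ← Finset.smul_sum]
    rw [sum_pushWeight]
    simp only [hkz]
    rw [hsum, hs]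
    simp
  · ext l
    simp only [Set.mem_ofPred_eq]
    by_cases hl : l ∈ S
    · have : l ∉ Set.range k := by rintro ⟨i, rfl⟩; exact hkS i hl
      simp [hl, pushWeight_of_notMem c this]
    · simp only [hl, if_false, false_iff, mul_one]
      have := hpw l
      linarith

end

/-! ### Balanced configurations in `ℝ³` -/

/-- The sign attached to a label: `-1` for the second member of a pair. -/
def labelSign (b : Bool) : ℝ := if b then -1 else 1

theorem labelSign_mul_self (b : Bool) : labelSign b * labelSign b = 1 := by
  cases b <;> simp [labelSign]

section
variable {J : Type}

/-- Each vector `y i` is paired with a vector close to `-y i`, pushed off in the direction `-S`;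
two further vectors `S + T` and `S - T` compensate for the push. -/
def balancedConfig (y : J → Fin 3 → ℝ) (S T : Fin 3 → ℝ) (ε : ℝ) :
    (J × Bool) ⊕ Bool → Fin 3 → ℝ :=
  Sum.elim (fun p => labelSign p.2 • (y p.1 + (if p.2 then ε else 0) • S))
    (fun b => S + labelSign b • T)

/-- The genericity and smallness conditions that make `balancedConfig y S T ε` behave as in the
limit `0 < ε ≪ ‖T‖ ≪ ‖S‖`. -/
structure IsGood (y : J → Fin 3 → ℝ) (S T : Fin 3 → ℝ) (ε : ℝ) : Prop where
  pos : 0 < ε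
  ne_yyy : ∀ i j k, i ≠ j → i ≠ k → j ≠ k → det3 (y i) (y j) (y k) ≠ 0
  ne_yST : ∀ i, det3 (y i) S T ≠ 0
  lt_yyS : ∀ i j, i ≠ j → |det3 (y i) (y j) T| < |det3 (y i) (y j) S|
  lt_yyy : ∀ i j k, i ≠ j → i ≠ k → j ≠ k →
    ε * (|det3 S (y j) (y k)| + |det3 (y i) S (y k)| + |det3 (y i) (y j) S|)
      < |det3 (y i) (y j) (y k)|
  lt_yyE : ∀ i j (b : Bool), i ≠ j →
    ε * (|det3 T (y j) S| + |det3 (y i) T S|)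
      < |det3 (y i) (y j) S + labelSign b * det3 (y i) (y j) T|

variable {y : J → Fin 3 → ℝ} {S T : Fin 3 → ℝ} {ε : ℝ}

theorem IsGood.ne_yyS (h : IsGood y S T ε) {i j : J} (hij : i ≠ j) :
    det3 (y i) (y j) S ≠ 0 := by
  have := h.lt_yyS i j hij
  exact abs_pos.1 ((abs_nonneg _).trans_lt this)

theorem exists_pos_mul_of_abs_lt {a r : ℝ} (h : |r| < |a|) : ∃ t : ℝ, 0 < t ∧ a + r = t * a := by
  have ha : a ≠ 0 := abs_pos.1 ((abs_nonneg _).trans_lt h)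
  refine ⟨1 + r / a, ?_, by field_simp⟩
  have : |r / a| < 1 := by rw [abs_div, div_lt_one (abs_pos.2 ha)]; exact h
  linarith [(abs_lt.1 this).1]

theorem abs_ite_mul_le {ε c : ℝ} (hε : 0 < ε) (b : Bool) :
    |(if b then ε else 0) * c| ≤ ε * |c| := by
  cases b
  · simp; positivity
  · simp [abs_mul, abs_of_pos hε]

/-- Three vectors from different pairs have, up to the signs of the labels, the sign of the three
vectors `y`: the push in the direction `S` is too small to matter. -/
theorem IsGood.det_yyy (h : IsGood y S T ε) {i j k : J} (hij : i ≠ j) (hik : i ≠ k)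
    (hjk : j ≠ k) (p q s : Bool) : ∃ t : ℝ, 0 < t ∧
      det3 (balancedConfig y S T ε (Sum.inl (i, p))) (balancedConfig y S T ε (Sum.inl (j, q)))
        (balancedConfig y S T ε (Sum.inl (k, s)))
      = labelSign p * labelSign q * labelSign s * (t * det3 (y i) (y j) (y k)) := by
  set r := (if p then ε else 0) * det3 S (y j) (y k) + (if q then ε else 0) * det3 (y i) S (y k)
    + (if s then ε else 0) * det3 (y i) (y j) S with hr
  obtain ⟨t, ht, hrt⟩ := exists_pos_mul_of_abs_lt (a := det3 (y i) (y j) (y k)) (r := r) <| by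
    refine lt_of_le_of_lt ?_ (h.lt_yyy i j k hij hik hjk)
    refine (abs_add_three _ _ _).trans ?_
    have := abs_ite_mul_le (c := det3 S (y j) (y k)) h.pos p
    have := abs_ite_mul_le (c := det3 (y i) S (y k)) h.pos q
    have := abs_ite_mul_le (c := det3 (y i) (y j) S) h.pos s
    linarith
  refine ⟨t, ht, ?_⟩
  rw [← hrt, hr]
  simp only [balancedConfig, Sum.elim_inl]
  rw [det3_smul]
  congr 1
  generalize (if p then ε else 0) = a, (if q then ε else 0) = b, (if s then ε else 0) = c
  simp only [det3, Pi.add_apply, Pi.smul_apply, smul_eq_mul]; ring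

theorem balancedConfig_det_pair_y (i k : J) (s : Bool) :
    det3 (balancedConfig y S T ε (Sum.inl (i, false)))
      (balancedConfig y S T ε (Sum.inl (i, true))) (balancedConfig y S T ε (Sum.inl (k, s)))
      = labelSign s * (ε * det3 (y i) (y k) S) := by
  cases s <;> simp [det3, labelSign, balancedConfig] <;> ring

theorem balancedConfig_det_pair_E (i : J) (b : Bool) :
    det3 (balancedConfig y S T ε (Sum.inl (i, false)))
      (balancedConfig y S T ε (Sum.inl (i, true))) (balancedConfig y S T ε (Sum.inr b))
      = -labelSign b * (ε * det3 (y i) S T) := by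
  cases b <;> simp [det3, labelSign, balancedConfig] <;> ring

theorem balancedConfig_det_y_EE (i : J) (p : Bool) :
    det3 (balancedConfig y S T ε (Sum.inl (i, p)))
      (balancedConfig y S T ε (Sum.inr false)) (balancedConfig y S T ε (Sum.inr true))
      = labelSign p * (-2) * (1 * det3 (y i) S T) := by
  cases p <;> simp [det3, labelSign, balancedConfig] <;> ring

/-- The vectors `S + T` and `S - T` behave like `S` with respect to vectors from two different
pairs. -/
theorem IsGood.det_yyE (h : IsGood y S T ε) {i j : J} (hij : i ≠ j) (p q b : Bool) :
    ∃ t : ℝ, 0 < t ∧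
      det3 (balancedConfig y S T ε (Sum.inl (i, p))) (balancedConfig y S T ε (Sum.inl (j, q)))
        (balancedConfig y S T ε (Sum.inr b))
      = labelSign p * labelSign q * (t * det3 (y i) (y j) S) := by
  have hb : |labelSign b| = 1 := by cases b <;> simp [labelSign]
  obtain ⟨t₁, ht₁, hrt₁⟩ := exists_pos_mul_of_abs_lt (a := det3 (y i) (y j) S)
    (r := labelSign b * det3 (y i) (y j) T) (by
      rw [abs_mul, hb, one_mul]; exact h.lt_yyS i j hij)
  set r := labelSign b * ((if p then ε else 0) * det3 S (y j) T
    + (if q then ε else 0) * det3 (y i) S T) with hr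
  obtain ⟨t₂, ht₂, hrt₂⟩ := exists_pos_mul_of_abs_lt
    (a := det3 (y i) (y j) S + labelSign b * det3 (y i) (y j) T) (r := r) <| by
      refine lt_of_le_of_lt ?_ (h.lt_yyE i j b hij)
      rw [hr, abs_mul, hb, one_mul]
      refine (abs_add_le _ _).trans ?_
      have h1 := abs_ite_mul_le (c := det3 S (y j) T) h.pos p
      have h2 := abs_ite_mul_le (c := det3 (y i) S T) h.pos q
      have e1 : |det3 S (y j) T| = |det3 T (y j) S| := by
        rw [← abs_neg]; congr 1; simp only [det3]; ring
      have e2 : |det3 (y i) S T| = |det3 (y i) T S| := by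
        rw [← abs_neg]; congr 1; simp only [det3]; ring
      rw [e1] at h1
      rw [e2] at h2
      linarith
  refine ⟨t₂ * t₁, mul_pos ht₂ ht₁, ?_⟩
  rw [mul_assoc t₂, ← hrt₁, ← hrt₂, hr]
  simp only [balancedConfig, Sum.elim_inl, Sum.elim_inr]
  generalize (if p then ε else 0) = a, (if q then ε else 0) = b
  simp only [det3, Pi.add_apply, Pi.smul_apply, smul_eq_mul]; ring

theorem mul_pos_of_pos_mul {a b σ t t' D D' : ℝ} (hσ : σ ≠ 0) (ht : 0 < t) (ht' : 0 < t')
    (hD : 0 < D * D') (ha : a = σ * (t * D)) (hb : b = σ * (t' * D')) : 0 < a * b := by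
  rw [ha, hb, show σ * (t * D) * (σ * (t' * D')) = σ * σ * (t * t') * (D * D') by ring]
  have := mul_self_pos.2 hσ
  positivity

theorem labelSign_ne_zero (b : Bool) : labelSign b ≠ 0 := by cases b <;> simp [labelSign]

/-- The chirotope of a good balanced configuration is nowhere zero, and depends only on the signs
of the determinants built from `y`, `S` and `T`. -/
theorem IsGood.det3Of_mul_pos {y' : J → Fin 3 → ℝ} {S' T' : Fin 3 → ℝ} {ε' : ℝ}
    (h : IsGood y S T ε) (h' : IsGood y' S' T' ε')
    (hyyy : ∀ i j k, i ≠ j → i ≠ k → j ≠ k →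
      0 < det3 (y i) (y j) (y k) * det3 (y' i) (y' j) (y' k))
    (hyyS : ∀ i j, i ≠ j → 0 < det3 (y i) (y j) S * det3 (y' i) (y' j) S')
    (hyST : ∀ i, 0 < det3 (y i) S T * det3 (y' i) S' T')
    {K : Fin 3 → (J × Bool) ⊕ Bool} (hK : Function.Injective K) :
    0 < det3Of (balancedConfig y S T ε) K * det3Of (balancedConfig y' S' T' ε') K := by
  set x := balancedConfig y S T ε with hx
  set x' := balancedConfig y' S' T' ε' with hx'
  -- The positivity is symmetric in the three labels; `P1` to `P5` treat their possible types.
  set P : ((J × Bool) ⊕ Bool) → ((J × Bool) ⊕ Bool) → ((J × Bool) ⊕ Bool) → Prop :=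
    fun a b c => 0 < det3 (x a) (x b) (x c) * det3 (x' a) (x' b) (x' c) with hP
  have swl : ∀ a b c, P b a c → P a b c := fun a b c hp => by
    simp only [hP] at hp ⊢
    rwa [det3_swap_left (x a), det3_swap_left (x' a), neg_mul_neg] at hp
  have swr : ∀ a b c, P a c b → P a b c := fun a b c hp => by
    simp only [hP] at hp ⊢
    rwa [det3_swap_right (x a), det3_swap_right (x' a), neg_mul_neg] at hp
  have P1 : ∀ i j k p q s, i ≠ j → i ≠ k → j ≠ k →
      P (Sum.inl (i, p)) (Sum.inl (j, q)) (Sum.inl (k, s)) := by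
    intro i j k p q s hij hik hjk
    obtain ⟨t, ht, e⟩ := h.det_yyy hij hik hjk p q s
    obtain ⟨t', ht', e'⟩ := h'.det_yyy hij hik hjk p q s
    exact mul_pos_of_pos_mul (mul_ne_zero (mul_ne_zero (labelSign_ne_zero p) (labelSign_ne_zero q))
      (labelSign_ne_zero s)) ht ht' (hyyy i j k hij hik hjk) e e'
  have P2 : ∀ i k p q s, p ≠ q → i ≠ k → P (Sum.inl (i, p)) (Sum.inl (i, q)) (Sum.inl (k, s)) := by
    intro i k p q s hpq hik
    have base : P (Sum.inl (i, false)) (Sum.inl (i, true)) (Sum.inl (k, s)) :=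
      mul_pos_of_pos_mul (labelSign_ne_zero s) h.pos h'.pos (hyyS i k hik)
        (balancedConfig_det_pair_y i k s) (balancedConfig_det_pair_y i k s)
    cases p <;> cases q
    · exact absurd rfl hpq
    · exact base
    · exact swl _ _ _ base
    · exact absurd rfl hpq
  have P3 : ∀ i j p q b, i ≠ j → P (Sum.inl (i, p)) (Sum.inl (j, q)) (Sum.inr b) := by
    intro i j p q b hij
    obtain ⟨t, ht, e⟩ := h.det_yyE hij p q b
    obtain ⟨t', ht', e'⟩ := h'.det_yyE hij p q b
    exact mul_pos_of_pos_mul (mul_ne_zero (labelSign_ne_zero p) (labelSign_ne_zero q)) ht ht'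
      (hyyS i j hij) e e'
  have P4 : ∀ i p q b, p ≠ q → P (Sum.inl (i, p)) (Sum.inl (i, q)) (Sum.inr b) := by
    intro i p q b hpq
    have base : P (Sum.inl (i, false)) (Sum.inl (i, true)) (Sum.inr b) :=
      mul_pos_of_pos_mul (neg_ne_zero.2 (labelSign_ne_zero b)) h.pos h'.pos (hyST i)
        (balancedConfig_det_pair_E i b) (balancedConfig_det_pair_E i b)
    cases p <;> cases q
    · exact absurd rfl hpq
    · exact base
    · exact swl _ _ _ base
    · exact absurd rfl hpq
  have P5 : ∀ i p b c, b ≠ c → P (Sum.inl (i, p)) (Sum.inr b) (Sum.inr c) := by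
    intro i p b c hbc
    have base : P (Sum.inl (i, p)) (Sum.inr false) (Sum.inr true) :=
      mul_pos_of_pos_mul (mul_ne_zero (labelSign_ne_zero p) (by norm_num)) one_pos one_pos
        (hyST i) (balancedConfig_det_y_EE i p) (balancedConfig_det_y_EE i p)
    cases b <;> cases c
    · exact absurd rfl hbc
    · exact base
    · exact swr _ _ _ base
    · exact absurd rfl hbc
  have Pyy : ∀ i p j q c, (i, p) ≠ (j, q) → c ≠ Sum.inl (i, p) → c ≠ Sum.inl (j, q) →
      P (Sum.inl (i, p)) (Sum.inl (j, q)) c := by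
    rintro i p j q (⟨k, s⟩ | b) h1 h2 h3
    · by_cases hij : i = j
      · subst hij
        have hpq : p ≠ q := fun h => h1 (by rw [h])
        refine P2 i k p q s hpq ?_
        rintro rfl
        have : s ≠ p := fun h => h2 (by rw [h])
        have : s ≠ q := fun h => h3 (by rw [h])
        exact (by decide : ∀ p q s : Bool, p ≠ q → s ≠ p → s ≠ q → False) p q s hpq
          ‹_› ‹_›
      · by_cases hik : i = k
        · subst hik
          have : p ≠ s := fun h => h2 (by rw [h])
          exact swr _ _ _ (P2 i j p s q this hij)
        · by_cases hjk : j = k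
          · subst hjk
            have : q ≠ s := fun h => h3 (by rw [h])
            exact swl _ _ _ (swr _ _ _ (P2 j i q s p this (Ne.symm hij)))
          · exact P1 i j k p q s hij hik hjk
    · by_cases hij : i = j
      · subst hij
        exact P4 i p q b (fun h => h1 (by rw [h]))
      · exact P3 i j p q b hij
  have h01 : K 0 ≠ K 1 := hK.ne (by decide)
  have h02 : K 0 ≠ K 2 := hK.ne (by decide)
  have h12 : K 1 ≠ K 2 := hK.ne (by decide)
  change P (K 0) (K 1) (K 2)
  revert h01 h02 h12
  generalize K 0 = a, K 1 = b, K 2 = c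
  intro hab hac hbc
  rcases a with ⟨i, p⟩ | a
  · rcases b with ⟨j, q⟩ | b
    · exact Pyy i p j q c (fun h => hab (by rw [h])) hac.symm hbc.symm
    · rcases c with ⟨k, s⟩ | c
      · exact swr _ _ _ (Pyy i p k s _ (fun h => hac (by rw [h])) (by simp) (by simp))
      · exact P5 i p b c (fun h => hbc (by rw [h]))
  · rcases b with ⟨j, q⟩ | b
    · rcases c with ⟨k, s⟩ | c
      · exact swl _ _ _ (swr _ _ _ (Pyy j q k s _ (fun h => hbc (by rw [h])) (by simp) (by simp)))
      · exact swl _ _ _ (P5 j q a c (fun h => hac (by rw [h])))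
    · rcases c with ⟨k, s⟩ | c
      · exact swr _ _ _ (swl _ _ _ (P5 k s a b (fun h => hab (by rw [h]))))
      · have h1 : a ≠ b := fun h => hab (by rw [h])
        have h2 : a ≠ c := fun h => hac (by rw [h])
        have h3 : b ≠ c := fun h => hbc (by rw [h])
        revert h1 h2 h3; cases a <;> cases b <;> cases c <;> simp

/-! ### Balanced configurations: counting vectors in half-spaces -/

variable [Fintype J]

open Classical in
theorem card_neg_eq (x : (J × Bool) ⊕ Bool → Fin 3 → ℝ) (ξ : Fin 3 → ℝ) :
    (Finset.univ.filter fun k => ξ ⬝ᵥ x k < 0).card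
      = ∑ i : J, ((if ξ ⬝ᵥ x (Sum.inl (i, false)) < 0 then 1 else 0)
          + (if ξ ⬝ᵥ x (Sum.inl (i, true)) < 0 then 1 else 0))
        + ((if ξ ⬝ᵥ x (Sum.inr false) < 0 then 1 else 0)
          + (if ξ ⬝ᵥ x (Sum.inr true) < 0 then 1 else 0)) := by
  rw [Finset.card_filter, Fintype.sum_sum_type, Fintype.sum_prod_type, Fintype.sum_bool]
  simp only [Fintype.sum_bool]
  congr 1
  · exact Finset.sum_congr rfl fun i _ => add_comm _ _
  · exact add_comm _ _

theorem dot_det3_cramer (ξ a b c v : Fin 3 → ℝ) :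
    det3 a b c * (ξ ⬝ᵥ v) = det3 v b c * (ξ ⬝ᵥ a) + det3 a v c * (ξ ⬝ᵥ b)
      + det3 a b v * (ξ ⬝ᵥ c) := by
  have := congrArg (fun v => ξ ⬝ᵥ v) (det3_cramer a b c v)
  simpa [dotProduct_add] using this

open Classical in
/-- Every open half-space contains at least as many vectors as there are pairs indexed by `J`, and
one more if it contains both members of such a pair. -/
theorem IsGood.card_neg (h : IsGood y S T ε) {ξ : Fin 3 → ℝ} (hξ : ξ ≠ 0) :
    Fintype.card J ≤ (Finset.univ.filter fun k => ξ ⬝ᵥ balancedConfig y S T ε k < 0).card ∧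
    ((∃ j, ξ ⬝ᵥ balancedConfig y S T ε (Sum.inl (j, false)) < 0 ∧
        ξ ⬝ᵥ balancedConfig y S T ε (Sum.inl (j, true)) < 0) →
      Fintype.card J + 1 ≤
        (Finset.univ.filter fun k => ξ ⬝ᵥ balancedConfig y S T ε k < 0).card) := by
  rw [card_neg_eq]
  have ey : ∀ i, ξ ⬝ᵥ balancedConfig y S T ε (Sum.inl (i, false)) = ξ ⬝ᵥ y i := by
    intro i; simp [balancedConfig, labelSign]
  have ez : ∀ i, ξ ⬝ᵥ balancedConfig y S T ε (Sum.inl (i, true))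
      = -(ξ ⬝ᵥ y i + ε * (ξ ⬝ᵥ S)) := by
    intro i; simp [balancedConfig, labelSign, dotProduct_add]; ring
  have ee : ξ ⬝ᵥ balancedConfig y S T ε (Sum.inr false) = ξ ⬝ᵥ S + ξ ⬝ᵥ T := by
    simp [balancedConfig, labelSign, dotProduct_add]
  have ef : ξ ⬝ᵥ balancedConfig y S T ε (Sum.inr true) = ξ ⬝ᵥ S - ξ ⬝ᵥ T := by
    simp [balancedConfig, labelSign, dotProduct_add, sub_eq_add_neg]
  simp only [ey, ez, ee, ef]
  -- Pair `i` contributes `f i`, the last pair contributes `N`.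
  set a := ξ ⬝ᵥ S with ha
  set f : J → ℕ := fun i => (if ξ ⬝ᵥ y i < 0 then 1 else 0)
    + (if -(ξ ⬝ᵥ y i + ε * a) < 0 then 1 else 0) with hf
  set N : ℕ := (if a + ξ ⬝ᵥ T < 0 then 1 else 0) + (if a - ξ ⬝ᵥ T < 0 then 1 else 0) with hN
  have hpos : 0 < a → ∀ i, 1 ≤ f i := by
    intro hapos i
    simp only [hf]
    have := mul_pos h.pos hapos
    by_cases hi : ξ ⬝ᵥ y i < 0
    · simp [hi]
    · rw [if_pos (show -(ξ ⬝ᵥ y i + ε * a) < 0 by linarith)]; omega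
  change _ ≤ Finset.univ.sum f + N ∧ (_ → _ ≤ Finset.univ.sum f + N)
  refine ⟨?_, ?_⟩
  · -- The pairs in `I` contribute nothing; the last pair has to make up for them.
    set I := Finset.univ.filter fun i => f i = 0 with hI
    have hIy : ∀ i ∈ I, 0 ≤ ξ ⬝ᵥ y i ∧ ξ ⬝ᵥ y i ≤ -(ε * a) := by
      intro i hi
      simp only [hI, hf, Finset.mem_filter, Finset.mem_univ, true_and, Nat.add_eq_zero_iff] at hi
      obtain ⟨h1, h2⟩ := hi
      constructor
      · by_contra hc; rw [if_pos (not_le.1 hc)] at h1; omega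
      · by_contra hc
        rw [if_pos (by linarith [not_le.1 hc])] at h2; omega
    suffices hIN : I.card ≤ N by
      have h1 : Fintype.card J = I.card + (Finset.univ.filter fun i => ¬ f i = 0).card := by
        rw [Finset.card_filter_add_card_filter_not]; rfl
      have h2 : (Finset.univ.filter fun i => ¬ f i = 0).card ≤ Finset.univ.sum f := by
        rw [Finset.card_filter]
        refine Finset.sum_le_sum fun i _ => ?_
        by_cases hfi : f i = 0
        · rw [if_neg (not_not.2 hfi)]; exact Nat.zero_le _
        · rw [if_pos hfi]; exact Nat.one_le_iff_ne_zero.2 hfi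
      omega
    rcases lt_trichotomy a 0 with hneg | hzero | hapos
    · -- `ξ` is negative on `S` and nearly vanishes on `y i` for `i ∈ I`, so `I` has at most two
      -- elements; if it has two, `ξ` is negative on both `S + T` and `S - T`.
      have hI2 : I.card ≤ 2 := by
        by_contra hc
        obtain ⟨i, j, k, hi, hj, hk, hij, hik, hjk⟩ := Finset.two_lt_card_iff.1 (not_le.1 hc)
        have hcr := dot_det3_cramer ξ (y i) (y j) (y k) S
        have hlt := h.lt_yyy i j k hij hik hjk
        have hb : ∀ (c : ℝ) i, i ∈ I → |c * (ξ ⬝ᵥ y i)| ≤ |c| * (-(ε * a)) := by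
          intro c i hi
          rw [abs_mul, abs_of_nonneg (hIy i hi).1]
          exact mul_le_mul_of_nonneg_left (hIy i hi).2 (abs_nonneg _)
        have h1 := hb (det3 S (y j) (y k)) i hi
        have h2 := hb (det3 (y i) S (y k)) j hj
        have h3 := hb (det3 (y i) (y j) S) k hk
        have h4 := abs_add_three (det3 S (y j) (y k) * (ξ ⬝ᵥ y i))
          (det3 (y i) S (y k) * (ξ ⬝ᵥ y j)) (det3 (y i) (y j) S * (ξ ⬝ᵥ y k))
        rw [← hcr, abs_mul, abs_of_neg hneg] at h4
        have := mul_lt_mul_of_pos_right hlt (neg_pos.2 hneg)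
        linarith
      have hN1 : 1 ≤ N := by
        simp only [hN]
        by_cases h1 : a + ξ ⬝ᵥ T < 0
        · simp [h1]
        · rw [if_pos (show a - ξ ⬝ᵥ T < 0 by linarith)]; omega
      by_cases hI1 : I.card ≤ 1
      · omega
      obtain ⟨i, hi, j, hj, hij⟩ := Finset.one_lt_card.1 (not_le.1 hI1)
      have hE : ∀ b, a + labelSign b * (ξ ⬝ᵥ T) < 0 := by
        intro b
        have hb : |labelSign b| = 1 := by cases b <;> simp [labelSign]
        have hlt := h.lt_yyE i j b hij
        obtain ⟨t, ht, hrt⟩ := exists_pos_mul_of_abs_lt (a := det3 (y i) (y j) S)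
          (r := labelSign b * det3 (y i) (y j) T) (by
            rw [abs_mul, hb, one_mul]; exact h.lt_yyS i j hij)
        set W := det3 (y i) (y j) S + labelSign b * det3 (y i) (y j) T with hW
        set R := labelSign b * (det3 T (y j) S * (ξ ⬝ᵥ y i) + det3 (y i) T S * (ξ ⬝ᵥ y j)) with hR
        have key : det3 (y i) (y j) S * (a + labelSign b * (ξ ⬝ᵥ T)) = R + W * a := by
          have := dot_det3_cramer ξ (y i) (y j) S T
          rw [hR, hW]
          linear_combination labelSign b * this
        have hRle : |R| ≤ ε * (|det3 T (y j) S| + |det3 (y i) T S|) * (-a) := by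
          rw [hR, abs_mul, hb, one_mul]
          refine (abs_add_le _ _).trans ?_
          rw [abs_mul, abs_mul, abs_of_nonneg (hIy i hi).1, abs_of_nonneg (hIy j hj).1]
          have h1 := mul_le_mul_of_nonneg_left (hIy i hi).2 (abs_nonneg (det3 T (y j) S))
          have h2 := mul_le_mul_of_nonneg_left (hIy j hj).2 (abs_nonneg (det3 (y i) T S))
          linarith
        have hRlt : |R| < |W * a| := by
          rw [abs_mul W a, abs_of_neg hneg]
          exact hRle.trans_lt (mul_lt_mul_of_pos_right hlt (neg_pos.2 hneg))
        obtain ⟨t₂, ht₂, hrt₂⟩ := exists_pos_mul_of_abs_lt hRlt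
        have hne := h.ne_yyS hij
        have : a + labelSign b * (ξ ⬝ᵥ T) = t₂ * t * a := by
          apply mul_left_cancel₀ hne
          rw [key, add_comm, hrt₂, hrt]; ring
        rw [this]
        exact mul_neg_of_pos_of_neg (mul_pos ht₂ ht) hneg
      have h1 := hE false
      have h2 := hE true
      simp only [labelSign, Bool.false_eq_true, if_false, if_true, one_mul] at h1 h2
      have hN2 : N = 2 := by
        simp only [hN]
        rw [if_pos h1, if_pos (by linarith)]
      omega
    · -- `ξ` vanishes on `S` and on `y i` for `i ∈ I`.
      have hy0 : ∀ i ∈ I, ξ ⬝ᵥ y i = 0 := by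
        intro i hi
        have := hIy i hi
        rw [hzero, mul_zero, neg_zero] at this
        exact le_antisymm this.2 this.1
      have hI1 : I.card ≤ 1 := by
        by_contra hc
        obtain ⟨i, hi, j, hj, hij⟩ := Finset.one_lt_card.1 (not_le.1 hc)
        exact hξ (eq_zero_of_dot_eq_zero (h.ne_yyS hij) (hy0 i hi) (hy0 j hj) (ha ▸ hzero))
      by_cases hI0 : I.card = 0
      · omega
      obtain ⟨i, hi⟩ := Finset.card_pos.1 (Nat.pos_of_ne_zero hI0)
      have hT : ξ ⬝ᵥ T ≠ 0 := fun hT =>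
        hξ (eq_zero_of_dot_eq_zero (h.ne_yST i) (hy0 i hi) (ha ▸ hzero) hT)
      have : 1 ≤ N := by
        simp only [hN, hzero, zero_add, zero_sub]
        rcases lt_or_gt_of_ne hT with h1 | h1
        · simp [h1]
        · rw [if_pos (show -(ξ ⬝ᵥ T) < 0 by linarith)]; omega
      omega
    · -- If `ξ` is positive on `S`, every pair contributes.
      have : I = ∅ := by
        rw [Finset.eq_empty_iff_forall_notMem]
        intro i hi
        simp only [hI, Finset.mem_filter, Finset.mem_univ, true_and] at hi
        have := hpos hapos i
        omega
      simp [this]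
  · rintro ⟨j, h1, h2⟩
    have hapos : 0 < a := by
      by_contra hc
      have := mul_nonpos_of_nonneg_of_nonpos h.pos.le (not_lt.1 hc)
      linarith
    have : Fintype.card J < Finset.univ.sum f := by
      rw [Fintype.card_eq_sum_ones]
      refine Finset.sum_lt_sum (fun i _ => hpos hapos i) ⟨j, Finset.mem_univ j, ?_⟩
      rw [if_pos h1, if_pos h2]; norm_num
    omega

end

/-! ### Rigidity: the face lattice determines the chirotope of the contraction -/

section
variable {J : Type} [Fintype J]

/-- All sets of fewer than `|J|` labels are faces, and so are the sets of at most `|J|` labels that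
contain a pair. -/
structure HasBalancedFaces (F : Set (Set ((J × Bool) ⊕ Bool))) : Prop where
  of_card_lt : ∀ S : Finset ((J × Bool) ⊕ Bool), S.card < Fintype.card J → (S : Set _) ∈ F
  of_pair : ∀ S : Finset ((J × Bool) ⊕ Bool), S.card ≤ Fintype.card J →
    ∀ j, Sum.inl (j, false) ∈ S → Sum.inl (j, true) ∈ S → (S : Set _) ∈ F

open Classical in
/-- Every open half-space contains at least `|J|` of the vectors, and at least `|J| + 1` if it
contains a pair. -/
def IsBalanced (x : (J × Bool) ⊕ Bool → Fin 3 → ℝ) : Prop :=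
  ∀ ξ : Fin 3 → ℝ, ξ ≠ 0 →
    Fintype.card J ≤ (Finset.univ.filter fun k => ξ ⬝ᵥ x k < 0).card ∧
    ((∃ j, ξ ⬝ᵥ x (Sum.inl (j, false)) < 0 ∧ ξ ⬝ᵥ x (Sum.inl (j, true)) < 0) →
      Fintype.card J + 1 ≤ (Finset.univ.filter fun k => ξ ⬝ᵥ x k < 0).card)

theorem IsGood.isBalanced {y : J → Fin 3 → ℝ} {S T : Fin 3 → ℝ} {ε : ℝ} (h : IsGood y S T ε) :
    IsBalanced (balancedConfig y S T ε) := fun _ hξ => h.card_neg hξ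

theorem IsBalanced.rescale {x x' : (J × Bool) ⊕ Bool → Fin 3 → ℝ} (h : IsBalanced x)
    {μ : (J × Bool) ⊕ Bool → ℝ} (hμ : ∀ k, 0 < μ k) (hx : ∀ k, x' k = μ k • x k) :
    IsBalanced x' := by
  have : ∀ ξ k, ξ ⬝ᵥ x' k < 0 ↔ ξ ⬝ᵥ x k < 0 := by
    intro ξ k
    rw [hx, dotProduct_smul, smul_eq_mul]
    constructor
    · intro h'
      by_contra hc
      exact absurd h' (not_lt.2 (mul_nonneg (hμ k).le (not_lt.1 hc)))
    · exact fun h' => mul_neg_of_pos_of_neg (hμ k) h'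
  intro ξ hξ
  simp only [this]
  exact h ξ hξ

/-- The vectors in an open half-space are too many for all their labels to lie in a small set, so
`isDualFace_of_forall_exists_neg` applies. -/
theorem IsBalanced.hasBalancedFaces {x : (J × Bool) ⊕ Bool → Fin 3 → ℝ} (h : IsBalanced x) :
    HasBalancedFaces {S | IsDualFace x S} := by
  classical
  constructor
  · intro S hS
    refine isDualFace_of_forall_exists_neg fun ξ hξ => ?_
    by_contra hc
    push Not at hc
    have := (h ξ hξ).1
    have hsub : (Finset.univ.filter fun k => ξ ⬝ᵥ x k < 0) ⊆ S := by
      intro k hk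
      simp only [Finset.mem_filter, Finset.mem_univ, true_and] at hk
      by_contra hkS
      exact absurd hk (not_lt.2 (hc k hkS))
    have := Finset.card_le_card hsub
    omega
  · intro S hS j h0 h1
    refine isDualFace_of_forall_exists_neg fun ξ hξ => ?_
    by_contra hc
    push Not at hc
    obtain ⟨hb, hb'⟩ := h ξ hξ
    have hsub : (Finset.univ.filter fun k => ξ ⬝ᵥ x k < 0) ⊆ S := by
      intro k hk
      simp only [Finset.mem_filter, Finset.mem_univ, true_and] at hk
      by_contra hkS
      exact absurd hk (not_lt.2 (hc k hkS))
    have heq := Finset.eq_of_subset_of_card_le hsub (hS.trans hb)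
    rw [← heq] at h0 h1
    simp only [Finset.mem_filter, Finset.mem_univ, true_and] at h0 h1
    have h2 := hb' ⟨j, h0, h1⟩
    have h3 := Finset.card_le_card hsub
    omega

/-- If the negative labels of an affine dependency form a face, the dependency is trivial. -/
theorem eq_zero_of_neg_mem_faceLattice {κ : Type} [Fintype κ] {D : ℕ}
    {p : κ → EuclideanSpace ℝ (Fin D)} {c : κ → ℝ} (hc : ∑ k, c k = 0)
    (hcp : ∀ i, ∑ k, c k * p k i = 0) (h : {k | c k < 0} ∈ faceLattice p) : c = 0 := by
  obtain ⟨u, b, hnn, hS⟩ := (mem_faceLattice_iff p _).1 h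
  have hsum : ∑ k, c k * (∑ i, u i * p k i + b) = 0 := by
    simp only [mul_add, Finset.sum_add_distrib, Finset.mul_sum]
    rw [Finset.sum_comm, ← Finset.sum_mul, hc, zero_mul, add_zero]
    refine Finset.sum_eq_zero fun i _ => ?_
    calc ∑ k, c k * (u i * p k i) = u i * ∑ k, c k * p k i := by
          rw [Finset.mul_sum]; exact Finset.sum_congr rfl fun k _ => by ring
      _ = 0 := by rw [hcp i, mul_zero]
  have hmem : ∀ k, c k < 0 ↔ ∑ i, u i * p k i + b = 0 := fun k => by
    have := congrArg (fun T : Set κ => k ∈ T) hS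
    simpa using this
  have hterm : ∀ k ∈ Finset.univ, 0 ≤ c k * (∑ i, u i * p k i + b) := by
    intro k _
    by_cases hk : c k < 0
    · rw [(hmem k).1 hk, mul_zero]
    · exact mul_nonneg (not_lt.1 hk) (hnn k)
  have hz := (Finset.sum_eq_zero_iff_of_nonneg hterm).1 hsum
  have hnonpos : ∀ k ∈ Finset.univ, c k ≤ 0 := by
    intro k hk
    by_cases hk' : c k < 0
    · exact hk'.le
    · rcases mul_eq_zero.1 (hz k hk) with h0 | h0
      · exact h0.le
      · exact absurd ((hmem k).2 h0) hk'
  funext k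
  exact (Finset.sum_eq_zero_iff_of_nonpos hnonpos).1 hc k (Finset.mem_univ k)

open Classical in
theorem HasBalancedFaces.card_neg {D : ℕ} {p : (J × Bool) ⊕ Bool → EuclideanSpace ℝ (Fin D)}
    (h : HasBalancedFaces (faceLattice p)) {c : (J × Bool) ⊕ Bool → ℝ} (hc0 : c ≠ 0)
    (hc : ∑ k, c k = 0) (hcp : ∀ i, ∑ k, c k * p k i = 0) :
    Fintype.card J ≤ (Finset.univ.filter fun k => c k < 0).card ∧
    ((∃ j, c (Sum.inl (j, false)) < 0 ∧ c (Sum.inl (j, true)) < 0) →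
      Fintype.card J + 1 ≤ (Finset.univ.filter fun k => c k < 0).card) := by
  constructor
  · by_contra hcon
    refine hc0 (eq_zero_of_neg_mem_faceLattice hc hcp ?_)
    simpa using h.of_card_lt _ (not_le.1 hcon)
  · rintro ⟨j, h0, h1⟩
    by_contra hcon
    refine hc0 (eq_zero_of_neg_mem_faceLattice hc hcp ?_)
    simpa using h.of_pair _ (Nat.lt_succ_iff.1 (not_le.1 hcon)) j (by simpa using h0)
      (by simpa using h1)

theorem HasBalancedFaces.isBalanced {D : ℕ} {p : (J × Bool) ⊕ Bool → EuclideanSpace ℝ (Fin D)}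
    (h : HasBalancedFaces (faceLattice p)) {x : (J × Bool) ⊕ Bool → Fin 3 → ℝ}
    (hx : IsAffineGaleDual p x) (hspan : ∀ ξ, (∀ k, ξ ⬝ᵥ x k = 0) → ξ = 0) : IsBalanced x := by
  intro ξ hξ
  have hlin : ∀ w : (J × Bool) ⊕ Bool → ℝ, ∑ k, w k • x k = 0 → ∑ k, ξ ⬝ᵥ x k * w k = 0 := by
    intro w hw
    have := congrArg (fun v => ξ ⬝ᵥ v) hw
    simp only [dotProduct_sum, dotProduct_smul, smul_eq_mul, dotProduct_zero] at this
    rw [← this]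
    exact Finset.sum_congr rfl fun k _ => mul_comm _ _
  refine h.card_neg (c := fun k => ξ ⬝ᵥ x k) (fun h0 => hξ (hspan ξ (congrFun h0))) ?_ fun i => ?_
  · simpa using hlin (fun _ => 1) ((hx _).1 ⟨0, 1, by simp⟩)
  · exact hlin (fun k => p k i) ((hx _).1 ⟨Pi.single i 1, 0, by simp [Pi.single_apply]⟩)

open Classical in
theorem card_neg_add_card_neg_add_card_zero_le {κ : Type} [Fintype κ] (x : κ → Fin 3 → ℝ)
    (ξ : Fin 3 → ℝ) (Z : Finset κ) (hZ : ∀ k ∈ Z, ξ ⬝ᵥ x k = 0) :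
    (Finset.univ.filter fun k => ξ ⬝ᵥ x k < 0).card
      + (Finset.univ.filter fun k => -ξ ⬝ᵥ x k < 0).card + Z.card ≤ Fintype.card κ := by
  have d1 : Disjoint (Finset.univ.filter fun k => ξ ⬝ᵥ x k < 0)
      (Finset.univ.filter fun k => -ξ ⬝ᵥ x k < 0) := by
    rw [Finset.disjoint_left]
    intro k hk hk'
    simp only [Finset.mem_filter, Finset.mem_univ, true_and, neg_dotProduct] at hk hk'
    linarith
  rw [← Finset.card_union_of_disjoint d1, ← Finset.card_union_of_disjoint]
  · exact Finset.card_le_univ _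
  · rw [Finset.disjoint_left]
    intro k hk hk'
    simp only [Finset.mem_union, Finset.mem_filter, Finset.mem_univ, true_and,
      neg_dotProduct, hZ k hk'] at hk
    simp at hk

theorem card_labels : Fintype.card ((J × Bool) ⊕ Bool) = 2 * Fintype.card J + 2 := by
  simp; ring

/-- Three vectors on a plane would leave too few vectors for the two open half-spaces. -/
theorem IsBalanced.det3Of_ne_zero {x : (J × Bool) ⊕ Bool → Fin 3 → ℝ} (h : IsBalanced x)
    {T : Fin 3 → (J × Bool) ⊕ Bool} (hT : Function.Injective T) : det3Of x T ≠ 0 := by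
  classical
  intro h0
  obtain ⟨ξ, hξ, h1, h2, h3⟩ := exists_dot_eq_zero h0
  have hle := card_neg_add_card_neg_add_card_zero_le x ξ (Finset.univ.image T) (by
    intro k hk
    obtain ⟨i, -, rfl⟩ := Finset.mem_image.1 hk
    fin_cases i
    · exact h1
    · exact h2
    · exact h3)
  rw [Finset.card_image_of_injective _ hT, card_labels] at hle
  have e1 := (h ξ hξ).1
  have e2 := (h (-ξ) (neg_ne_zero.2 hξ)).1
  simp only [Finset.card_univ, Fintype.card_fin] at hle
  omega

/-- The members of a pair lie on opposite sides of each plane spanned by two other vectors. -/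
theorem IsBalanced.det3_mul_neg {x : (J × Bool) ⊕ Bool → Fin 3 → ℝ} (h : IsBalanced x) (i : J)
    {a b : (J × Bool) ⊕ Bool} (hab : a ≠ b) (ha : ∀ q, a ≠ Sum.inl (i, q))
    (hb : ∀ q, b ≠ Sum.inl (i, q)) :
    det3 (x (Sum.inl (i, false))) (x a) (x b) * det3 (x (Sum.inl (i, true))) (x a) (x b) < 0 := by
  classical
  obtain ⟨ξ, hξ⟩ := exists_dot_eq_det3 (x a) (x b)
  have hne : ∀ q, det3 (x (Sum.inl (i, q))) (x a) (x b) ≠ 0 := by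
    intro q
    exact h.det3Of_ne_zero (T := ![Sum.inl (i, q), a, b])
      (injective_vec3 (ha q).symm (hb q).symm hab)
  have hξ0 : ξ ≠ 0 := by
    rintro rfl
    exact hne true (by rw [← hξ, zero_dotProduct])
  have hle := card_neg_add_card_neg_add_card_zero_le x ξ {a, b} (by
    intro k hk
    simp only [Finset.mem_insert, Finset.mem_singleton] at hk
    rcases hk with rfl | rfl
    · rw [hξ, det3_self_left]
    · rw [hξ, det3_self_mid])
  rw [Finset.card_pair hab, card_labels] at hle
  obtain ⟨e1, e1'⟩ := h ξ hξ0
  obtain ⟨e2, e2'⟩ := h (-ξ) (neg_ne_zero.2 hξ0)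
  simp only [neg_dotProduct] at e2 e2' hle
  have n1 : ¬ (ξ ⬝ᵥ x (Sum.inl (i, false)) < 0 ∧ ξ ⬝ᵥ x (Sum.inl (i, true)) < 0) := by
    intro hc
    have := e1' ⟨i, hc⟩
    omega
  have n2 : ¬ (-(ξ ⬝ᵥ x (Sum.inl (i, false))) < 0 ∧ -(ξ ⬝ᵥ x (Sum.inl (i, true))) < 0) := by
    intro hc
    have := e2' ⟨i, hc⟩
    omega
  rw [hξ, hξ] at n1 n2
  rcases lt_or_gt_of_ne (hne false) with h1 | h1 <;> rcases lt_or_gt_of_ne (hne true) with h2 | h2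
  · exact absurd ⟨h1, h2⟩ n1
  · exact mul_neg_of_neg_of_pos h1 h2
  · exact mul_neg_of_pos_of_neg h1 h2
  · exact absurd ⟨neg_lt_zero.2 h1, neg_lt_zero.2 h2⟩ n2

/-- Passing from the first to the second member of a pair changes signs as passing from `y` to
`-y` does. -/
theorem IsBalanced.sign_det3Of {x : (J × Bool) ⊕ Bool → Fin 3 → ℝ} (h : IsBalanced x)
    {ι : Type} {q : ι → J} (hq : Function.Injective q) (b : ι → Bool)
    {T : Fin 3 → ι} (hT : Function.Injective T) :
    SignType.sign (det3Of (fun l => labelSign (b l) • x (Sum.inl (q l, false))) T)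
      = SignType.sign (det3Of (fun l => x (Sum.inl (q l, b l))) T) := by
  have hij : q (T 0) ≠ q (T 1) := (hq.comp hT).ne (by decide)
  have hik : q (T 0) ≠ q (T 2) := (hq.comp hT).ne (by decide)
  have hjk : q (T 1) ≠ q (T 2) := (hq.comp hT).ne (by decide)
  simp only [det3Of]
  rw [det3_smul]
  generalize b (T 0) = p, b (T 1) = r, b (T 2) = s
  generalize q (T 0) = i, q (T 1) = j, q (T 2) = k at *
  set E : Bool → Bool → Bool → ℝ := fun p r s =>
    det3 (x (Sum.inl (i, p))) (x (Sum.inl (j, r))) (x (Sum.inl (k, s))) with hE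
  have hne : ∀ p r s, E p r s ≠ 0 := by
    intro p r s
    exact h.det3Of_ne_zero (T := ![Sum.inl (i, p), Sum.inl (j, r), Sum.inl (k, s)])
      (injective_vec3 (by simp [hij]) (by simp [hik]) (by simp [hjk]))
  have f1 : ∀ p r s, 0 < labelSign p * (E false r s * E p r s) := by
    intro p r s
    cases p
    · simpa [labelSign] using mul_self_pos.2 (hne false r s)
    · have := h.det3_mul_neg i (a := Sum.inl (j, r)) (b := Sum.inl (k, s)) (by simp [hjk])
        (by simp [hij.symm]) (by simp [hik.symm])
      simpa [labelSign, hE] using this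
  have f2 : ∀ p r s, 0 < labelSign r * (E p false s * E p r s) := by
    intro p r s
    cases r
    · simpa [labelSign] using mul_self_pos.2 (hne p false s)
    · have := h.det3_mul_neg j (a := Sum.inl (i, p)) (b := Sum.inl (k, s)) (by simp [hik])
        (by simp [hij]) (by simp [hjk.symm])
      rw [det3_swap_left (x (Sum.inl (i, p))), det3_swap_left (x (Sum.inl (i, p))),
        neg_mul_neg] at this
      simpa [labelSign, hE] using this
  have f3 : ∀ p r s, 0 < labelSign s * (E p r false * E p r s) := by
    intro p r s
    cases s
    · simpa [labelSign] using mul_self_pos.2 (hne p r false)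
    · have := h.det3_mul_neg k (a := Sum.inl (i, p)) (b := Sum.inl (j, r)) (by simp [hij])
        (by simp [hik]) (by simp [hjk])
      rw [← det3_rotate, ← det3_rotate (x (Sum.inl (k, true)))] at this
      simpa [labelSign, hE] using this
  have key : 0 < (labelSign p * labelSign r * labelSign s * E false false false) * E p r s := by
    have h1 := mul_pos (mul_pos (f1 p r s) (f2 false r s)) (f3 false false s)
    have h2 : 0 < (E false r s * E false r s) * (E false false s * E false false s) :=
      mul_pos (mul_self_pos.2 (hne _ _ _)) (mul_self_pos.2 (hne _ _ _))
    have h3 : labelSign p * (E false r s * E p r s)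
        * (labelSign r * (E false false s * E false r s))
        * (labelSign s * (E false false false * E false false s))
        = (labelSign p * labelSign r * labelSign s * E false false false) * E p r s
          * ((E false r s * E false r s) * (E false false s * E false false s)) := by ring
    rw [h3] at h1
    exact (pos_iff_pos_of_mul_pos h1).2 h2
  change SignType.sign (_ * E false false false) = SignType.sign (E p r s)
  rcases pos_and_pos_or_neg_and_neg_of_mul_pos key with ⟨h1, h2⟩ | ⟨h1, h2⟩
  · rw [sign_pos h1, sign_pos h2]
  · rw [sign_neg h1, sign_neg h2]

/-- Balanced configurations with the same dual faces have, on the first members of the pairs, the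
same chirotope up to a global sign. -/
theorem IsBalanced.sign_det3Of_mul_eq [DecidableEq J] {x x' : (J × Bool) ⊕ Bool → Fin 3 → ℝ}
    (h : IsBalanced x) (h' : IsBalanced x') (hf : ∀ S, IsDualFace x S → IsDualFace x' S)
    (hJ : 3 < Fintype.card J) {T T' : Fin 3 → J} (hT : Function.Injective T)
    (hT' : Function.Injective T') :
    SignType.sign (det3Of (fun i => x (Sum.inl (i, false))) T *
        det3Of (fun i => x' (Sum.inl (i, false))) T)
      = SignType.sign (det3Of (fun i => x (Sum.inl (i, false))) T' *
        det3Of (fun i => x' (Sum.inl (i, false))) T') := by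
  refine eq_of_exchange_invariant hJ (fun T => SignType.sign
    (det3Of (fun i => x (Sum.inl (i, false))) T * det3Of (fun i => x' (Sum.inl (i, false))) T))
    ?_ hT hT'
  clear hT hT' T T'
  intro T p m hT hm
  set y : J → Fin 3 → ℝ := fun i => x (Sum.inl (i, false)) with hy
  set y' : J → Fin 3 → ℝ := fun i => x' (Sum.inl (i, false)) with hy'
  obtain ⟨a, b, hab, hpa, hpb, hr, hD⟩ := det3Of_update T hT p
  rw [hr] at hm
  simp only [Set.mem_insert_iff, Set.mem_singleton_iff, not_or] at hm
  obtain ⟨hm1, hm2, hm3⟩ := hm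
  have hDT : ∀ y : J → Fin 3 → ℝ, det3Of y T = det3 (y (T p)) (y a) (y b) := by
    intro y; rw [← hD y (T p), Function.update_eq_self]
  rw [hD, hD, hDT, hDT]
  set q : Fin 4 → J := ![T p, m, a, b] with hq
  have hqi : Function.Injective q := by
    intro i j hij
    fin_cases i <;> fin_cases j <;> simp_all
  -- An exchange involves four pairs. The linear dependency of their first members, given by
  -- Cramer's rule, determines the effect of the exchange on the sign; its signs are visible in the
  -- dual faces.
  have hne : ∀ i j k : Fin 4, i ≠ j → i ≠ k → j ≠ k → det3 (y (q i)) (y (q j)) (y (q k)) ≠ 0 := by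
    intro i j k hij hik hjk
    refine h.det3Of_ne_zero (T := fun l => Sum.inl (q (![i, j, k] l), false)) ?_
    intro l l' hl
    exact injective_vec3 hij hik hjk (hqi (by simpa using hl))
  set c : Fin 4 → ℝ := ![det3 (y (q 1)) (y (q 2)) (y (q 3)), -det3 (y (q 0)) (y (q 2)) (y (q 3)),
    det3 (y (q 0)) (y (q 1)) (y (q 3)), -det3 (y (q 0)) (y (q 1)) (y (q 2))] with hc
  have hc0 : ∀ l, c l ≠ 0 := by
    intro l
    fin_cases l
    · exact hne 1 2 3 (by decide) (by decide) (by decide)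
    · exact neg_ne_zero.2 (hne 0 2 3 (by decide) (by decide) (by decide))
    · exact hne 0 1 3 (by decide) (by decide) (by decide)
    · exact neg_ne_zero.2 (hne 0 1 2 (by decide) (by decide) (by decide))
  have hcs : ∑ l, c l • y (q l) = 0 := by
    rw [Fin.sum_univ_four]
    simp only [hc, Matrix.cons_val]
    generalize y (q 0) = v₀, y (q 1) = v₁, y (q 2) = v₂, y (q 3) = v₃
    funext k
    fin_cases k <;> simp [det3] <;> ring
  -- Choosing from each pair according to the sign makes the dependency positive.
  set s : Fin 4 → Bool := fun l => decide (c l < 0) with hs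
  have habs : ∀ l, |c l| * labelSign (s l) = c l := by
    intro l
    by_cases hl : c l < 0
    · simp [hs, labelSign, hl, abs_of_neg hl]
    · simp [hs, labelSign, hl, abs_of_nonneg (not_lt.1 hl)]
  have hsign := fun (T : Fin 3 → Fin 4) (hT : Function.Injective T) => h.sign_det3Of hqi s hT
  have hsign' := fun (T : Fin 3 → Fin 4) (hT : Function.Injective T) => h'.sign_det3Of hqi s hT
  set z : Fin 4 → (J × Bool) ⊕ Bool := fun l => Sum.inl (q l, s l) with hz
  have hzi : Function.Injective z := fun l l' hl => hqi (by simp [hz] at hl; exact hl.1)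
  obtain ⟨c₁, hc₁, hc₁s⟩ := exists_positive_quadruple_transfer
    (x := fun l => labelSign (s l) • y (q l)) (x' := fun l => x (z l))
    (fun T hT => by
      rw [← sign_ne_zero, hsign T hT, sign_ne_zero]
      exact h.det3Of_ne_zero (hzi.comp hT)) hsign (fun l => abs_pos.2 (hc0 l)) (by
      simp only [smul_smul, habs]; exact hcs)
  have hface : IsDualFace x (Set.range z)ᶜ := by
    refine ⟨pushWeight z c₁, fun k => Finset.sum_nonneg fun l _ => ?_, ?_, ?_⟩
    · split_ifs
      · exact (hc₁ l).le
      · exact le_rfl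
    · rw [sum_pushWeight, hc₁s]
    · ext k
      simp only [Set.mem_ofPred_eq]
      by_cases hk : k ∈ Set.range z
      · obtain ⟨l, rfl⟩ := hk
        rw [pushWeight_apply hzi]
        exact iff_of_false (fun h => h ⟨l, rfl⟩) (hc₁ l).ne'
      · exact iff_of_true hk (pushWeight_of_notMem _ hk)
  obtain ⟨w, hw, hws, hwS⟩ := hf _ hface
  have hwz : ∀ k, w k = 0 ↔ k ∉ Set.range z := fun k => by
    have := congrArg (fun S : Set _ => k ∈ S) hwS
    simpa using this.symm
  obtain ⟨c₂, hc₂, hc₂s⟩ := exists_positive_quadruple_transfer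
    (x := fun l => x' (z l)) (x' := fun l => labelSign (s l) • y' (q l))
    (fun T hT => h'.det3Of_ne_zero (hzi.comp hT)) (fun T hT => (hsign' T hT).symm)
    (c := fun l => w (z l))
    (fun l => lt_of_le_of_ne (hw _) (fun h0 => (hwz (z l)).1 h0.symm ⟨l, rfl⟩)) (by
      rw [← sum_pushWeight z (fun l => w (z l)), ← hws]
      refine Finset.sum_congr rfl fun k _ => ?_
      congr 1
      by_cases hk : k ∈ Set.range z
      · obtain ⟨l, rfl⟩ := hk
        rw [pushWeight_apply hzi]
      · rw [pushWeight_of_notMem _ hk, (hwz k).2 hk])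
  have hex : ∀ (d : Fin 4 → ℝ) (y : J → Fin 3 → ℝ), ∑ l, d l • y (q l) = 0 →
      d 0 * det3 (y (T p)) (y a) (y b) + d 1 * det3 (y m) (y a) (y b) = 0 := by
    intro d y hd
    have := det3_sum Finset.univ d (fun l => y (q l)) (y a) (y b)
    rw [hd, det3_zero, Fin.sum_univ_four] at this
    simp only [hq, Matrix.cons_val, det3_self_left, det3_self_mid, mul_zero, add_zero] at this
    exact this.symm
  have e1 := hex c y hcs
  have e2 := hex (fun l => c₂ l * labelSign (s l)) y' (by simpa only [smul_smul] using hc₂s)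
  have hpos : ∀ l, 0 < c l * (c₂ l * labelSign (s l)) := by
    intro l
    rw [← habs l, show |c l| * labelSign (s l) * (c₂ l * labelSign (s l))
      = |c l| * c₂ l * (labelSign (s l) * labelSign (s l)) by ring, labelSign_mul_self, mul_one]
    exact mul_pos (abs_pos.2 (hc0 l)) (hc₂ l)
  exact (sign_mul_eq_of_exchange e1 e2 (by rw [sign_pos (hpos 0), sign_pos (hpos 1)])
    (hpos 0).ne').symm

end

/-! ### Continuous choice of small parameters -/

open Filter Topology in
/-- A condition that holds for all small positive values of a parameter, locally uniformly in a
point of a paracompact space, can be met by a continuous positive parameter. -/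
theorem exists_continuous_pos_of_eventually {Z : Type} [TopologicalSpace Z] [NormalSpace Z]
    [ParacompactSpace Z] {G : Z → ℝ → Prop}
    (h : ∀ z, ∀ᶠ p : Z × ℝ in 𝓝 z ×ˢ 𝓝[>] (0 : ℝ), G p.1 p.2) :
    ∃ t : C(Z, ℝ), ∀ z, 0 < t z ∧ G z (t z) := by
  have hconv : ∀ z, Convex ℝ {t : ℝ | 0 < t ∧ ∀ s, 0 < s → s ≤ t → G z s} := by
    intro z
    refine Set.OrdConnected.convex ⟨fun a ha b hb c hc => ?_⟩
    exact ⟨ha.1.trans_le hc.1, fun s hs hsc => hb.2 s hs (hsc.trans hc.2)⟩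
  obtain ⟨t, ht⟩ := exists_continuous_forall_mem_convex_of_local_const hconv (fun z => by
    obtain ⟨pa, hpa, pb, hpb, hG⟩ := Filter.eventually_prod_iff.1 (h z)
    obtain ⟨c, hc, hcb⟩ := mem_nhdsGT_iff_exists_Ioo_subset.1 hpb
    have hc' : (0 : ℝ) < c := hc
    refine ⟨c / 2, hpa.mono fun z' hz' => ⟨half_pos hc', fun s hs hsc => hG hz' (hcb ⟨hs, ?_⟩)⟩⟩
    linarith)
  exact ⟨t, fun z => ⟨(ht z).1, (ht z).2 _ (ht z).1 le_rfl⟩⟩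

open Filter Topology in
theorem eventually_of_continuousAt_pos {Z : Type} [TopologicalSpace Z] {F : Z × ℝ → ℝ} {z : Z}
    (hF : ContinuousAt F (z, 0)) (h0 : 0 < F (z, 0)) :
    ∀ᶠ p : Z × ℝ in 𝓝 z ×ˢ 𝓝[>] (0 : ℝ), 0 < F p := by
  have h1 : ∀ᶠ p in 𝓝 (z, (0 : ℝ)), 0 < F p := hF.eventually (lt_mem_nhds h0)
  rw [nhds_prod_eq] at h1
  exact h1.filter_mono (Filter.prod_mono le_rfl nhdsWithin_le_nhds)

open Filter Topology in
theorem eventually_snd_pos {Z : Type} [TopologicalSpace Z] (z : Z) :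
    ∀ᶠ p : Z × ℝ in 𝓝 z ×ˢ 𝓝[>] (0 : ℝ), 0 < p.2 :=
  Filter.tendsto_snd.eventually self_mem_nhdsWithin

open Filter Topology in
/-- The sign of a quadratic polynomial at small positive arguments is that of its first nonzero
coefficient; it is constant if the signs of the coefficients are. -/
theorem exists_sign_of_quadratic {Z : Type} [TopologicalSpace Z] {D : Fin 3 → Z → ℝ}
    (hD : ∀ k, Continuous (D k)) {e : Fin 3 → ℝ}
    (he : ∀ k, (∀ z, 0 < e k * D k z) ∨ (e k = 0 ∧ ∀ z, D k z = 0)) (hne : ∃ k, e k ≠ 0) :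
    ∃ c : ℝ, c ≠ 0 ∧ ∀ z, ∀ᶠ p : Z × ℝ in 𝓝 z ×ˢ 𝓝[>] (0 : ℝ),
      0 < c * (D 0 p.1 + p.2 * D 1 p.1 + p.2 ^ 2 * D 2 p.1) := by
  have h0 := hD 0
  have h1 := hD 1
  have h2 := hD 2
  by_cases e0 : e 0 = 0
  · have z0 : ∀ z, D 0 z = 0 := (he 0).elim (fun h z => absurd (h z) (by simp [e0])) (·.2)
    by_cases e1 : e 1 = 0
    · have z1 : ∀ z, D 1 z = 0 := (he 1).elim (fun h z => absurd (h z) (by simp [e1])) (·.2)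
      have e2 : e 2 ≠ 0 := by
        obtain ⟨k, hk⟩ := hne
        fin_cases k
        · exact absurd e0 hk
        · exact absurd e1 hk
        · exact hk
      refine ⟨e 2, e2, fun z => (eventually_snd_pos z).mono fun p hp => ?_⟩
      have := ((he 2).resolve_right fun h => e2 h.1) p.1
      rw [z0, z1, show e 2 * (0 + p.2 * 0 + p.2 ^ 2 * D 2 p.1) = p.2 ^ 2 * (e 2 * D 2 p.1) by ring]
      positivity
    · have hp := (he 1).resolve_right fun h => e1 h.1
      refine ⟨e 1, e1, fun z => ?_⟩
      have hev := eventually_of_continuousAt_pos (z := z)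
        (F := fun p => e 1 * (D 1 p.1 + p.2 * D 2 p.1)) (by fun_prop) (by simpa using hp z)
      refine (hev.and (eventually_snd_pos z)).mono fun p ⟨h, hp⟩ => ?_
      rw [z0, show e 1 * (0 + p.2 * D 1 p.1 + p.2 ^ 2 * D 2 p.1)
        = p.2 * (e 1 * (D 1 p.1 + p.2 * D 2 p.1)) by ring]
      exact mul_pos hp h
  · have hp := (he 0).resolve_right fun h => e0 h.1
    refine ⟨e 0, e0, fun z => ?_⟩
    exact eventually_of_continuousAt_pos (z := z)
      (F := fun p => e 0 * (D 0 p.1 + p.2 * D 1 p.1 + p.2 ^ 2 * D 2 p.1)) (by fun_prop)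
      (by simpa using hp z)

theorem continuous_det3 : Continuous fun q : (Fin 3 → ℝ) × (Fin 3 → ℝ) × (Fin 3 → ℝ) =>
    det3 q.1 q.2.1 q.2.2 := by
  unfold det3; fun_prop

theorem Continuous.det3 {X : Type} [TopologicalSpace X] {a b c : X → Fin 3 → ℝ}
    (ha : Continuous a) (hb : Continuous b) (hc : Continuous c) :
    Continuous fun t => det3 (a t) (b t) (c t) :=
  continuous_det3.comp (ha.prodMk (hb.prodMk hc))

open Filter Topology in
/-- The conditions of `IsGood` hold for small `ε` as soon as they hold in the limit `ε = 0`. -/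
theorem eventually_isGood {J : Type} [Finite J] {Z : Type} [TopologicalSpace Z]
    {y : Z → J → Fin 3 → ℝ} (hy : Continuous y) {S T : Z × ℝ → Fin 3 → ℝ} {z : Z}
    (hS : ContinuousAt S (z, 0)) (hT : ContinuousAt T (z, 0))
    (hyyy : ∀ i j k, i ≠ j → i ≠ k → j ≠ k → det3 (y z i) (y z j) (y z k) ≠ 0)
    (hyST : ∀ i, det3 (y z i) (S (z, 0)) (T (z, 0)) ≠ 0)
    (hyyS : ∀ i j, i ≠ j → |det3 (y z i) (y z j) (T (z, 0))| < |det3 (y z i) (y z j) (S (z, 0))|) :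
    ∀ᶠ p : Z × ℝ in 𝓝 z ×ˢ 𝓝[>] (0 : ℝ), IsGood (y p.1) (S p) (T p) p.2 := by
  set Q := (J → Fin 3 → ℝ) × (Fin 3 → ℝ) × (Fin 3 → ℝ) × ℝ
  set q : Z × ℝ → Q := fun p => (y p.1, S p, T p, p.2) with hq
  have hqc : ContinuousAt q (z, 0) :=
    (hy.comp continuous_fst).continuousAt.prodMk (hS.prodMk (hT.prodMk continuousAt_snd))
  have cy : ∀ i, Continuous fun v : Q => v.1 i := fun i => (continuous_apply i).comp continuous_fst
  have cS : Continuous fun v : Q => v.2.1 := by fun_prop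
  have cT : Continuous fun v : Q => v.2.2.1 := by fun_prop
  have cε : Continuous fun v : Q => v.2.2.2 := by fun_prop
  have hev : ∀ {U : Set Q}, IsOpen U → q (z, 0) ∈ U →
      ∀ᶠ p : Z × ℝ in 𝓝 z ×ˢ 𝓝[>] (0 : ℝ), q p ∈ U := by
    intro U hU hmem
    have h1 : ∀ᶠ p in 𝓝 (z, (0 : ℝ)), q p ∈ U := hqc.eventually (hU.mem_nhds hmem)
    rw [nhds_prod_eq] at h1
    exact h1.filter_mono (Filter.prod_mono le_rfl nhdsWithin_le_nhds)
  have imp : ∀ {P : Prop} {R : Z × ℝ → Prop}, (P → ∀ᶠ p : Z × ℝ in 𝓝 z ×ˢ 𝓝[>] (0 : ℝ), R p) →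
      ∀ᶠ p : Z × ℝ in 𝓝 z ×ˢ 𝓝[>] (0 : ℝ), P → R p := by
    intro P R h
    by_cases hP : P
    · exact (h hP).mono fun _ h _ => h
    · exact Eventually.of_forall fun _ h => absurd h hP
  have A1 : ∀ᶠ p : Z × ℝ in 𝓝 z ×ˢ 𝓝[>] (0 : ℝ), ∀ i j k, i ≠ j → i ≠ k → j ≠ k →
      det3 (y p.1 i) (y p.1 j) (y p.1 k) ≠ 0 := by
    refine eventually_all.2 fun i => eventually_all.2 fun j => eventually_all.2 fun k =>
      imp fun hij => imp fun hik => imp fun hjk => ?_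
    exact hev (U := {v | det3 (v.1 i) (v.1 j) (v.1 k) ≠ 0})
      (isOpen_ne_fun ((cy i).det3 (cy j) (cy k)) continuous_const) (hyyy i j k hij hik hjk)
  have A2 : ∀ᶠ p : Z × ℝ in 𝓝 z ×ˢ 𝓝[>] (0 : ℝ), ∀ i, det3 (y p.1 i) (S p) (T p) ≠ 0 := by
    refine eventually_all.2 fun i => ?_
    exact hev (U := {v | det3 (v.1 i) v.2.1 v.2.2.1 ≠ 0})
      (isOpen_ne_fun ((cy i).det3 cS cT) continuous_const) (hyST i)
  have A3 : ∀ᶠ p : Z × ℝ in 𝓝 z ×ˢ 𝓝[>] (0 : ℝ), ∀ i j, i ≠ j →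
      |det3 (y p.1 i) (y p.1 j) (T p)| < |det3 (y p.1 i) (y p.1 j) (S p)| := by
    refine eventually_all.2 fun i => eventually_all.2 fun j => imp fun hij => ?_
    exact hev (U := {v | |det3 (v.1 i) (v.1 j) v.2.2.1| < |det3 (v.1 i) (v.1 j) v.2.1|})
      (isOpen_lt ((cy i).det3 (cy j) cT).abs ((cy i).det3 (cy j) cS).abs) (hyyS i j hij)
  have A4 : ∀ᶠ p : Z × ℝ in 𝓝 z ×ˢ 𝓝[>] (0 : ℝ), ∀ i j k, i ≠ j → i ≠ k → j ≠ k →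
      p.2 * (|det3 (S p) (y p.1 j) (y p.1 k)| + |det3 (y p.1 i) (S p) (y p.1 k)|
        + |det3 (y p.1 i) (y p.1 j) (S p)|) < |det3 (y p.1 i) (y p.1 j) (y p.1 k)| := by
    refine eventually_all.2 fun i => eventually_all.2 fun j => eventually_all.2 fun k =>
      imp fun hij => imp fun hik => imp fun hjk => ?_
    refine hev (U := {v | v.2.2.2 * (|det3 v.2.1 (v.1 j) (v.1 k)| + |det3 (v.1 i) v.2.1 (v.1 k)|
        + |det3 (v.1 i) (v.1 j) v.2.1|) < |det3 (v.1 i) (v.1 j) (v.1 k)|})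
      (isOpen_lt (cε.mul (((cS.det3 (cy j) (cy k)).abs.add ((cy i).det3 cS (cy k)).abs).add
        ((cy i).det3 (cy j) cS).abs)) ((cy i).det3 (cy j) (cy k)).abs) ?_
    simpa [hq] using hyyy i j k hij hik hjk
  have A5 : ∀ᶠ p : Z × ℝ in 𝓝 z ×ˢ 𝓝[>] (0 : ℝ), ∀ i j (b : Bool), i ≠ j →
      p.2 * (|det3 (T p) (y p.1 j) (S p)| + |det3 (y p.1 i) (T p) (S p)|)
      < |det3 (y p.1 i) (y p.1 j) (S p) + labelSign b * det3 (y p.1 i) (y p.1 j) (T p)| := by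
    refine eventually_all.2 fun i => eventually_all.2 fun j => eventually_all.2 fun b =>
      imp fun hij => ?_
    refine hev (U := {v | v.2.2.2 * (|det3 v.2.2.1 (v.1 j) v.2.1| + |det3 (v.1 i) v.2.2.1 v.2.1|)
        < |det3 (v.1 i) (v.1 j) v.2.1 + labelSign b * det3 (v.1 i) (v.1 j) v.2.2.1|})
      (isOpen_lt (cε.mul ((cT.det3 (cy j) cS).abs.add ((cy i).det3 cT cS).abs))
        (((cy i).det3 (cy j) cS).add (continuous_const.mul ((cy i).det3 (cy j) cT))).abs) ?_
    have hb : |labelSign b| = 1 := by cases b <;> simp [labelSign]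
    obtain ⟨t, ht, hrt⟩ := exists_pos_mul_of_abs_lt (a := det3 (y z i) (y z j) (S (z, 0)))
      (r := labelSign b * det3 (y z i) (y z j) (T (z, 0))) (by
        rw [abs_mul, hb, one_mul]; exact hyyS i j hij)
    have hne : det3 (y z i) (y z j) (S (z, 0)) ≠ 0 :=
      abs_pos.1 ((abs_nonneg _).trans_lt (hyyS i j hij))
    simp only [hq, Set.mem_ofPred_eq, zero_mul, hrt]
    exact abs_pos.2 (mul_ne_zero ht.ne' hne)
  filter_upwards [eventually_snd_pos z, A1, A2, A3, A4, A5] with p h0 h1 h2 h3 h4 h5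
  exact ⟨h0, h1, h2, h3, h4, h5⟩

/-! ### Lightlike configurations -/

section
variable {r : ℕ}

/-- The labels of the dual configuration `stdDual M`. -/
abbrev DualLabel (r : ℕ) : Type := Fin r ⊕ Fin 3

/-- The labels of the polytope: a pair for each element of `DualLabel r`, and a further pair. -/
abbrev PolyLabel (r : ℕ) : Type := (DualLabel r × Bool) ⊕ Bool

/-- The height of the `i`-th pair that makes its first vector lightlike. -/
noncomputable def pairHeight (M : Fin r → Fin 3 → ℝ) (σ τ : DualLabel r → ℝ) (i : DualLabel r) :
    ℝ := (∑ c, stdConfig M i c ^ 2 + τ i ^ 2 - σ i ^ 2) / (2 * σ i)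

/-- The correction `κ` that makes the last pair of vectors lightlike. -/
noncomputable def lightCorrection (M : Fin r → Fin 3 → ℝ) (σ τ : DualLabel r → ℝ) (ε : ℝ) : ℝ :=
  ε ^ 2 * (∑ i, pairHeight M σ τ i ^ 2) / 4

/-- The space coordinates of the lightlike vectors. -/
noncomputable def lightSpace (M : Fin r → Fin 3 → ℝ) (σ τ : DualLabel r → ℝ) (ε : ℝ) :
    PolyLabel r → DualLabel r ⊕ Fin r ⊕ Unit → ℝ :=
  Sum.elim
    (fun p => if p.2 then Sum.elim (Pi.single p.1 1) 0
      else Sum.elim (Pi.single p.1 (pairHeight M σ τ p.1))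
        (Sum.elim (stdConfig M p.1) fun _ => τ p.1))
    (fun b => Sum.elim (fun i => ε * pairHeight M σ τ i)
      (Sum.elim 0 fun _ => labelSign b * (1 - lightCorrection M σ τ ε)))

/-- The time coordinates of the lightlike vectors. -/
noncomputable def lightTime (M : Fin r → Fin 3 → ℝ) (σ τ : DualLabel r → ℝ) (ε : ℝ) :
    PolyLabel r → ℝ :=
  Sum.elim (fun p => if p.2 then 1 else pairHeight M σ τ p.1 + σ p.1)
    (fun _ => 1 + lightCorrection M σ τ ε)

/-- The common direction of the last pair of vectors in the dual. -/
noncomputable def dualS (M : Fin r → Fin 3 → ℝ) (σ τ : DualLabel r → ℝ) (ε : ℝ) : Fin 3 → ℝ :=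
  -(1 + lightCorrection M σ τ ε - ε * ∑ i, pairHeight M σ τ i)⁻¹ • ∑ i, σ i • stdDual M i

/-- Half the difference of the last pair of vectors in the dual. -/
noncomputable def dualT (M : Fin r → Fin 3 → ℝ) (σ τ : DualLabel r → ℝ) (ε : ℝ) : Fin 3 → ℝ :=
  -(1 - lightCorrection M σ τ ε)⁻¹ • ∑ i, τ i • stdDual M i

/-- The positive factors between the dual of the lightlike vectors and `balancedConfig`. -/
noncomputable def dualScale (M : Fin r → Fin 3 → ℝ) (σ τ : DualLabel r → ℝ) : PolyLabel r → ℝ :=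
  Sum.elim (fun p => if p.2 then pairHeight M σ τ p.1 else 1) (fun _ => 1 / 2)

/-- The inequalities on the parameters under which the lightlike vectors lie in the future light
cone and their dual is a good balanced configuration. -/
structure IsAdmissible (M : Fin r → Fin 3 → ℝ) (σ τ : DualLabel r → ℝ) (ε : ℝ) : Prop where
  sigma_pos : ∀ i, 0 < σ i
  height_pos : ∀ i, 0 < pairHeight M σ τ i
  correction_lt : 0 < 1 - lightCorrection M σ τ ε
  denom_pos : 0 < 1 + lightCorrection M σ τ ε - ε * ∑ i, pairHeight M σ τ i
  good : IsGood (stdDual M) (dualS M σ τ ε) (dualT M σ τ ε) ε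

variable {M : Fin r → Fin 3 → ℝ} {σ τ : DualLabel r → ℝ} {ε : ℝ}

theorem lightCorrection_nonneg : 0 ≤ lightCorrection M σ τ ε := by
  unfold lightCorrection; positivity

theorem IsAdmissible.time_pos (h : IsAdmissible M σ τ ε) (k : PolyLabel r) :
    0 < lightTime M σ τ ε k := by
  rcases k with ⟨i, b⟩ | b
  · cases b
    · simpa [lightTime] using add_pos (h.height_pos i) (h.sigma_pos i)
    · simp [lightTime]
  · simpa [lightTime] using add_pos_of_pos_of_nonneg one_pos lightCorrection_nonneg

theorem IsAdmissible.scale_pos (h : IsAdmissible M σ τ ε) (k : PolyLabel r) :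
    0 < dualScale M σ τ k := by
  rcases k with ⟨i, b⟩ | b
  · cases b
    · simp [dualScale]
    · simpa [dualScale] using h.height_pos i
  · simp [dualScale]

theorem sum_spaceLabel (f : DualLabel r ⊕ Fin r ⊕ Unit → ℝ) :
    ∑ c, f c = ∑ i, f (Sum.inl i) + (∑ j, f (Sum.inr (Sum.inl j)) + f (Sum.inr (Sum.inr ()))) := by
  rw [Fintype.sum_sum_type, Fintype.sum_sum_type (fun c => f (Sum.inr c))]
  simp

/-- The vectors lie on the light cone. -/
theorem IsAdmissible.sum_space_sq (h : IsAdmissible M σ τ ε) (k : PolyLabel r) :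
    ∑ c, lightSpace M σ τ ε k c ^ 2 = lightTime M σ τ ε k ^ 2 := by
  have hsingle : ∀ (i : DualLabel r) (a : ℝ), ∑ j, (Pi.single i a : DualLabel r → ℝ) j ^ 2
      = a ^ 2 := by
    intro i a
    rw [Finset.sum_eq_single i]
    · simp
    · intro j _ hj; simp [Pi.single_eq_of_ne hj]
    · simp
  rw [sum_spaceLabel]
  rcases k with ⟨i, b⟩ | b
  · cases b
    · simp only [lightSpace, lightTime, Sum.elim_inl, Sum.elim_inr, Bool.false_eq_true, if_false,
        hsingle]
      have hs := (h.sigma_pos i).ne'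
      have key : pairHeight M σ τ i * (2 * σ i)
          = ∑ c, stdConfig M i c ^ 2 + τ i ^ 2 - σ i ^ 2 := by
        unfold pairHeight; field_simp
      linear_combination -key
    · simp only [lightSpace, lightTime, Sum.elim_inl, Sum.elim_inr, if_true, hsingle]
      simp
  · have hb : labelSign b ^ 2 = 1 := by rw [sq, labelSign_mul_self]
    simp only [lightSpace, lightTime, Sum.elim_inl, Sum.elim_inr, mul_pow, hb, ← Finset.mul_sum]
    have key : 4 * lightCorrection M σ τ ε = ε ^ 2 * ∑ i, pairHeight M σ τ i ^ 2 := by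
      unfold lightCorrection; ring
    rw [← key]
    simp only [Pi.zero_apply, ne_eq, OfNat.ofNat_ne_zero, not_false_eq_true, zero_pow,
      Finset.sum_const_zero]
    ring

/-- The Gale dual of the lightlike vectors. -/
noncomputable def lightDual (M : Fin r → Fin 3 → ℝ) (σ τ : DualLabel r → ℝ) (ε : ℝ) :
    PolyLabel r → Fin 3 → ℝ :=
  fun k => dualScale M σ τ k •
    balancedConfig (stdDual M) (dualS M σ τ ε) (dualT M σ τ ε) ε k

theorem sum_smul_lightDual (v : PolyLabel r → ℝ) :
    ∑ k, v k • lightDual M σ τ ε k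
      = ∑ i, v (Sum.inl (i, false)) • stdDual M i
        - ∑ i, (v (Sum.inl (i, true)) * pairHeight M σ τ i) •
            (stdDual M i + ε • dualS M σ τ ε)
        + ((v (Sum.inr false) + v (Sum.inr true)) / 2) • dualS M σ τ ε
        + ((v (Sum.inr false) - v (Sum.inr true)) / 2) • dualT M σ τ ε := by
  rw [Fintype.sum_sum_type, Fintype.sum_prod_type, Fintype.sum_bool]
  simp only [Fintype.sum_bool, Finset.sum_add_distrib, lightDual, dualScale, balancedConfig,
    Sum.elim_inl, Sum.elim_inr, if_true, Bool.false_eq_true, if_false, labelSign, zero_smul,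
    add_zero, one_smul]
  rw [add_comm (∑ i, _ ) (∑ i, v (Sum.inl (i, false)) • stdDual M i), sub_eq_add_neg,
    ← Finset.sum_neg_distrib, add_assoc, add_assoc, add_assoc]
  congr 1
  congr 1
  · exact Finset.sum_congr rfl fun i _ => by module
  · module

/-- The dependencies of `lightDual` are the values of linear functionals: the values on the second
members of the pairs and on the last pair can be prescribed, and what remains is a dependency of
`stdDual M`. -/
theorem IsAdmissible.isGaleDual (h : IsAdmissible M σ τ ε) :
    IsGaleDual (fun k => Sum.elim (lightSpace M σ τ ε k) (fun _ : Unit => lightTime M σ τ ε k))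
      (lightDual M σ τ ε) := by
  have hκ := h.correction_lt.ne'
  have hd := h.denom_pos.ne'
  set κ := lightCorrection M σ τ ε with hκdef
  set γ := pairHeight M σ τ with hγ
  have hσS : ∑ i, σ i • stdDual M i = -(1 + κ - ε * ∑ i, γ i) • dualS M σ τ ε := by
    rw [dualS, smul_smul, neg_mul_neg, mul_inv_cancel₀ hd, one_smul]
  have hτT : ∑ i, τ i • stdDual M i = -(1 - κ) • dualT M σ τ ε := by
    rw [dualT, smul_smul, neg_mul_neg, mul_inv_cancel₀ hκ, one_smul]
  -- The values of a functional, split into its components.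
  have hval : ∀ (u : (DualLabel r ⊕ Fin r ⊕ Unit) ⊕ Unit → ℝ) k,
      ∑ c, u c * Sum.elim (lightSpace M σ τ ε k) (fun _ : Unit => lightTime M σ τ ε k) c
      = ∑ i, u (Sum.inl (Sum.inl i)) * lightSpace M σ τ ε k (Sum.inl i)
        + (∑ j, u (Sum.inl (Sum.inr (Sum.inl j))) * lightSpace M σ τ ε k (Sum.inr (Sum.inl j))
        + u (Sum.inl (Sum.inr (Sum.inr ()))) * lightSpace M σ τ ε k (Sum.inr (Sum.inr ())))
        + u (Sum.inr ()) * lightTime M σ τ ε k := by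
    intro u k
    simp [Fintype.sum_sum_type]
  have hvy : ∀ (u : (DualLabel r ⊕ Fin r ⊕ Unit) ⊕ Unit → ℝ) i,
      ∑ c, u c * Sum.elim (lightSpace M σ τ ε (Sum.inl (i, false)))
        (fun _ : Unit => lightTime M σ τ ε (Sum.inl (i, false))) c
      = u (Sum.inl (Sum.inl i)) * γ i + ∑ j, u (Sum.inl (Sum.inr (Sum.inl j))) * stdConfig M i j
        + u (Sum.inl (Sum.inr (Sum.inr ()))) * τ i + u (Sum.inr ()) * (γ i + σ i) := by
    intro u i
    rw [hval]
    simp [lightSpace, lightTime, Pi.single_apply, hγ, add_assoc]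
  have hvz : ∀ (u : (DualLabel r ⊕ Fin r ⊕ Unit) ⊕ Unit → ℝ) i,
      ∑ c, u c * Sum.elim (lightSpace M σ τ ε (Sum.inl (i, true)))
        (fun _ : Unit => lightTime M σ τ ε (Sum.inl (i, true))) c
      = u (Sum.inl (Sum.inl i)) + u (Sum.inr ()) := by
    intro u i
    rw [hval]
    simp [lightSpace, lightTime, Pi.single_apply]
  have hve : ∀ (u : (DualLabel r ⊕ Fin r ⊕ Unit) ⊕ Unit → ℝ) b,
      ∑ c, u c * Sum.elim (lightSpace M σ τ ε (Sum.inr b))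
        (fun _ : Unit => lightTime M σ τ ε (Sum.inr b)) c
      = ε * ∑ i, u (Sum.inl (Sum.inl i)) * γ i
        + u (Sum.inl (Sum.inr (Sum.inr ()))) * (labelSign b * (1 - κ))
        + u (Sum.inr ()) * (1 + κ) := by
    intro u b
    rw [hval]
    simp [lightSpace, lightTime, hγ, Finset.mul_sum, hκdef, -Fintype.sum_sum_type]
    exact Finset.sum_congr rfl fun i _ => by ring
  have hfwd : ∀ (u : (DualLabel r ⊕ Fin r ⊕ Unit) ⊕ Unit → ℝ), ∑ k,
      (∑ c, u c * Sum.elim (lightSpace M σ τ ε k) (fun _ : Unit => lightTime M σ τ ε k) c) •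
        lightDual M σ τ ε k = 0 := by
    intro u
    rw [sum_smul_lightDual]
    simp only [hvy, hvz, hve, labelSign, if_true, Bool.false_eq_true, if_false]
    have hcfg : ∑ i, (∑ j, u (Sum.inl (Sum.inr (Sum.inl j))) * stdConfig M i j) • stdDual M i = 0 :=
      (isGaleDual_stdConfig M _).1 ⟨fun j => u (Sum.inl (Sum.inr (Sum.inl j))), fun _ => rfl⟩
    have e1 : ∑ i, (u (Sum.inl (Sum.inl i)) * γ i
        + ∑ j, u (Sum.inl (Sum.inr (Sum.inl j))) * stdConfig M i j
        + u (Sum.inl (Sum.inr (Sum.inr ()))) * τ i + u (Sum.inr ()) * (γ i + σ i)) • stdDual M i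
        = ∑ i, ((u (Sum.inl (Sum.inl i)) + u (Sum.inr ())) * γ i) • stdDual M i
          + u (Sum.inl (Sum.inr (Sum.inr ()))) • ∑ i, τ i • stdDual M i
          + u (Sum.inr ()) • ∑ i, σ i • stdDual M i := by
      rw [Finset.smul_sum, Finset.smul_sum, ← Finset.sum_add_distrib, ← Finset.sum_add_distrib,
        ← add_zero (∑ i, (_ + _) : Fin 3 → ℝ), ← hcfg, ← Finset.sum_add_distrib]
      exact Finset.sum_congr rfl fun i _ => by module
    have e2 : ∑ i, ((u (Sum.inl (Sum.inl i)) + u (Sum.inr ())) * γ i) •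
          (stdDual M i + ε • dualS M σ τ ε)
        = ∑ i, ((u (Sum.inl (Sum.inl i)) + u (Sum.inr ())) * γ i) • stdDual M i
          + (ε * ∑ i, u (Sum.inl (Sum.inl i)) * γ i + ε * u (Sum.inr ()) * ∑ i, γ i) •
            dualS M σ τ ε := by
      rw [Finset.mul_sum, Finset.mul_sum, ← Finset.sum_add_distrib, Finset.sum_smul,
        ← Finset.sum_add_distrib]
      exact Finset.sum_congr rfl fun i _ => by module
    rw [e1, e2, hσS, hτT]
    module
  intro w
  constructor
  · rintro ⟨u, hu⟩
    simp only [hu]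
    exact hfwd u
  · intro hw
    -- The functional is determined by its values on the second members of the pairs and on the
    -- last pair, up to a functional on the space of the configuration `stdConfig M`.
    set c₀ := (w (Sum.inr false) + w (Sum.inr true)
      - 2 * (ε * ∑ i, w (Sum.inl (i, true)) * γ i)) / (2 * (1 + κ - ε * ∑ i, γ i)) with hc₀
    set d₀ := (w (Sum.inr false) - w (Sum.inr true)) / (2 * (1 - κ)) with hd₀
    set U : (Fin r → ℝ) → (DualLabel r ⊕ Fin r ⊕ Unit) ⊕ Unit → ℝ := fun a =>
      Sum.elim (Sum.elim (fun i => w (Sum.inl (i, true)) - c₀) (Sum.elim a fun _ => d₀))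
        (fun _ => c₀) with hU
    have hc₀' : c₀ * (1 + κ - ε * ∑ i, γ i) = (w (Sum.inr false) + w (Sum.inr true)) / 2
        - ε * ∑ i, w (Sum.inl (i, true)) * γ i := by
      rw [hc₀]; field_simp
    have hd₀' : d₀ * (1 - κ) = (w (Sum.inr false) - w (Sum.inr true)) / 2 := by
      rw [hd₀]; field_simp
    have hz : ∀ a i, ∑ c, U a c * Sum.elim (lightSpace M σ τ ε (Sum.inl (i, true)))
        (fun _ : Unit => lightTime M σ τ ε (Sum.inl (i, true))) c = w (Sum.inl (i, true)) := by
      intro a i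
      rw [hvz]; simp [hU]
    have he : ∀ a b, ∑ c, U a c * Sum.elim (lightSpace M σ τ ε (Sum.inr b))
        (fun _ : Unit => lightTime M σ τ ε (Sum.inr b)) c = w (Sum.inr b) := by
      intro a b
      rw [hve]
      simp only [hU, Sum.elim_inl, Sum.elim_inr, sub_mul, Finset.sum_sub_distrib,
        ← Finset.mul_sum]
      cases b <;> simp only [labelSign, if_true, Bool.false_eq_true, if_false]
      · linear_combination hc₀' + hd₀'
      · linear_combination hc₀' - hd₀'
    set R : DualLabel r → ℝ := fun i => w (Sum.inl (i, false))
      - ∑ c, U 0 c * Sum.elim (lightSpace M σ τ ε (Sum.inl (i, false)))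
        (fun _ : Unit => lightTime M σ τ ε (Sum.inl (i, false))) c with hR
    have hRs : ∑ i, R i • stdDual M i = 0 := by
      have h1 := hfwd (U 0)
      rw [sum_smul_lightDual] at h1 hw
      simp only [hz, he] at h1
      simp only [hR, sub_smul, Finset.sum_sub_distrib]
      rw [sub_eq_zero]
      rw [← hw] at h1
      simpa using h1.symm
    obtain ⟨a, ha⟩ := (isGaleDual_stdConfig M R).2 hRs
    refine ⟨U a, ?_⟩
    rintro (⟨i, b⟩ | b)
    · cases b
      · have h1 := ha i
        simp only [hR] at h1
        rw [hvy] at h1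
        rw [hvy]
        simp only [hU, Sum.elim_inl, Sum.elim_inr, Pi.zero_apply, zero_mul,
          Finset.sum_const_zero] at h1 ⊢
        linarith
      · exact (hz a i).symm
    · exact (he a b).symm

end

/-! ### Inscribed realizations -/

section
variable {r D : ℕ} {M : Fin r → Fin 3 → ℝ} {σ τ : DualLabel r → ℝ} {ε : ℝ}

/-- The points of the unit sphere spanned by the lightlike vectors. -/
noncomputable def lightPoint (θ : DualLabel r ⊕ Fin r ⊕ Unit ≃ Fin D) (M : Fin r → Fin 3 → ℝ)
    (σ τ : DualLabel r → ℝ) (ε : ℝ) (k : PolyLabel r) : EuclideanSpace ℝ (Fin D) :=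
  WithLp.toLp 2 fun i => lightSpace M σ τ ε k (θ.symm i) / lightTime M σ τ ε k

theorem IsAdmissible.norm_lightPoint (h : IsAdmissible M σ τ ε)
    (θ : DualLabel r ⊕ Fin r ⊕ Unit ≃ Fin D) (k : PolyLabel r) :
    lightPoint θ M σ τ ε k ∈ Metric.sphere (0 : EuclideanSpace ℝ (Fin D)) 1 := by
  rw [mem_sphere_zero_iff_norm, EuclideanSpace.norm_eq, Real.sqrt_eq_one]
  have ht := (h.time_pos k).ne'
  simp only [lightPoint, Real.norm_eq_abs, sq_abs, div_pow, ← Finset.sum_div]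
  rw [Equiv.sum_comp θ.symm (fun c => lightSpace M σ τ ε k c ^ 2), h.sum_space_sq k,
    div_self (pow_ne_zero 2 ht)]

/-- The Gale dual of the points `lightPoint`. -/
noncomputable def pointDual (M : Fin r → Fin 3 → ℝ) (σ τ : DualLabel r → ℝ) (ε : ℝ) :
    PolyLabel r → Fin 3 → ℝ :=
  fun k => (lightTime M σ τ ε k * dualScale M σ τ k) •
    balancedConfig (stdDual M) (dualS M σ τ ε) (dualT M σ τ ε) ε k

/-- Dividing by the time coordinates multiplies the dual vectors by them. -/
theorem IsAdmissible.isAffineGaleDual (h : IsAdmissible M σ τ ε)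
    (θ : DualLabel r ⊕ Fin r ⊕ Unit ≃ Fin D) :
    IsAffineGaleDual (lightPoint θ M σ τ ε) (pointDual M σ τ ε) := by
  intro w
  have h1 : ∑ k, w k • pointDual M σ τ ε k
      = ∑ k, (w k * lightTime M σ τ ε k) • lightDual M σ τ ε k := by
    refine Finset.sum_congr rfl fun k _ => ?_
    simp only [pointDual, lightDual, smul_smul, mul_assoc]
  rw [h1, ← h.isGaleDual]
  have hval : ∀ (u : DualLabel r ⊕ Fin r ⊕ Unit → ℝ) (c : ℝ) k,
      (w k = ∑ i, u (θ.symm i) * lightPoint θ M σ τ ε k i + c ↔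
        w k * lightTime M σ τ ε k
          = ∑ a, u a * lightSpace M σ τ ε k a + c * lightTime M σ τ ε k) := by
    intro u c k
    have ht := (h.time_pos k).ne'
    have h2 : (∑ i, u (θ.symm i) * lightPoint θ M σ τ ε k i) * lightTime M σ τ ε k
        = ∑ a, u a * lightSpace M σ τ ε k a := by
      rw [← Equiv.sum_comp θ.symm (fun a => u a * lightSpace M σ τ ε k a), Finset.sum_mul]
      refine Finset.sum_congr rfl fun i _ => ?_
      simp only [lightPoint]
      field_simp
    rw [← h2, ← add_mul, mul_left_inj' ht]
  constructor
  · rintro ⟨u, c, hu⟩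
    refine ⟨Sum.elim (u ∘ θ) (fun _ => c), fun k => ?_⟩
    have := (hval (u ∘ θ) c k).1 (by simpa using hu k)
    rw [this]
    symm
    rw [Fintype.sum_sum_type]
    simp [-Fintype.sum_sum_type]
  · rintro ⟨u, hu⟩
    refine ⟨fun i => u (Sum.inl (θ.symm i)), u (Sum.inr ()), fun k => ?_⟩
    refine (hval (u ∘ Sum.inl) (u (Sum.inr ())) k).2 ?_
    rw [hu k, Fintype.sum_sum_type]
    simp [-Fintype.sum_sum_type]

theorem pointDual_inl_false (i : DualLabel r) : pointDual M σ τ ε (Sum.inl (i, false))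
    = lightTime M σ τ ε (Sum.inl (i, false)) • stdDual M i := by
  simp [pointDual, dualScale, balancedConfig, labelSign]

theorem IsAdmissible.isBalanced (h : IsAdmissible M σ τ ε) :
    IsBalanced (pointDual M σ τ ε) :=
  h.good.isBalanced.rescale (fun k => mul_pos (h.time_pos k) (h.scale_pos k)) fun _ => rfl

/-- Admissible lightlike configurations with the same sign data have the same face lattice. -/
theorem IsAdmissible.faceLattice_subset {M' : Fin r → Fin 3 → ℝ} {σ' τ' : DualLabel r → ℝ}
    {ε' : ℝ} (h : IsAdmissible M σ τ ε) (h' : IsAdmissible M' σ' τ' ε')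
    (hyyy : ∀ T : Fin 3 → DualLabel r, Function.Injective T →
      0 < det3Of (stdDual M) T * det3Of (stdDual M') T)
    (hyyS : ∀ i j, i ≠ j → 0 < det3 (stdDual M i) (stdDual M j) (dualS M σ τ ε)
      * det3 (stdDual M' i) (stdDual M' j) (dualS M' σ' τ' ε'))
    (hyST : ∀ i, 0 < det3 (stdDual M i) (dualS M σ τ ε) (dualT M σ τ ε)
      * det3 (stdDual M' i) (dualS M' σ' τ' ε') (dualT M' σ' τ' ε'))
    (θ : DualLabel r ⊕ Fin r ⊕ Unit ≃ Fin D) :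
    faceLattice (lightPoint θ M σ τ ε) ⊆ faceLattice (lightPoint θ M' σ' τ' ε') := by
  intro S hS
  rw [(h.isAffineGaleDual θ).mem_faceLattice] at hS
  rw [(h'.isAffineGaleDual θ).mem_faceLattice]
  refine hS.of_sign_eq (fun T hT => h.isBalanced.det3Of_ne_zero hT)
    (by simp; omega) fun T hT => ?_
  have hpos := h.good.det3Of_mul_pos h'.good
    (fun i j k hij hik hjk => hyyy ![i, j, k] (injective_vec3 hij hik hjk)) hyyS hyST hT
  have hs : ∀ {M : Fin r → Fin 3 → ℝ} {σ τ : DualLabel r → ℝ} {ε : ℝ}, IsAdmissible M σ τ ε →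
      SignType.sign (det3Of (pointDual M σ τ ε) T) = SignType.sign
        (det3Of (balancedConfig (stdDual M) (dualS M σ τ ε) (dualT M σ τ ε) ε) T) := by
    intro M σ τ ε h
    have hp := fun k => mul_pos (h.time_pos k) (h.scale_pos k)
    simp only [det3Of, pointDual]
    rw [det3_smul, sign_mul, sign_pos (mul_pos (mul_pos (hp _) (hp _)) (hp _)), one_mul]
  rw [hs h, hs h']
  rcases pos_and_pos_or_neg_and_neg_of_mul_pos hpos with ⟨h1, h2⟩ | ⟨h1, h2⟩
  · rw [sign_pos h1, sign_pos h2]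
  · rw [sign_neg h1, sign_neg h2]

end

/-! ### Existence of continuous admissible parameters -/

section
variable {r : ℕ}

/-- The matrices `M` for which `stdDual M` is in general position and has the same chirotope as
`stdDual M₀`. -/
def chirotopeSet (M₀ : Fin r → Fin 3 → ℝ) : Set (Fin r → Fin 3 → ℝ) :=
  {M | ∀ T, Function.Injective T → 0 < det3Of (stdDual M₀) T * det3Of (stdDual M) T}

/-- The entries of `M` are minors of `stdDual M`. -/
theorem det3_stdDual_entry {β : Type} (M : β → Fin 3 → ℝ) (q : β ⊕ Fin 3) (k : Fin 3) :
    det3 (stdDual M q) (Pi.single (k + 1) 1) (Pi.single (k + 2) 1) = stdDual M q k := by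
  generalize stdDual M q = v
  fin_cases k <;> simp [det3]

theorem entry_mul_pos {M₀ M : Fin r → Fin 3 → ℝ} (h : M ∈ chirotopeSet M₀) (j : Fin r)
    (k : Fin 3) : 0 < M₀ j k * M j k := by
  have hk : (Sum.inr (k + 1) : DualLabel r) ≠ Sum.inr (k + 2) := by
    simp
  have := h ![Sum.inl j, Sum.inr (k + 1), Sum.inr (k + 2)] (injective_vec3 (by simp) (by simp) hk)
  simp only [det3Of, Matrix.cons_val] at this
  have e := fun M : Fin r → Fin 3 → ℝ => det3_stdDual_entry M (Sum.inl j) k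
  simp only [stdDual_inl, stdDual_inr] at e this
  rwa [e, e] at this

/-- The moment curve in `ℝ³`. For small positive arguments, its points and tangents are in general
position with respect to finitely many given lines and planes through the origin. -/
def momentVec (ν : ℝ) : Fin 3 → ℝ := ![1, ν, ν ^ 2]

/-- The derivative of the moment curve. -/
def momentDeriv (ν : ℝ) : Fin 3 → ℝ := ![0, 1, 2 * ν]

theorem continuous_stdDual {Z : Type} [TopologicalSpace Z] {M : Z → Fin r → Fin 3 → ℝ}
    (hM : Continuous M) (q : DualLabel r) : Continuous fun z => stdDual (M z) q := by
  rcases q with j | k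
  · exact (continuous_apply j).comp hM
  · exact continuous_const

/-- The parameter `ν` of the moment curve can be chosen so small, continuously in the matrix, that
the determinants needed for `dualS` and `dualT` are nonzero; their signs, those of `cS` and `cT`, do
not depend on the matrix. -/
theorem exists_momentParameter {M₀ : Fin r → Fin 3 → ℝ} (hM₀ : M₀ ∈ chirotopeSet M₀) :
    ∃ (ν : C(chirotopeSet M₀, ℝ)) (cS : DualLabel r → DualLabel r → ℝ) (cT : DualLabel r → ℝ),
      ∀ z : chirotopeSet M₀, 0 < ν z ∧
        (∀ i j, i ≠ j → 0 < cS i j * det3 (stdDual z.1 i) (stdDual z.1 j) (momentVec (ν z))) ∧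
        (∀ i, 0 < cT i * det3 (stdDual z.1 i) (momentVec (ν z)) (momentDeriv (ν z))) := by
  have hc : ∀ q, Continuous fun z : chirotopeSet M₀ => stdDual z.1 q :=
    fun q => continuous_stdDual continuous_subtype_val q
  have hS : ∀ i j : DualLabel r, ∃ c : ℝ, i ≠ j → ∀ z : chirotopeSet M₀,
      ∀ᶠ p : chirotopeSet M₀ × ℝ in nhds z ×ˢ nhdsWithin (0 : ℝ) (Set.Ioi 0),
        0 < c * det3 (stdDual p.1.1 i) (stdDual p.1.1 j) (momentVec p.2) := by
    intro i j
    by_cases hij : i = j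
    · exact ⟨0, fun h => absurd hij h⟩
    obtain ⟨c, -, hc⟩ := exists_sign_of_quadratic (Z := chirotopeSet M₀)
      (D := fun k z => det3 (stdDual z.1 i) (stdDual z.1 j) (stdDual z.1 (Sum.inr k)))
      (e := fun k => det3 (stdDual M₀ i) (stdDual M₀ j) (stdDual M₀ (Sum.inr k)))
      (fun k => (hc i).det3 (hc j) (hc _))
      (fun k => by
        by_cases hik : i = Sum.inr k
        · right; subst hik; exact ⟨det3_self_mid _ _, fun z => det3_self_mid _ _⟩
        by_cases hjk : j = Sum.inr k
        · right; subst hjk; exact ⟨det3_self_right _ _, fun z => det3_self_right _ _⟩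
        left
        intro z
        exact z.2 ![i, j, Sum.inr k] (injective_vec3 hij hik hjk))
      (by
        obtain ⟨k, hik, hjk⟩ : ∃ k : Fin 3, i ≠ Sum.inr k ∧ j ≠ Sum.inr k := by
          rcases i with i | i <;> rcases j with j | j
          · exact ⟨0, by simp, by simp⟩
          · exact ⟨j + 1, by simp, by simp⟩
          · exact ⟨i + 1, by simp, by simp⟩
          · have : ∀ i j : Fin 3, ∃ k, i ≠ k ∧ j ≠ k := by decide
            obtain ⟨k, h1, h2⟩ := this i j
            exact ⟨k, by simpa using h1, by simpa using h2⟩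
        exact ⟨k, left_ne_zero_of_mul
          (hM₀ ![i, j, Sum.inr k] (injective_vec3 hij hik hjk)).ne'⟩)
    refine ⟨c, fun _ z => (hc z).mono fun p hp => ?_⟩
    convert hp using 2
    simp [det3, momentVec]
    ring
  have hT : ∀ i : DualLabel r, ∃ c : ℝ, ∀ z : chirotopeSet M₀,
      ∀ᶠ p : chirotopeSet M₀ × ℝ in nhds z ×ˢ nhdsWithin (0 : ℝ) (Set.Ioi 0),
        0 < c * det3 (stdDual p.1.1 i) (momentVec p.2) (momentDeriv p.2) := by
    intro i
    -- The cross product of the moment curve and its derivative is `(ν², -2ν, 1)`.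
    have ha : ∀ k, (![1, -2, 1] : Fin 3 → ℝ) k ≠ 0 := by
      intro k; fin_cases k <;> simp
    obtain ⟨c, -, hc⟩ := exists_sign_of_quadratic (Z := chirotopeSet M₀)
      (D := fun k z => (![1, -2, 1] : Fin 3 → ℝ) k * stdDual z.1 i (Fin.rev k))
      (e := fun k => (![1, -2, 1] : Fin 3 → ℝ) k * stdDual M₀ i (Fin.rev k))
      (fun k => continuous_const.mul ((continuous_apply _).comp (hc i)))
      (fun k => by
        rcases i with j | m
        · left
          intro z
          have := mul_pos (mul_self_pos.2 (ha k)) (entry_mul_pos z.2 j (Fin.rev k))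
          rw [stdDual_inl, stdDual_inl]
          linarith
        · by_cases hm : Fin.rev k = m
          · left; intro z; simp [hm, ha k]
          · right; simp [hm])
      (by
        rcases i with j | m
        · exact ⟨0, mul_ne_zero (ha 0) (left_ne_zero_of_mul (entry_mul_pos hM₀ j _).ne')⟩
        · exact ⟨Fin.rev m, mul_ne_zero (ha _) (by simp)⟩)
    refine ⟨c, fun z => (hc z).mono fun p hp => ?_⟩
    convert hp using 2
    simp [det3, momentVec, momentDeriv]
    ring
  choose cS hcS using hS
  choose cT hcT using hT
  obtain ⟨ν, hν⟩ := exists_continuous_pos_of_eventually (Z := chirotopeSet M₀)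
    (G := fun z t => (∀ i j, i ≠ j →
      0 < cS i j * det3 (stdDual z.1 i) (stdDual z.1 j) (momentVec t)) ∧
      (∀ i, 0 < cT i * det3 (stdDual z.1 i) (momentVec t) (momentDeriv t))) (fun z => by
    refine Filter.Eventually.and (Filter.eventually_all.2 fun i => Filter.eventually_all.2 fun j =>
      ?_) (Filter.eventually_all.2 fun i => hcT i z)
    by_cases hij : i = j
    · exact Filter.Eventually.of_forall fun _ h => absurd hij h
    · exact (hcS i j hij z).mono fun p hp _ => hp)
  exact ⟨ν, cS, cT, hν⟩

/-- Weights that combine the vectors of `stdDual M` to `ζ • momentVec ν`, and that are positive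
for small `ζ`. -/
def momentSigma (M : Fin r → Fin 3 → ℝ) (ν ζ : ℝ) : DualLabel r → ℝ :=
  Sum.elim (fun _ => ζ ^ 2) (fun k => ζ * (momentVec ν k - ζ * ∑ j, M j k))

/-- Weights that combine the vectors of `stdDual M` to `ζ ^ 2 • momentDeriv ν`. -/
def momentTau (ν ζ : ℝ) : DualLabel r → ℝ :=
  Sum.elim (fun _ => 0) (fun k => ζ ^ 2 * momentDeriv ν k)

theorem sum_momentSigma (M : Fin r → Fin 3 → ℝ) (ν ζ : ℝ) :
    ∑ i, momentSigma M ν ζ i • stdDual M i = ζ • momentVec ν := by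
  funext k
  rw [sum_smul_stdDual]
  simp only [momentSigma, Sum.elim_inl, Sum.elim_inr, ← Finset.mul_sum, Pi.smul_apply, smul_eq_mul]
  ring

theorem sum_momentTau (M : Fin r → Fin 3 → ℝ) (ν ζ : ℝ) :
    ∑ i, momentTau ν ζ i • stdDual M i = ζ ^ 2 • momentDeriv ν := by
  funext k
  rw [sum_smul_stdDual]
  simp [momentTau]

theorem continuous_momentVec : Continuous momentVec := by
  refine continuous_pi fun k => ?_
  fin_cases k
  · exact continuous_const
  · exact continuous_id
  · exact continuous_pow 2

theorem continuous_momentDeriv : Continuous momentDeriv := by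
  refine continuous_pi fun k => ?_
  fin_cases k
  · exact continuous_const
  · exact continuous_const
  · exact continuous_const.mul continuous_id

section
variable {Z : Type} [TopologicalSpace Z] {M : Z → Fin r → Fin 3 → ℝ} {ν ζ : Z → ℝ}

theorem continuous_momentSigma (hM : Continuous M) (hν : Continuous ν) (hζ : Continuous ζ) :
    Continuous fun z => momentSigma (M z) (ν z) (ζ z) := by
  refine continuous_pi fun i => ?_
  rcases i with j | k
  · exact hζ.pow 2
  · refine hζ.mul (((continuous_apply k).comp (continuous_momentVec.comp hν)).sub (hζ.mul ?_))
    exact continuous_finsetSum _ fun j _ => (continuous_apply k).comp ((continuous_apply j).comp hM)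

theorem continuous_momentTau (hν : Continuous ν) (hζ : Continuous ζ) :
    Continuous fun z => (momentTau (ν z) (ζ z) : DualLabel r → ℝ) := by
  refine continuous_pi fun i => ?_
  rcases i with j | k
  · exact continuous_const
  · exact (hζ.pow 2).mul ((continuous_apply k).comp (continuous_momentDeriv.comp hν))

theorem continuous_stdConfig (hM : Continuous M) (q : DualLabel r) (c : Fin r) :
    Continuous fun z => stdConfig (M z) q c := by
  rcases q with j | k
  · exact continuous_const
  · exact ((continuous_apply k).comp ((continuous_apply c).comp hM)).neg

theorem continuous_pairHeight (hM : Continuous M) {σ τ : Z → DualLabel r → ℝ}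
    (hσ : Continuous σ) (hτ : Continuous τ) (h0 : ∀ z i, 0 < σ z i) (i : DualLabel r) :
    Continuous fun z => pairHeight (M z) (σ z) (τ z) i := by
  have h1 : Continuous fun z => σ z i := (continuous_apply i).comp hσ
  have h2 : Continuous fun z => τ z i := (continuous_apply i).comp hτ
  refine Continuous.div ?_ (continuous_const.mul h1) fun z => (mul_pos two_pos (h0 z i)).ne'
  exact ((continuous_finsetSum _ fun c _ => (continuous_stdConfig hM i c).pow 2).add (h2.pow 2)).sub
    (h1.pow 2)

end

theorem sum_stdConfig_sq_pos [NeZero r] {M₀ M : Fin r → Fin 3 → ℝ} (h : M ∈ chirotopeSet M₀)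
    (i : DualLabel r) : 0 < ∑ c, stdConfig M i c ^ 2 := by
  refine Finset.sum_pos' (fun c _ => sq_nonneg _) ?_
  rcases i with j | k
  · exact ⟨j, Finset.mem_univ _, by simp [stdConfig]⟩
  · refine ⟨0, Finset.mem_univ _, ?_⟩
    have := right_ne_zero_of_mul (entry_mul_pos h 0 k).ne'
    simp only [stdConfig, Sum.elim_inr]
    exact sq_pos_iff.2 (neg_ne_zero.2 this)

theorem det3_smul_right (c : ℝ) (a b v : Fin 3 → ℝ) : det3 a b (c • v) = c * det3 a b v := by
  simp [det3]; ring

theorem det3_smul_smul_right (b c : ℝ) (a u v : Fin 3 → ℝ) :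
    det3 a (b • u) (c • v) = b * c * det3 a u v := by
  simp [det3]; ring

theorem pos_of_mul_pos_mul {c a b : ℝ} (ha : 0 < c * a) (hb : 0 < c * b) : 0 < a * b := by
  rcases pos_and_pos_or_neg_and_neg_of_mul_pos ha with ⟨h1, h2⟩ | ⟨h1, h2⟩
  · exact mul_pos h2 ((mul_pos_iff_of_pos_left h1).1 hb)
  · exact mul_pos_of_neg_of_neg h2 ((pos_and_pos_or_neg_and_neg_of_mul_pos hb).resolve_left
      fun h => absurd h.1 h1.not_gt).2

/-- Admissible parameters can be chosen continuously, with constant sign data. -/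
theorem exists_admissible [NeZero r] {M₀ : Fin r → Fin 3 → ℝ} (hM₀ : M₀ ∈ chirotopeSet M₀) :
    ∃ (σ τ : chirotopeSet M₀ → DualLabel r → ℝ) (ε : chirotopeSet M₀ → ℝ),
      Continuous σ ∧ Continuous τ ∧ Continuous ε ∧
      (∀ z, IsAdmissible z.1 (σ z) (τ z) (ε z)) ∧
      (∀ z z' : chirotopeSet M₀, ∀ i j, i ≠ j →
        0 < det3 (stdDual z.1 i) (stdDual z.1 j) (dualS z.1 (σ z) (τ z) (ε z))
          * det3 (stdDual z'.1 i) (stdDual z'.1 j) (dualS z'.1 (σ z') (τ z') (ε z'))) ∧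
      (∀ z z' : chirotopeSet M₀, ∀ i,
        0 < det3 (stdDual z.1 i) (dualS z.1 (σ z) (τ z) (ε z)) (dualT z.1 (σ z) (τ z) (ε z))
          * det3 (stdDual z'.1 i) (dualS z'.1 (σ z') (τ z') (ε z'))
            (dualT z'.1 (σ z') (τ z') (ε z'))) := by
  obtain ⟨ν, cS, cT, hν⟩ := exists_momentParameter hM₀
  have hval : Continuous fun z : chirotopeSet M₀ => z.1 := continuous_subtype_val
  have hy : ∀ q, Continuous fun z : chirotopeSet M₀ => stdDual z.1 q :=
    fun q => continuous_stdDual hval q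
  -- First `ζ`, which scales the weights `σ` and `τ`.
  obtain ⟨ζ, hζ⟩ := exists_continuous_pos_of_eventually (Z := chirotopeSet M₀)
    (G := fun z t => (0 < t ∧ ∀ k, 0 < momentVec (ν z) k - t * ∑ j, z.1 j k) ∧
      (∀ i, 0 < ∑ c, stdConfig z.1 i c ^ 2 + momentTau (ν z) t i ^ 2
        - momentSigma z.1 (ν z) t i ^ 2) ∧
      (∀ i j, i ≠ j → t * |det3 (stdDual z.1 i) (stdDual z.1 j) (momentDeriv (ν z))|
        < |det3 (stdDual z.1 i) (stdDual z.1 j) (momentVec (ν z))|)) (fun z => by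
    have hval' : Continuous fun p : chirotopeSet M₀ × ℝ => p.1.1 := hval.comp continuous_fst
    have hν' : Continuous fun p : chirotopeSet M₀ × ℝ => ν p.1 := ν.continuous.comp continuous_fst
    have hy' : ∀ q, Continuous fun p : chirotopeSet M₀ × ℝ => stdDual p.1.1 q :=
      fun q => (hy q).comp continuous_fst
    have hS0 : ∀ i, momentSigma z.1 (ν z) 0 i = 0 := by rintro (j | k) <;> simp [momentSigma]
    have hT0 : ∀ i, momentTau (r := r) (ν z) 0 i = 0 := by rintro (j | k) <;> simp [momentTau]
    refine Filter.Eventually.and (Filter.Eventually.and (eventually_snd_pos z)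
      (Filter.eventually_all.2 fun k => ?_)) (Filter.Eventually.and
      (Filter.eventually_all.2 fun i => ?_) (Filter.eventually_all.2 fun i =>
        Filter.eventually_all.2 fun j => ?_))
    · have h0 : 0 < momentVec (ν z) k := by
        have := (hν z).1
        fin_cases k <;> simp [momentVec, this]
      refine eventually_of_continuousAt_pos
        (F := fun p : chirotopeSet M₀ × ℝ => momentVec (ν p.1) k - p.2 * ∑ j, p.1.1 j k)
        (Continuous.continuousAt ?_) (by simpa using h0)
      refine ((continuous_apply k).comp (continuous_momentVec.comp hν')).sub
        (continuous_snd.mul ?_)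
      exact continuous_finsetSum _ fun j _ =>
        (continuous_apply k).comp ((continuous_apply j).comp hval')
    · refine eventually_of_continuousAt_pos
        (F := fun p : chirotopeSet M₀ × ℝ => ∑ c, stdConfig p.1.1 i c ^ 2
          + momentTau (ν p.1) p.2 i ^ 2 - momentSigma p.1.1 (ν p.1) p.2 i ^ 2)
        (Continuous.continuousAt ?_) (by
          simpa [hS0, hT0] using sum_stdConfig_sq_pos z.2 i)
      refine ((continuous_finsetSum _ fun c _ => (continuous_stdConfig hval' i c).pow 2).add
        (((continuous_apply i).comp (continuous_momentTau hν' continuous_snd)).pow 2)).sub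
        (((continuous_apply i).comp (continuous_momentSigma hval' hν' continuous_snd)).pow 2)
    · by_cases hij : i = j
      · exact Filter.Eventually.of_forall fun _ h => absurd hij h
      have h0 := right_ne_zero_of_mul ((hν z).2.1 i j hij).ne'
      refine (eventually_of_continuousAt_pos (z := z) (F := fun p : chirotopeSet M₀ × ℝ =>
        |det3 (stdDual p.1.1 i) (stdDual p.1.1 j) (momentVec (ν p.1))|
          - p.2 * |det3 (stdDual p.1.1 i) (stdDual p.1.1 j) (momentDeriv (ν p.1))|)
        (Continuous.continuousAt ?_) (by simpa using h0)).mono fun p hp _ => sub_pos.1 hp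
      exact ((hy' i).det3 (hy' j) (continuous_momentVec.comp hν')).abs.sub (continuous_snd.mul
        ((hy' i).det3 (hy' j) (continuous_momentDeriv.comp hν')).abs))
  set σ : chirotopeSet M₀ → DualLabel r → ℝ := fun z => momentSigma z.1 (ν z) (ζ z) with hσ
  set τ : chirotopeSet M₀ → DualLabel r → ℝ := fun z => momentTau (ν z) (ζ z) with hτ
  have cσ : Continuous σ := continuous_momentSigma hval ν.continuous ζ.continuous
  have cτ : Continuous τ := continuous_momentTau ν.continuous ζ.continuous
  have hζpos : ∀ z, 0 < ζ z := fun z => (hζ z).1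
  have hσpos : ∀ z i, 0 < σ z i := by
    intro z i
    rcases i with j | k
    · exact pow_pos (hζpos z) 2
    · exact mul_pos (hζpos z) ((hζ z).2.1.2 k)
  have hγpos : ∀ z i, 0 < pairHeight z.1 (σ z) (τ z) i := fun z i =>
    div_pos ((hζ z).2.2.1 i) (mul_pos two_pos (hσpos z i))
  have cγ : ∀ i, Continuous fun z : chirotopeSet M₀ => pairHeight z.1 (σ z) (τ z) i :=
    fun i => continuous_pairHeight hval cσ cτ hσpos i
  -- Then `ε`, which separates the members of the pairs.
  have cκ : Continuous fun p : chirotopeSet M₀ × ℝ =>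
      lightCorrection p.1.1 (σ p.1) (τ p.1) p.2 := by
    unfold lightCorrection
    refine ((continuous_snd.pow 2).mul ?_).div_const _
    exact continuous_finsetSum _ fun i _ => ((cγ i).comp continuous_fst).pow 2
  have cd : Continuous fun p : chirotopeSet M₀ × ℝ => 1 + lightCorrection p.1.1 (σ p.1) (τ p.1) p.2
      - p.2 * ∑ i, pairHeight p.1.1 (σ p.1) (τ p.1) i := by
    refine (continuous_const.add cκ).sub (continuous_snd.mul ?_)
    exact continuous_finsetSum _ fun i _ => (cγ i).comp continuous_fst
  obtain ⟨ε, hε⟩ := exists_continuous_pos_of_eventually (Z := chirotopeSet M₀)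
    (G := fun z t => 0 < 1 - lightCorrection z.1 (σ z) (τ z) t ∧
      0 < 1 + lightCorrection z.1 (σ z) (τ z) t - t * ∑ i, pairHeight z.1 (σ z) (τ z) i ∧
      IsGood (stdDual z.1) (dualS z.1 (σ z) (τ z) t) (dualT z.1 (σ z) (τ z) t) t) (fun z => by
    have hκ0 : lightCorrection z.1 (σ z) (τ z) 0 = 0 := by simp [lightCorrection]
    have eS : ∀ p : chirotopeSet M₀ × ℝ, dualS p.1.1 (σ p.1) (τ p.1) p.2
        = -(1 + lightCorrection p.1.1 (σ p.1) (τ p.1) p.2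
            - p.2 * ∑ i, pairHeight p.1.1 (σ p.1) (τ p.1) i)⁻¹ • ζ p.1 • momentVec (ν p.1) := by
      intro p
      rw [dualS, hσ, sum_momentSigma]
    have eT : ∀ p : chirotopeSet M₀ × ℝ, dualT p.1.1 (σ p.1) (τ p.1) p.2
        = -(1 - lightCorrection p.1.1 (σ p.1) (τ p.1) p.2)⁻¹ •
          ζ p.1 ^ 2 • momentDeriv (ν p.1) := by
      intro p
      rw [dualT, hτ, sum_momentTau]
    have eS0 : dualS z.1 (σ z) (τ z) 0 = -ζ z • momentVec (ν z) := by
      rw [eS (z, 0)]; simp [hκ0]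
    have eT0 : dualT z.1 (σ z) (τ z) 0 = -ζ z ^ 2 • momentDeriv (ν z) := by
      rw [eT (z, 0)]; simp [hκ0]
    refine Filter.Eventually.and ?_ (Filter.Eventually.and ?_ ?_)
    · exact eventually_of_continuousAt_pos (continuous_const.sub cκ).continuousAt (by simp [hκ0])
    · exact eventually_of_continuousAt_pos cd.continuousAt (by simp [hκ0])
    · refine eventually_isGood (y := fun z : chirotopeSet M₀ => stdDual z.1) (continuous_pi hy)
        (S := fun p => dualS p.1.1 (σ p.1) (τ p.1) p.2)
        (T := fun p => dualT p.1.1 (σ p.1) (τ p.1) p.2) ?_ ?_ ?_ ?_ ?_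
      · simp only [eS]
        refine (cd.continuousAt.inv₀ (by simp [hκ0])).neg.smul (Continuous.continuousAt ?_)
        exact (ζ.continuous.comp continuous_fst).smul
          (continuous_momentVec.comp (ν.continuous.comp continuous_fst))
      · simp only [eT]
        refine ((continuous_const.sub cκ).continuousAt.inv₀ (by simp [hκ0])).neg.smul
          (Continuous.continuousAt ?_)
        exact ((ζ.continuous.comp continuous_fst).pow 2).smul
          (continuous_momentDeriv.comp (ν.continuous.comp continuous_fst))
      · intro i j k hij hik hjk
        exact right_ne_zero_of_mul (z.2 ![i, j, k] (injective_vec3 hij hik hjk)).ne'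
      · intro i
        have := right_ne_zero_of_mul ((hν z).2.2 i).ne'
        have h0 := (hζpos z).ne'
        simp only [eS0, eT0, det3_smul_smul_right]
        exact mul_ne_zero (mul_ne_zero (neg_ne_zero.2 h0) (neg_ne_zero.2 (pow_ne_zero 2 h0))) this
      · intro i j hij
        have h0 := hζpos z
        have h1 := mul_lt_mul_of_pos_left ((hζ z).2.2.2 i j hij) h0
        simp only [eS0, eT0, det3_smul_right, abs_mul, abs_neg, abs_of_pos h0, abs_pow]
        rw [sq, mul_assoc]
        exact h1)
  have hadm : ∀ z, IsAdmissible z.1 (σ z) (τ z) (ε z) := fun z =>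
    ⟨hσpos z, hγpos z, (hε z).2.1, (hε z).2.2.1, (hε z).2.2.2⟩
  have hS : ∀ z : chirotopeSet M₀, ∃ a : ℝ, 0 < a ∧
      dualS z.1 (σ z) (τ z) (ε z) = -a • momentVec (ν z) := by
    intro z
    refine ⟨_, mul_pos (inv_pos.2 (hadm z).denom_pos) (hζpos z), ?_⟩
    rw [dualS, hσ, sum_momentSigma, smul_smul, neg_mul]
  have hT : ∀ z : chirotopeSet M₀, ∃ a : ℝ, 0 < a ∧
      dualT z.1 (σ z) (τ z) (ε z) = -a • momentDeriv (ν z) := by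
    intro z
    refine ⟨_, mul_pos (inv_pos.2 (hadm z).correction_lt) (pow_pos (hζpos z) 2), ?_⟩
    rw [dualT, hτ, sum_momentTau, smul_smul, neg_mul]
  refine ⟨σ, τ, ε, cσ, cτ, ε.continuous, hadm, fun z z' i j hij => ?_, fun z z' i => ?_⟩
  · obtain ⟨a, ha, e⟩ := hS z
    obtain ⟨a', ha', e'⟩ := hS z'
    have h3 := mul_pos (mul_pos ha ha')
      (pos_of_mul_pos_mul ((hν z).2.1 i j hij) ((hν z').2.1 i j hij))
    rw [e, e', det3_smul_right, det3_smul_right]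
    linarith
  · obtain ⟨a, ha, e⟩ := hS z
    obtain ⟨a', ha', e'⟩ := hS z'
    obtain ⟨b, hb, f⟩ := hT z
    obtain ⟨b', hb', f'⟩ := hT z'
    have h3 := mul_pos (mul_pos (mul_pos ha ha') (mul_pos hb hb'))
      (pos_of_mul_pos_mul ((hν z).2.2 i) ((hν z').2.2 i))
    rw [e, e', f, f', det3_smul_smul_right, det3_smul_smul_right]
    linarith

end

/-! ### Normalization by positive row and column factors -/

section
variable {r : ℕ}

/-- The matrix `M` with its rows and columns rescaled by powers of positive factors. For `t = 1`
the entries of the first row and of the first column become `±1`; for `t = 0` nothing changes. -/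
noncomputable def partialNormalized [NeZero r] (t : ℝ) (M : Fin r → Fin 3 → ℝ) :
    Fin r → Fin 3 → ℝ :=
  fun j k => (|M 0 0| / |M j 0|) ^ t * (|M 0 k|⁻¹) ^ t * M j k

/-- The representative, with entries `±1` in the first row and the first column, of `M` up to
positive row and column factors. -/
noncomputable def normalized [NeZero r] (M : Fin r → Fin 3 → ℝ) : Fin r → Fin 3 → ℝ :=
  fun j k => |M 0 0| / |M j 0| * |M 0 k|⁻¹ * M j k

theorem partialNormalized_zero [NeZero r] (M : Fin r → Fin 3 → ℝ) : partialNormalized 0 M = M := by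
  funext j k; simp [partialNormalized]

theorem partialNormalized_one [NeZero r] (M : Fin r → Fin 3 → ℝ) :
    partialNormalized 1 M = normalized M := by
  funext j k; simp [partialNormalized, normalized]

theorem normalized_eq_of_scale [NeZero r] {M M' : Fin r → Fin 3 → ℝ} (hM : ∀ j k, M j k ≠ 0)
    {a : Fin r → ℝ} {b : Fin 3 → ℝ} (ha : ∀ j, 0 < a j) (hb : ∀ k, 0 < b k)
    (h : ∀ j k, M' j k = a j * b k * M j k) : normalized M' = normalized M := by
  funext j k
  have h1 := (ha 0).ne'
  have h2 := (ha j).ne'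
  have h3 := (hb 0).ne'
  have h4 := (hb k).ne'
  have h5 := abs_ne_zero.2 (hM j 0)
  have h6 := abs_ne_zero.2 (hM 0 k)
  simp only [normalized, h, abs_mul, abs_of_pos (ha _), abs_of_pos (hb _)]
  field_simp

theorem normalized_normalized [NeZero r] {M : Fin r → Fin 3 → ℝ} (hM : ∀ j k, M j k ≠ 0) :
    normalized (normalized M) = normalized M :=
  normalized_eq_of_scale hM
    (fun j => div_pos (abs_pos.2 (hM 0 0)) (abs_pos.2 (hM j 0)))
    (fun k => inv_pos.2 (abs_pos.2 (hM 0 k))) fun _ _ => rfl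

/-- Row factors rescale the vectors of `stdDual M`. Column factors amount to a diagonal linear map,
followed by rescaling the standard basis. -/
theorem chirotopeSet_scale {M₀ M M' : Fin r → Fin 3 → ℝ} (hM : M ∈ chirotopeSet M₀)
    {a : Fin r → ℝ} {b : Fin 3 → ℝ} (ha : ∀ j, 0 < a j) (hb : ∀ k, 0 < b k)
    (h : ∀ j k, M' j k = a j * b k * M j k) : M' ∈ chirotopeSet M₀ := by
  intro T hT
  set μ : DualLabel r → ℝ := Sum.elim a fun k => (b k)⁻¹ with hμ
  have hμpos : ∀ q, 0 < μ q := by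
    rintro (j | k)
    · exact ha j
    · exact inv_pos.2 (hb k)
  have hq : ∀ q k, stdDual M' q k = μ q * (b k * stdDual M q k) := by
    rintro (j | l) k
    · simp [hμ, h, mul_assoc]
    · by_cases hkl : k = l
      · subst hkl; simp [hμ, (hb k).ne']
      · simp [hμ, hkl]
  have hdet : det3Of (stdDual M') T = (μ (T 0) * μ (T 1) * μ (T 2)) * (b 0 * b 1 * b 2)
      * det3Of (stdDual M) T := by
    simp only [det3Of, det3, hq]
    ring
  rw [hdet, mul_left_comm]
  exact mul_pos (mul_pos (mul_pos (mul_pos (hμpos _) (hμpos _)) (hμpos _))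
    (mul_pos (mul_pos (hb 0) (hb 1)) (hb 2))) (hM T hT)

theorem entry_ne_zero {M₀ M : Fin r → Fin 3 → ℝ} (hM : M ∈ chirotopeSet M₀) (j : Fin r)
    (k : Fin 3) : M j k ≠ 0 := right_ne_zero_of_mul (entry_mul_pos hM j k).ne'

theorem partialNormalized_mem [NeZero r] {M₀ M : Fin r → Fin 3 → ℝ} (hM : M ∈ chirotopeSet M₀)
    (t : ℝ) :
    partialNormalized t M ∈ chirotopeSet M₀ :=
  chirotopeSet_scale hM
    (fun j => Real.rpow_pos_of_pos (div_pos (abs_pos.2 (entry_ne_zero hM 0 0))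
      (abs_pos.2 (entry_ne_zero hM j 0))) t)
    (fun k => Real.rpow_pos_of_pos (inv_pos.2 (abs_pos.2 (entry_ne_zero hM 0 k))) t)
    fun _ _ => rfl

theorem continuous_entry {M₀ : Fin r → Fin 3 → ℝ} (j : Fin r) (k : Fin 3) :
    Continuous fun z : chirotopeSet M₀ => z.1 j k :=
  (continuous_apply k).comp ((continuous_apply j).comp continuous_subtype_val)

theorem continuous_partialNormalized [NeZero r] (M₀ : Fin r → Fin 3 → ℝ) :
    Continuous fun p : unitInterval × chirotopeSet M₀ => partialNormalized p.1 p.2.1 := by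
  refine continuous_pi fun j => continuous_pi fun k => ?_
  have hc : ∀ j k, Continuous fun p : unitInterval × chirotopeSet M₀ => |p.2.1 j k| :=
    fun j k => ((continuous_entry j k).comp continuous_snd).abs
  have h0 : ∀ (p : unitInterval × chirotopeSet M₀) j k, |p.2.1 j k| ≠ 0 :=
    fun p j k => abs_ne_zero.2 (entry_ne_zero p.2.2 j k)
  have ht : Continuous fun p : unitInterval × chirotopeSet M₀ => (p.1 : ℝ) :=
    continuous_subtype_val.comp continuous_fst
  refine (Continuous.mul ?_ ?_).mul ((continuous_entry j k).comp continuous_snd)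
  · exact ((hc 0 0).div (hc j 0) fun p => h0 p j 0).rpow ht
      fun p => Or.inl (div_ne_zero (h0 p 0 0) (h0 p j 0))
  · exact ((hc 0 k).inv₀ fun p => h0 p 0 k).rpow ht fun p => Or.inl (inv_ne_zero (h0 p 0 k))

/-- The normalized matrices in `chirotopeSet M₀`. -/
def normalizedSet [NeZero r] (M₀ : Fin r → Fin 3 → ℝ) : Set (Fin r → Fin 3 → ℝ) :=
  {M | M ∈ chirotopeSet M₀ ∧ normalized M = M}

theorem normalized_mem [NeZero r] {M₀ M : Fin r → Fin 3 → ℝ} (hM : M ∈ chirotopeSet M₀) :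
    normalized M ∈ normalizedSet M₀ :=
  ⟨partialNormalized_one M ▸ partialNormalized_mem hM 1, normalized_normalized (entry_ne_zero hM)⟩

theorem continuous_normalized [NeZero r] (M₀ : Fin r → Fin 3 → ℝ) :
    Continuous fun z : chirotopeSet M₀ => normalized z.1 := by
  have := (continuous_partialNormalized M₀).comp
    (continuous_const.prodMk continuous_id : Continuous fun z => ((1 : unitInterval), z))
  simpa [Function.comp_def, partialNormalized_one] using this

/-- The matrices with a given chirotope deform to the normalized ones: move the row and column
factors to `1` along powers. -/
noncomputable def normalizedHomotopyEquiv [NeZero r] (M₀ : Fin r → Fin 3 → ℝ) :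
    normalizedSet M₀ ≃ₕ chirotopeSet M₀ where
  toFun := ⟨fun z => ⟨z.1, z.2.1⟩, continuous_subtype_val.subtype_mk _⟩
  invFun := ⟨fun z => ⟨normalized z.1, normalized_mem z.2⟩, (continuous_normalized M₀).subtype_mk _⟩
  left_inv := by
    convert ContinuousMap.Homotopic.refl _
    ext z : 2
    exact z.2.2.symm
  right_inv := by
    refine ContinuousMap.Homotopic.symm ⟨⟨⟨fun p => ⟨partialNormalized p.1 p.2.1,
      partialNormalized_mem p.2.2 _⟩, (continuous_partialNormalized M₀).subtype_mk _⟩, ?_, ?_⟩⟩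
    · intro z
      exact Subtype.ext (by simp [partialNormalized_zero])
    · intro z
      exact Subtype.ext (by simp [partialNormalized_one])

end

/-! ### The realization space of a uniform oriented matroid of corank three -/

section
variable {ι : Type} {r : ℕ} {V₀ : ι → Fin r → ℝ} (φ : DualLabel r ≃ ι)

/-- All minors of maximal size are nonzero. -/
def IsUniform {ι : Type} {r : ℕ} (V : ι → Fin r → ℝ) : Prop :=
  ∀ t : Fin r → ι, Function.Injective t → Matrix.det (Matrix.of fun k => V (t k)) ≠ 0

/-- Realizations of the oriented matroid of a uniform configuration are uniform, and their minors
differ from those of the configuration by a constant sign. -/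
theorem RealizesOM.exists_sign (hV₀ : IsUniform V₀) {V : ι → Fin r → ℝ}
    (hV : RealizesOM (chirotope V₀) V) :
    ∃ s : SignType, s ≠ 0 ∧ ∀ t : Fin r → ι, Function.Injective t →
      SignType.sign (Matrix.det (Matrix.of fun k => V₀ (t k)) *
        Matrix.det (Matrix.of fun k => V (t k))) = s := by
  have hsq : ∀ s : SignType, s ≠ 0 → s * s = 1 := by decide
  have hneg : ∀ s : SignType, s ≠ 0 → s * -s = -1 := by decide
  rcases hV with h | h
  · refine ⟨1, by decide, fun t ht => ?_⟩
    have := congrFun h t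
    simp only [chirotope] at this
    rw [sign_mul, this]
    exact hsq _ (sign_ne_zero.2 (hV₀ t ht))
  · refine ⟨-1, by decide, fun t ht => ?_⟩
    have := congrFun h t
    simp only [chirotope] at this
    rw [sign_mul, this]
    exact hneg _ (sign_ne_zero.2 (hV₀ t ht))

theorem card_dualLabel : Fintype.card (DualLabel r) = r + 3 := by simp

theorem RealizesOM.det_ne_zero (hV₀ : IsUniform V₀) {V : ι → Fin r → ℝ}
    (hV : RealizesOM (chirotope V₀) V) :
    Matrix.det (Matrix.of fun m => V (φ (Sum.inl m))) ≠ 0 := by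
  obtain ⟨s, hs0, hs⟩ := hV.exists_sign hV₀
  intro h0
  have := hs (fun m => φ (Sum.inl m)) (φ.injective.comp Sum.inl_injective)
  rw [h0, mul_zero, sign_zero] at this
  exact hs0 this.symm

/-- The last three vectors of a normalized dual have determinant `1`, which fixes the global sign
of the dual chirotope. -/
theorem RealizesOM.dualCoords_mem [NeZero r] (hV₀ : IsUniform V₀) {V : ι → Fin r → ℝ}
    (hV : RealizesOM (chirotope V₀) V) :
    dualCoords (V ∘ φ) ∈ chirotopeSet (dualCoords (V₀ ∘ φ)) := by
  obtain ⟨s, hs0, hs⟩ := hV.exists_sign hV₀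
  have h0 := RealizesOM.det_ne_zero φ hV₀ (Or.inl rfl : RealizesOM (chirotope V₀) V₀)
  intro T hT
  have := sign_det3Of_mul_eq (isGaleDual_dualCoords (q := V₀ ∘ φ) h0)
    (isGaleDual_dualCoords (q := V ∘ φ) (hV.det_ne_zero φ hV₀)) card_dualLabel
    (Nat.pos_of_ne_zero (NeZero.ne r)) hs0
    (fun t ht => hs (φ ∘ t) (φ.injective.comp ht)) hT Sum.inr_injective
  rw [det3Of_stdDual_inr, det3Of_stdDual_inr, mul_one, sign_one] at this
  exact sign_eq_one_iff.1 this

/-- The chirotope of the dual determines that of the configuration up to a global sign. -/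
theorem realizesOM_stdConfig (hV₀ : IsUniform V₀) {M : Fin r → Fin 3 → ℝ}
    (hM : M ∈ chirotopeSet (dualCoords (V₀ ∘ φ))) :
    RealizesOM (chirotope V₀) (stdConfig M ∘ φ.symm) := by
  have h0 := RealizesOM.det_ne_zero φ hV₀ (Or.inl rfl : RealizesOM (chirotope V₀) V₀)
  have hstd : Matrix.det (Matrix.of fun m : Fin r => stdConfig M (Sum.inl m)) = 1 := by
    rw [of_stdConfig_inl, Matrix.det_one]
  have hsign : ∀ t : Fin r → ι, Function.Injective t →
      SignType.sign (Matrix.det (Matrix.of fun k => V₀ (t k))) *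
        SignType.sign (Matrix.det (Matrix.of fun k => stdConfig M (φ.symm (t k))))
      = SignType.sign (Matrix.det (Matrix.of fun k => V₀ (φ (Sum.inl k)))) := by
    intro t ht
    have := sign_det_mul_eq (isGaleDual_dualCoords (q := V₀ ∘ φ) h0) (isGaleDual_stdConfig M)
      card_dualLabel (s := 1) (by decide)
      (fun T hT => sign_eq_one_iff.2 (hM T hT)) (φ.symm.injective.comp ht) Sum.inl_injective
    rw [hstd, mul_one, sign_mul] at this
    simpa using this
  have hrep : ∀ t : Fin r → ι, ¬ Function.Injective t → ∀ V : ι → Fin r → ℝ,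
      Matrix.det (Matrix.of fun k => V (t k)) = 0 := by
    intro t ht V
    simp only [Function.Injective, not_forall] at ht
    obtain ⟨i, j, hij, hne⟩ := ht
    exact Matrix.det_zero_of_row_eq hne (by funext c; simp [hij])
  have hone : ∀ a b : SignType, a * b = 1 → b = a := by decide
  have hmone : ∀ a b : SignType, a * b = -1 → b = -a := by decide
  rcases (sign_ne_zero.2 h0).lt_or_gt with h | h
  · right
    funext t
    by_cases ht : Function.Injective t
    · refine hmone _ _ ((hsign t ht).trans ?_)
      exact SignType.neg_iff.1 h
    · simp [chirotope, hrep t ht V₀, hrep t ht fun i => stdConfig M (φ.symm i)]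
  · left
    funext t
    by_cases ht : Function.Injective t
    · refine hone _ _ ((hsign t ht).trans ?_)
      exact SignType.pos_iff.1 h
    · simp [chirotope, hrep t ht V₀, hrep t ht fun i => stdConfig M (φ.symm i)]

theorem dualCoords_stdConfig (M : Fin r → Fin 3 → ℝ) : dualCoords (stdConfig M) = M := by
  refine dualCoords_unique (by rw [of_stdConfig_inl]; simp) fun k => ?_
  funext j
  simp [stdConfig, Finset.sum_apply, Pi.single_apply]

/-- Each class in the realization space of a uniform oriented matroid with three elements more than
a basis has a unique representative `stdConfig M`. -/
noncomputable def realizationSpaceHomeomorph [NeZero r] (hV₀ : IsUniform V₀) :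
    chirotopeSet (dualCoords (V₀ ∘ φ)) ≃ₜ Quotient (omSetoid (chirotope V₀)) where
  toFun M := Quotient.mk _ ⟨stdConfig M.1 ∘ φ.symm, realizesOM_stdConfig φ hV₀ M.2⟩
  invFun := Quotient.lift (fun V => ⟨dualCoords (V.1 ∘ φ), V.2.dualCoords_mem φ hV₀⟩) (by
    rintro V W ⟨g, hg⟩
    refine Subtype.ext (funext fun m => funext fun k => ?_)
    have := dualCoords_rescale (q := V.1 ∘ φ) (q' := W.1 ∘ φ)
      (Matrix.toLin' (g : Matrix (Fin r) (Fin r) ℝ)) (fun _ => 1) (fun _ => one_ne_zero)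
      (fun k => by simp [hg]) (V.2.det_ne_zero φ hV₀) (W.2.det_ne_zero φ hV₀) m k
    simpa using this.symm)
  left_inv M := by
    refine Subtype.ext ?_
    change dualCoords ((stdConfig M.1 ∘ φ.symm) ∘ φ) = M.1
    rw [Function.comp_assoc, Equiv.symm_comp_self, Function.comp_id, dualCoords_stdConfig]
  right_inv := by
    refine Quotient.ind fun V => Quotient.sound ?_
    have hdet := V.2.det_ne_zero φ hV₀
    -- The matrix with columns `V.1 (φ (Sum.inl m))` maps the standard basis to these vectors.
    set B := Matrix.of fun m => V.1 (φ (Sum.inl m)) with hB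
    have hBT : IsUnit Bᵀ.det := by rw [Matrix.det_transpose]; exact isUnit_iff_ne_zero.2 hdet
    refine ⟨Matrix.GeneralLinearGroup.mk'' Bᵀ hBT, fun i => ?_⟩
    obtain ⟨q, rfl⟩ := φ.surjective i
    change Bᵀ *ᵥ stdConfig (dualCoords (V.1 ∘ φ)) (φ.symm (φ q)) = V.1 (φ q)
    rw [Equiv.symm_apply_apply]
    rcases q with m | k
    · funext c
      simp [stdConfig, hB]
    · have := eq_neg_sum_dualCoords (q := V.1 ∘ φ) hdet k
      simp only [Function.comp_apply] at this
      rw [this]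
      funext c
      simp [Matrix.mulVec, dotProduct, stdConfig, hB, Finset.sum_apply, mul_comm]
  continuous_toFun := by
    refine continuous_quotient_mk'.comp (Continuous.subtype_mk ?_ _)
    refine continuous_pi fun i => continuous_pi fun c => ?_
    exact continuous_stdConfig continuous_subtype_val _ _
  continuous_invFun := by
    refine Continuous.quotient_lift (Continuous.subtype_mk ?_ _) _
    refine continuous_dualCoords ?_ fun V => V.2.det_ne_zero φ hV₀
    exact continuous_pi fun q => (continuous_apply (φ q)).comp continuous_subtype_val

end

section
variable {ι : Type} {d : ℕ} {A : ι → EuclideanSpace ℝ (Fin d)}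

theorem InGeneralPosition.affineIndependent_comp (hA : InGeneralPosition A) {t : Fin (d + 1) → ι}
    (ht : Function.Injective t) : AffineIndependent ℝ fun k => A (t k) := by
  have hs := hA (Finset.univ.map ⟨t, ht⟩) (by rw [Finset.card_map, Finset.card_fin])
  let f : Fin (d + 1) ↪ {i // i ∈ Finset.univ.map ⟨t, ht⟩} :=
    ⟨fun k => ⟨t k, Finset.mem_map_of_mem _ (Finset.mem_univ k)⟩,
      fun a b h => ht (congrArg Subtype.val h)⟩
  exact hs.comp_embedding f

theorem InGeneralPosition.isUniform (hA : InGeneralPosition A) :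
    IsUniform (homogenization A) := by
  intro t ht h0
  obtain ⟨v, hv0, hv⟩ := Matrix.exists_vecMul_eq_zero_iff.2 h0
  have hind := hA.affineIndependent_comp ht
  have hcol : ∀ c, ∑ k, v k * homogenization A (t k) c = 0 := fun c => congrFun hv c
  rw [affineIndependent_iff] at hind
  refine hv0 (funext fun k => hind Finset.univ v ?_ ?_ k (Finset.mem_univ k))
  · simpa [homogenization] using hcol (Fin.last d)
  · ext c
    simpa [homogenization] using hcol c.castSucc

end

/-! ### Dual coordinates of inscribed realizations -/

section
variable {r D : ℕ}

/-- The labels of `PolyLabel r` other than the first members of the last three pairs. -/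
abbrev BasisLabel (r : ℕ) : Type := Fin r ⊕ DualLabel r ⊕ Bool

/-- The arrangement of the labels of the polytope in which the first members of the last three
pairs come last. -/
def labelEquiv (r : ℕ) : BasisLabel r ⊕ Fin 3 ≃ PolyLabel r where
  toFun := Sum.elim (Sum.elim (fun j => Sum.inl (Sum.inl j, false))
    (Sum.elim (fun i => Sum.inl (i, true)) Sum.inr)) (fun k => Sum.inl (Sum.inr k, false))
  invFun := Sum.elim (fun p => if p.2 then Sum.inl (Sum.inr (Sum.inl p.1))
    else Sum.elim (fun j => Sum.inl (Sum.inl j)) Sum.inr p.1)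
    (fun b => Sum.inl (Sum.inr (Sum.inr b)))
  left_inv := by rintro ((j | i | b) | k) <;> simp
  right_inv := by rintro (⟨j | k, b⟩ | b) <;> cases b <;> simp

/-- The coordinates `(v, w)` of `ℝ^(D+1)`, relabelled. -/
noncomputable def homogEquiv (η : BasisLabel r ≃ Fin D ⊕ Unit) :
    (EuclideanSpace ℝ (Fin D) × ℝ) ≃ₗ[ℝ] (BasisLabel r → ℝ) :=
  ((WithLp.linearEquiv 2 ℝ (Fin D → ℝ)).prodCongr (LinearEquiv.funUnique Unit ℝ ℝ).symm) ≪≫ₗ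
    (LinearEquiv.sumArrowLequivProdArrow (Fin D) Unit ℝ ℝ).symm ≪≫ₗ LinearEquiv.funCongrLeft ℝ ℝ η

theorem homogEquiv_apply (η : BasisLabel r ≃ Fin D ⊕ Unit) (v : EuclideanSpace ℝ (Fin D)) (w : ℝ)
    (b : BasisLabel r) : homogEquiv η (v, w) b = Sum.elim v (fun _ => w) (η b) := by
  simp only [homogEquiv, LinearEquiv.trans_apply, LinearEquiv.funCongrLeft_apply,
    LinearMap.funLeft_apply]
  rcases η b with i | u <;> rfl

/-- The homogeneous coordinates of a point configuration, arranged along `labelEquiv`. -/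
noncomputable def homogConfig (η : BasisLabel r ≃ Fin D ⊕ Unit)
    (p : PolyLabel r → EuclideanSpace ℝ (Fin D)) : BasisLabel r ⊕ Fin 3 → BasisLabel r → ℝ :=
  fun k => homogEquiv η (p (labelEquiv r k), 1)

variable (η : BasisLabel r ≃ Fin D ⊕ Unit) {p : PolyLabel r → EuclideanSpace ℝ (Fin D)}

theorem sum_homogConfig (u : BasisLabel r → ℝ) (k : BasisLabel r ⊕ Fin 3) :
    ∑ b, u b * homogConfig η p k b
      = ∑ i, u (η.symm (Sum.inl i)) * p (labelEquiv r k) i + u (η.symm (Sum.inr ())) := by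
  simp only [homogConfig, homogEquiv_apply]
  rw [← Equiv.sum_comp η.symm, Fintype.sum_sum_type]
  simp

theorem isGaleDual_homogConfig_iff (x : PolyLabel r → Fin 3 → ℝ) :
    IsGaleDual (homogConfig η p) (x ∘ labelEquiv r) ↔ IsAffineGaleDual p x := by
  have key : ∀ w : PolyLabel r → ℝ,
      (∃ u : BasisLabel r → ℝ, ∀ k, w (labelEquiv r k) = ∑ b, u b * homogConfig η p k b) ↔
        ∃ (u : Fin D → ℝ) (c : ℝ), ∀ k, w k = ∑ i, u i * p k i + c := by
    intro w
    simp only [sum_homogConfig]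
    constructor
    · rintro ⟨u, hu⟩
      refine ⟨fun i => u (η.symm (Sum.inl i)), u (η.symm (Sum.inr ())), fun k => ?_⟩
      simpa using hu ((labelEquiv r).symm k)
    · rintro ⟨u, c, hu⟩
      refine ⟨Sum.elim u (fun _ => c) ∘ η, fun k => ?_⟩
      simpa using hu (labelEquiv r k)
  have hsum : ∀ w : PolyLabel r → ℝ,
      ∑ k, w (labelEquiv r k) • (x ∘ labelEquiv r) k = ∑ k, w k • x k := fun w =>
    Equiv.sum_comp (labelEquiv r) fun k => w k • x k
  constructor
  · intro h w
    rw [← key, ← hsum]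
    exact h fun k => w (labelEquiv r k)
  · intro h w
    have := h (w ∘ (labelEquiv r).symm)
    rw [← key, ← hsum] at this
    simpa using this

/-- If all faces required by `HasBalancedFaces` are present, the points other than the first
members of the last three pairs are affinely independent: a dependency between them would have too
few labels. -/
theorem HasBalancedFaces.eq_zero_of_dependency (h : HasBalancedFaces (faceLattice p))
    {v : BasisLabel r → ℝ} (hv : ∑ m, v m = 0)
    (hvp : ∀ i, ∑ m, v m * p (labelEquiv r (Sum.inl m)) i = 0) : v = 0 := by
  classical
  -- A nonzero dependency has at least `r + 3` labels of each sign, out of `2 * r + 5` labels.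
  set c : PolyLabel r → ℝ := Sum.elim v 0 ∘ (labelEquiv r).symm with hc
  have hsum : ∀ f : PolyLabel r → ℝ, ∑ k, c k * f k = ∑ m, v m * f (labelEquiv r (Sum.inl m)) := by
    intro f
    rw [← Equiv.sum_comp (labelEquiv r), Fintype.sum_sum_type]
    simp [hc]
  by_contra hv0
  have hc0 : c ≠ 0 := by
    intro h0
    refine hv0 (funext fun m => ?_)
    have := congrFun h0 (labelEquiv r (Sum.inl m))
    simpa [hc] using this
  have h1 : ∑ k, c k = 0 := by simpa [hv] using hsum 1
  have h2 : ∀ i, ∑ k, c k * p k i = 0 := fun i => (hsum fun k => p k i).trans (hvp i)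
  have n1 := (h.card_neg hc0 h1 h2).1
  have n2 := (h.card_neg (c := -c) (neg_ne_zero.2 hc0)
    (by simp only [Pi.neg_apply, Finset.sum_neg_distrib, h1, neg_zero])
    (fun i => by simp only [Pi.neg_apply, neg_mul, Finset.sum_neg_distrib, h2 i, neg_zero])).1
  have hdisj : Disjoint (Finset.univ.filter fun k => c k < 0)
      (Finset.univ.filter fun k => (-c) k < 0) := by
    rw [Finset.disjoint_filter]
    intro k _ hk hk'
    simp only [Pi.neg_apply] at hk'
    linarith
  have hsub : (Finset.univ.filter fun k => c k < 0) ∪ (Finset.univ.filter fun k => (-c) k < 0)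
      ⊆ Finset.univ.image fun m => labelEquiv r (Sum.inl m) := by
    intro k hk
    have hck : c k ≠ 0 := by
      simp only [Finset.mem_union, Finset.mem_filter, Finset.mem_univ, true_and, Pi.neg_apply] at hk
      rcases hk with hk | hk <;> intro h0 <;> rw [h0] at hk <;> simp at hk
    obtain ⟨m | l, rfl⟩ := (labelEquiv r).surjective k
    · simp
    · simp [hc] at hck
  have hle := (Finset.card_le_card hsub).trans Finset.card_image_le
  rw [Finset.card_union_of_disjoint hdisj] at hle
  have hN : (Finset.univ : Finset (BasisLabel r)).card = 2 * r + 5 := by simp; omega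
  have n1' : r + 3 ≤ (Finset.univ.filter fun k => c k < 0).card := by
    rw [← card_dualLabel]; convert n1
  have n2' : r + 3 ≤ (Finset.univ.filter fun k => (-c) k < 0).card := by
    rw [← card_dualLabel]; convert n2
  omega

theorem HasBalancedFaces.det_homogConfig_ne_zero (h : HasBalancedFaces (faceLattice p)) :
    Matrix.det (Matrix.of fun m => homogConfig η p (Sum.inl m)) ≠ 0 := by
  intro h0
  obtain ⟨v, hv0, hv⟩ := Matrix.exists_vecMul_eq_zero_iff.2 h0
  have hcol : ∀ b, ∑ m, v m * homogConfig η p (Sum.inl m) b = 0 := fun b => congrFun hv b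
  refine hv0 (h.eq_zero_of_dependency ?_ fun i => ?_)
  · simpa [homogConfig, homogEquiv_apply] using hcol (η.symm (Sum.inr ()))
  · simpa [homogConfig, homogEquiv_apply] using hcol (η.symm (Sum.inl i))

theorem HasBalancedFaces.affineSpan_eq_top (h : HasBalancedFaces (faceLattice p))
    (hD : D = 2 * r + 4) : affineSpan ℝ (Set.range p) = ⊤ := by
  have hind : AffineIndependent ℝ fun m => p (labelEquiv r (Sum.inl m)) := by
    rw [affineIndependent_iff_of_fintype]
    intro v hv hvp k
    refine congrFun (h.eq_zero_of_dependency hv fun i => ?_) k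
    rw [Finset.weightedVSub_eq_linear_combination _ hv] at hvp
    simpa using congrArg (fun q : EuclideanSpace ℝ (Fin D) => q i) hvp
  have htop := hind.affineSpan_eq_top_iff_card_eq_finrank_add_one.2 (by simp; omega)
  rw [eq_top_iff, ← htop]
  exact affineSpan_mono ℝ (Set.range_comp_subset_range _ p)

theorem HasBalancedFaces.injective (h : HasBalancedFaces (faceLattice p)) :
    Function.Injective p := by
  intro k l hkl
  have hk := h.of_card_lt {k} (by simp)
  obtain ⟨u, c, -, hS⟩ := (mem_faceLattice_iff p _).1 hk
  have hmem : k ∈ ((({k} : Finset (PolyLabel r)) : Set (PolyLabel r))) := by simp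
  rw [hS] at hmem
  have hl : l ∈ ((({k} : Finset (PolyLabel r)) : Set (PolyLabel r))) := by
    rw [hS]
    simpa [← hkl] using hmem
  simpa [eq_comm] using hl

theorem extremePoints_convexHull_of_subset_sphere {E : Type} [NormedAddCommGroup E]
    [NormedSpace ℝ E] [StrictConvexSpace ℝ E] {s : Set E} (hs : s ⊆ Metric.sphere 0 1) :
    (convexHull ℝ s).extremePoints ℝ = s := by
  refine Set.Subset.antisymm extremePoints_convexHull_subset fun x hx => ?_
  refine inter_extremePoints_subset_extremePoints_of_subset (convexHull_min
    (hs.trans Metric.sphere_subset_closedBall) (convex_closedBall (0 : E) 1))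
    ⟨subset_convexHull ℝ s hx, ?_⟩
  exact StrictConvexSpace.sphere_subset_extremePoints_closedBall _ one_ne_zero (hs hx)

/-- The matrix read off from the dual of an inscribed realization: the coordinates of the first
members of the pairs with respect to the last three of them. -/
noncomputable def sphereMatrix (η : BasisLabel r ≃ Fin D ⊕ Unit)
    (p : PolyLabel r → EuclideanSpace ℝ (Fin D)) : Fin r → Fin 3 → ℝ :=
  fun j k => dualCoords (homogConfig η p) (Sum.inl j) k

theorem continuous_sphereMatrix {X : Type} [TopologicalSpace X]
    {p : X → PolyLabel r → EuclideanSpace ℝ (Fin D)} (hp : Continuous p)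
    (h : ∀ a, HasBalancedFaces (faceLattice (p a))) :
    Continuous fun a => sphereMatrix η (p a) := by
  have hq : Continuous fun a => homogConfig η (p a) := by
    refine continuous_pi fun k => ?_
    refine (LinearMap.continuous_of_finiteDimensional (homogEquiv η).toLinearMap).comp ?_
    exact ((continuous_apply _).comp hp).prodMk continuous_const
  have := continuous_dualCoords hq fun a => (h a).det_homogConfig_ne_zero η
  exact continuous_pi fun j => (continuous_apply (Sum.inl j)).comp this

/-- The face lattice determines the chirotope of `sphereMatrix`. -/
theorem sphereMatrix_mem [NeZero r] {M : Fin r → Fin 3 → ℝ} {σ τ : DualLabel r → ℝ} {ε : ℝ}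
    (hM : IsAdmissible M σ τ ε) (θ : DualLabel r ⊕ Fin r ⊕ Unit ≃ Fin D)
    (hB : HasBalancedFaces (faceLattice p))
    (hp : faceLattice p = faceLattice (lightPoint θ M σ τ ε)) :
    sphereMatrix η p ∈ chirotopeSet M := by
  have hdet := hB.det_homogConfig_ne_zero η
  set x : PolyLabel r → Fin 3 → ℝ :=
    stdDual (dualCoords (homogConfig η p)) ∘ (labelEquiv r).symm with hx
  have hgale : IsAffineGaleDual p x := by
    rw [← isGaleDual_homogConfig_iff η, hx, Function.comp_assoc, Equiv.symm_comp_self,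
      Function.comp_id]
    exact isGaleDual_dualCoords hdet
  have hy : (fun i => x (Sum.inl (i, false))) = stdDual (sphereMatrix η p) := by
    funext i
    rcases i with j | k
    · rfl
    · rfl
  have hbal : IsBalanced x := by
    refine hB.isBalanced hgale fun ξ hξ => funext fun k => ?_
    have h1 := hξ (Sum.inl (Sum.inr k, false))
    rw [show x (Sum.inl (Sum.inr k, false)) = Pi.single k 1 from congrFun hy (Sum.inr k)] at h1
    simpa using h1
  have hface : ∀ S, IsDualFace (pointDual M σ τ ε) S → IsDualFace x S := by
    intro S hS
    rwa [← hgale.mem_faceLattice, hp, (hM.isAffineGaleDual θ).mem_faceLattice]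
  have hpos : ∀ T : Fin 3 → DualLabel r, ∃ c : ℝ, 0 < c ∧
      det3Of (fun i => pointDual M σ τ ε (Sum.inl (i, false))) T = c * det3Of (stdDual M) T := by
    intro T
    refine ⟨_, mul_pos (mul_pos (hM.time_pos (Sum.inl (T 0, false)))
      (hM.time_pos (Sum.inl (T 1, false)))) (hM.time_pos (Sum.inl (T 2, false))), ?_⟩
    simp only [det3Of, pointDual_inl_false]
    rw [det3_smul]
  intro T hT
  have := hM.isBalanced.sign_det3Of_mul_eq hbal hface (by simp [NeZero.pos r]) hT
    (Sum.inr_injective : Function.Injective (Sum.inr : Fin 3 → DualLabel r))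
  rw [hy] at this
  obtain ⟨c, hc, e⟩ := hpos T
  obtain ⟨c', hc', e'⟩ := hpos Sum.inr
  rw [e, e', det3Of_stdDual_inr, det3Of_stdDual_inr, mul_one, mul_one, sign_pos hc',
    mul_assoc, sign_mul, sign_pos hc, one_mul] at this
  exact sign_eq_one_iff.1 this

/-- The dual coordinates of the lightlike configuration of `M` return `M` up to positive row and
column factors, which come from the time coordinates. -/
theorem normalized_sphereMatrix_lightPoint [NeZero r] {M M₀ : Fin r → Fin 3 → ℝ}
    {σ τ : DualLabel r → ℝ} {ε : ℝ} (hM : IsAdmissible M σ τ ε) (hM₀ : M ∈ chirotopeSet M₀)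
    (θ : DualLabel r ⊕ Fin r ⊕ Unit ≃ Fin D)
    (hB : HasBalancedFaces (faceLattice (lightPoint θ M σ τ ε))) :
    normalized (sphereMatrix η (lightPoint θ M σ τ ε)) = normalized M := by
  have hdet := hB.det_homogConfig_ne_zero η
  have hgale := (isGaleDual_homogConfig_iff η _).2 (hM.isAffineGaleDual θ)
  refine normalized_eq_of_scale (entry_ne_zero hM₀)
    (fun j => hM.time_pos (Sum.inl (Sum.inl j, false)))
    (fun k => inv_pos.2 (hM.time_pos (Sum.inl (Sum.inr k, false)))) fun j k => ?_
  have h1 := congrFun (dualCoords_spec_of_isGaleDual hdet hgale (Sum.inl j)) k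
  have ht := (hM.time_pos (Sum.inl (Sum.inr k, false))).ne'
  have el : ∀ j, labelEquiv r (Sum.inl (Sum.inl j)) = Sum.inl (Sum.inl j, false) := fun _ => rfl
  have er : ∀ k, labelEquiv r (Sum.inr k) = Sum.inl (Sum.inr k, false) := fun _ => rfl
  simp only [Function.comp_apply, el, er, pointDual_inl_false, stdDual_inl, stdDual_inr,
    Finset.sum_apply,
    Pi.smul_apply, smul_eq_mul, Pi.single_apply, mul_ite, mul_one, mul_zero, Finset.sum_ite_eq,
    Finset.mem_univ, if_true] at h1
  change dualCoords (homogConfig η (lightPoint θ M σ τ ε)) (Sum.inl j) k = _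
  field_simp
  linarith

end

/-! ### Möbius transformations act projectively -/

section
variable {D : ℕ}

/-- In homogeneous coordinates, `g` is the restriction of a linear map to the light cone, up to
positive factors. -/
def IsProjective (g : USphere D → USphere D) : Prop :=
  ∃ T : (EuclideanSpace ℝ (Fin D) × ℝ) →ₗ[ℝ] (EuclideanSpace ℝ (Fin D) × ℝ), ∀ x : USphere D,
    ∃ μ : ℝ, 0 < μ ∧ ((g x : EuclideanSpace ℝ (Fin D)), (1 : ℝ)) = μ • T (x, 1)

theorem IsProjective.comp {f g : USphere D → USphere D} (hf : IsProjective f)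
    (hg : IsProjective g) : IsProjective (f ∘ g) := by
  obtain ⟨T, hT⟩ := hf
  obtain ⟨S, hS⟩ := hg
  refine ⟨T ∘ₗ S, fun x => ?_⟩
  obtain ⟨μ, hμ, h1⟩ := hT (g x)
  obtain ⟨ν, hν, h2⟩ := hS x
  refine ⟨μ * ν, mul_pos hμ hν, ?_⟩
  rw [Function.comp_apply, h1, h2, map_smul, smul_smul]
  rfl

theorem IsSphereReflection.inv_eq_self {f : Equiv.Perm (USphere D)} (hf : IsSphereReflection f) :
    f⁻¹ = f := by
  ext1 x
  rw [Equiv.Perm.inv_eq_iff_eq]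
  refine Subtype.ext ?_
  rcases hf with ⟨v, -, h⟩ | ⟨c, R, hR, -, h⟩
  · rw [h, h, Submodule.reflection_reflection]
  · rw [h, h, EuclideanGeometry.inversion_inversion c hR.ne']

/-- An inversion in a sphere orthogonal to the unit sphere has denominator `‖x - c‖²`, which is
affine in `x` on the unit sphere. -/
theorem IsSphereReflection.isProjective {f : Equiv.Perm (USphere D)} (hf : IsSphereReflection f) :
    IsProjective f := by
  rcases hf with ⟨v, -, h⟩ | ⟨c, R, hR, hc, h⟩
  · refine ⟨((ℝ ∙ v)ᗮ.reflection.toLinearEquiv.toLinearMap).prodMap LinearMap.id, fun x =>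
      ⟨1, one_pos, ?_⟩⟩
    simp [h]
  · set L : EuclideanSpace ℝ (Fin D) →ₗ[ℝ] ℝ := (innerSL ℝ c).toLinearMap with hL
    set π₁ := LinearMap.fst ℝ (EuclideanSpace ℝ (Fin D)) ℝ
    set π₂ := LinearMap.snd ℝ (EuclideanSpace ℝ (Fin D)) ℝ
    refine ⟨LinearMap.prod
      (R ^ 2 • π₁ + ((2 : ℝ) • π₂ - (2 : ℝ) • (L ∘ₗ π₁)).smulRight c)
      ((2 + R ^ 2) • π₂ - (2 : ℝ) • (L ∘ₗ π₁)), fun x => ?_⟩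
    have hx : ‖(x : EuclideanSpace ℝ (Fin D))‖ = 1 := mem_sphere_zero_iff_norm.1 x.2
    -- On the sphere, the squared distance to `c` is an affine function.
    have hs : dist (x : EuclideanSpace ℝ (Fin D)) c ^ 2
        = 2 + R ^ 2 - 2 * inner ℝ c (x : EuclideanSpace ℝ (Fin D)) := by
      rw [dist_eq_norm, norm_sub_sq_real, hx, hc, real_inner_comm]; ring
    have hpos : 0 < dist (x : EuclideanSpace ℝ (Fin D)) c ^ 2 := by
      refine pow_pos (dist_pos.2 ?_) 2
      intro hxc
      rw [← hxc, hx] at hc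
      nlinarith [pow_pos hR 2]
    set s := dist (x : EuclideanSpace ℝ (Fin D)) c ^ 2 with hsdef
    refine ⟨s⁻¹, inv_pos.2 hpos, Prod.ext ?_ ?_⟩
    · simp only [h, EuclideanGeometry.inversion, div_pow, ← hsdef, vsub_eq_sub, vadd_eq_add,
        Prod.smul_fst, LinearMap.prod_apply, Function.prod_apply, LinearMap.add_apply,
        LinearMap.smul_apply, LinearMap.smulRight_apply, LinearMap.sub_apply,
        LinearMap.comp_apply, π₁, π₂,
        LinearMap.fst_apply, LinearMap.snd_apply, hL]
      have hs' : (2 : ℝ) • (1 : ℝ) - (2 : ℝ) • inner ℝ c (x : EuclideanSpace ℝ (Fin D))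
          = s - R ^ 2 := by rw [hs]; simp; ring
      change (R ^ 2 / s) • ((x : EuclideanSpace ℝ (Fin D)) - c) + c =
        s⁻¹ • (R ^ 2 • (x : EuclideanSpace ℝ (Fin D)) + ((2 : ℝ) • (1 : ℝ)
          - (2 : ℝ) • inner ℝ c (x : EuclideanSpace ℝ (Fin D))) • c)
      rw [hs', sub_smul, smul_add, smul_sub, smul_sub, smul_smul, smul_smul, smul_smul,
        inv_mul_cancel₀ hpos.ne', one_smul, div_eq_inv_mul]
      abel
    · change (1 : ℝ) = s⁻¹ • ((2 + R ^ 2) • (1 : ℝ)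
        - (2 : ℝ) • inner ℝ c (x : EuclideanSpace ℝ (Fin D)))
      rw [smul_eq_mul, smul_eq_mul, smul_eq_mul, mul_one, ← hs, inv_mul_cancel₀ hpos.ne']

theorem isProjective_of_mem_moebiusGroup {g : Equiv.Perm (USphere D)} (hg : g ∈ moebiusGroup D) :
    IsProjective g := by
  suffices IsProjective g ∧ IsProjective (g⁻¹ : Equiv.Perm (USphere D)) from this.1
  refine Subgroup.closure_induction (p := fun (g : Equiv.Perm (USphere D)) _ =>
      IsProjective g ∧ IsProjective (g⁻¹ : Equiv.Perm (USphere D)))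
    ?_ ?_ ?_ ?_ hg
  · intro f hf
    rw [IsSphereReflection.inv_eq_self hf]
    exact ⟨IsSphereReflection.isProjective hf, IsSphereReflection.isProjective hf⟩
  · have : IsProjective (id : USphere D → USphere D) :=
      ⟨LinearMap.id, fun x => ⟨1, one_pos, by simp⟩⟩
    simpa using this
  · rintro f g - - ⟨hf, hf'⟩ ⟨hg, hg'⟩
    rw [mul_inv_rev]
    exact ⟨hf.comp hg, hg'.comp hf'⟩
  · rintro f - ⟨hf, hf'⟩
    exact ⟨hf', by rwa [inv_inv]⟩

/-- The matrices of Möbius equivalent configurations differ by positive row and column factors. -/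
theorem normalized_sphereMatrix_moebius {r : ℕ} [NeZero r] (η : BasisLabel r ≃ Fin D ⊕ Unit)
    {M₀ : Fin r → Fin 3 → ℝ} {g : Equiv.Perm (USphere D)} (hg : g ∈ moebiusGroup D)
    {B C : PolyLabel r → USphere D} (h : ∀ k, g (B k) = C k)
    (hB : HasBalancedFaces (faceLattice fun k => (B k : EuclideanSpace ℝ (Fin D))))
    (hC : HasBalancedFaces (faceLattice fun k => (C k : EuclideanSpace ℝ (Fin D))))
    (hM₀ : sphereMatrix η (fun k => (B k : EuclideanSpace ℝ (Fin D))) ∈ chirotopeSet M₀) :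
    normalized (sphereMatrix η fun k => (C k : EuclideanSpace ℝ (Fin D)))
      = normalized (sphereMatrix η fun k => (B k : EuclideanSpace ℝ (Fin D))) := by
  obtain ⟨T, hT⟩ := isProjective_of_mem_moebiusGroup hg
  choose μ hμ hT using hT
  refine normalized_eq_of_scale (entry_ne_zero hM₀)
    (a := fun j => (μ (B (labelEquiv r (Sum.inl (Sum.inl j)))))⁻¹)
    (b := fun k => μ (B (labelEquiv r (Sum.inr k))))
    (fun j => inv_pos.2 (hμ _)) (fun k => hμ _) fun j k => ?_
  have := dualCoords_rescale
    ((homogEquiv η).toLinearMap ∘ₗ T ∘ₗ (homogEquiv η).symm.toLinearMap)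
    (fun k => μ (B (labelEquiv r k))) (fun k => (hμ _).ne') (fun k => ?_)
    (hB.det_homogConfig_ne_zero η) (hC.det_homogConfig_ne_zero η) (Sum.inl j) k
  · refine this.trans ?_
    rw [div_eq_inv_mul]
    rfl
  · simp only [homogConfig, LinearMap.comp_apply, LinearEquiv.coe_coe,
      LinearEquiv.symm_apply_apply]
    rw [← map_smul, ← hT, h]

end

/-! ### The retraction -/

section
variable {r D : ℕ} {M : Fin r → Fin 3 → ℝ} {σ τ : DualLabel r → ℝ} {ε : ℝ}

theorem IsAdmissible.hasBalancedFaces (h : IsAdmissible M σ τ ε)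
    (θ : DualLabel r ⊕ Fin r ⊕ Unit ≃ Fin D) :
    HasBalancedFaces (faceLattice (lightPoint θ M σ τ ε)) := by
  have : faceLattice (lightPoint θ M σ τ ε) = {S | IsDualFace (pointDual M σ τ ε) S} :=
    Set.ext fun S => (h.isAffineGaleDual θ).mem_faceLattice S
  rw [this]
  exact h.isBalanced.hasBalancedFaces

theorem IsAdmissible.isVertexConfiguration {ι : Type} (h : IsAdmissible M σ τ ε)
    (θ : DualLabel r ⊕ Fin r ⊕ Unit ≃ Fin D) (hD : D = 2 * r + 4) (ψ : ι ≃ PolyLabel r) :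
    IsVertexConfiguration (lightPoint θ M σ τ ε ∘ ψ) where
  injective := (h.hasBalancedFaces θ).injective.comp ψ.injective
  extremePoints_eq := extremePoints_convexHull_of_subset_sphere (by
    rintro _ ⟨i, rfl⟩
    exact h.norm_lightPoint θ (ψ i))
  affineSpan_eq := by
    rw [ψ.surjective.range_comp]
    exact (h.hasBalancedFaces θ).affineSpan_eq_top hD

theorem IsAdmissible.isNeighborly {ι : Type} (h : IsAdmissible M σ τ ε)
    (θ : DualLabel r ⊕ Fin r ⊕ Unit ≃ Fin D) (hD : D = 2 * r + 4) (ψ : ι ≃ PolyLabel r) :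
    IsNeighborly (lightPoint θ M σ τ ε ∘ ψ) := by
  classical
  intro S hS
  rw [mem_faceLattice_comp, ← Finset.coe_image]
  refine (h.hasBalancedFaces θ).of_card_lt _ ?_
  rw [Finset.card_image_of_injective _ ψ.injective, card_dualLabel]
  omega

theorem continuous_lightPoint {Z : Type} [TopologicalSpace Z] {M : Z → Fin r → Fin 3 → ℝ}
    {σ τ : Z → DualLabel r → ℝ} {ε : Z → ℝ} (hM : Continuous M) (hσ : Continuous σ)
    (hτ : Continuous τ) (hε : Continuous ε) (h : ∀ z, IsAdmissible (M z) (σ z) (τ z) (ε z))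
    (θ : DualLabel r ⊕ Fin r ⊕ Unit ≃ Fin D) (k : PolyLabel r) :
    Continuous fun z => lightPoint θ (M z) (σ z) (τ z) (ε z) k := by
  have cγ : ∀ i, Continuous fun z => pairHeight (M z) (σ z) (τ z) i :=
    continuous_pairHeight hM hσ hτ fun z => (h z).sigma_pos
  have cκ : Continuous fun z => lightCorrection (M z) (σ z) (τ z) (ε z) :=
    ((hε.pow 2).mul (continuous_finsetSum _ fun i _ => (cγ i).pow 2)).div_const _
  have ct : Continuous fun z => lightTime (M z) (σ z) (τ z) (ε z) k := by
    rcases k with ⟨i, b⟩ | b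
    · cases b
      · exact (cγ i).add ((continuous_apply i).comp hσ)
      · exact continuous_const
    · exact continuous_const.add cκ
  have cs : ∀ a, Continuous fun z => lightSpace (M z) (σ z) (τ z) (ε z) k a := by
    intro a
    rcases k with ⟨i, b⟩ | b
    · cases b
      · rcases a with l | c | u
        · by_cases hl : l = i
          · subst hl
            simpa [lightSpace] using cγ l
          · simpa [lightSpace, hl] using continuous_const
        · exact continuous_stdConfig hM i c
        · exact (continuous_apply i).comp hτ
      · exact continuous_const
    · rcases a with l | c | u
      · exact hε.mul (cγ l)
      · exact continuous_const
      · exact continuous_const.mul (continuous_const.sub cκ)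
  refine (PiLp.continuous_toLp 2 _).comp (continuous_pi fun i => ?_)
  exact (cs _).div ct fun z => ((h z).time_pos k).ne'

/-- Normalizing the dual coordinates retracts the inscribed realization space to the set of
normalized matrices; the section sends a matrix to its lightlike configuration. -/
theorem exists_inscribed_isRetractOf [NeZero r] {ι : Type} {M₀ : Fin r → Fin 3 → ℝ}
    (hM₀ : M₀ ∈ chirotopeSet M₀) (hD : D = 2 * r + 4) (ψ : ι ≃ PolyLabel r) :
    ∃ P : ι → EuclideanSpace ℝ (Fin D), IsVertexConfiguration P ∧ IsInscribed P ∧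
      IsNeighborly P ∧ IsRetractOf (normalizedSet M₀) (RealizationSpaceInscribed P) := by
  obtain ⟨σ, τ, ε, cσ, cτ, cε, hadm, hS, hT⟩ := exists_admissible hM₀
  have θ : DualLabel r ⊕ Fin r ⊕ Unit ≃ Fin D := Fintype.equivOfCardEq (by simp; omega)
  have η : BasisLabel r ≃ Fin D ⊕ Unit := Fintype.equivOfCardEq (by simp; omega)
  set p : chirotopeSet M₀ → PolyLabel r → EuclideanSpace ℝ (Fin D) := fun z =>
    lightPoint θ z.1 (σ z) (τ z) (ε z) with hp
  set z₀ : chirotopeSet M₀ := ⟨M₀, hM₀⟩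
  have hsub : ∀ z z', faceLattice (p z) ⊆ faceLattice (p z') := fun z z' =>
    (hadm z).faceLattice_subset (hadm z')
      (fun T hT => pos_of_mul_pos_mul (z.2 T hT) (z'.2 T hT)) (hS z z') (hT z z') θ
  have hface : ∀ z z', faceLattice (p z) = faceLattice (p z') := fun z z' =>
    (hsub z z').antisymm (hsub z' z)
  have hbal : ∀ z, HasBalancedFaces (faceLattice (p z)) := fun z => (hadm z).hasBalancedFaces θ
  refine ⟨p z₀ ∘ ψ, (hadm z₀).isVertexConfiguration θ hD ψ,
    fun i => (hadm z₀).norm_lightPoint θ (ψ i), (hadm z₀).isNeighborly θ hD ψ, ?_⟩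
  set R := {B : ι → USphere D // faceLattice (fun i => (B i : EuclideanSpace ℝ (Fin D)))
    = faceLattice (p z₀ ∘ ψ)}
  set b : R → PolyLabel r → EuclideanSpace ℝ (Fin D) := fun B k => B.1 (ψ.symm k) with hb
  have hbface : ∀ B : R, faceLattice (b B) = faceLattice (p z₀) := fun B => by
    rw [← faceLattice_comp_eq_iff _ _ ψ, ← B.2]
    congr 1
    funext i
    simp [hb]
  have hbbal : ∀ B : R, HasBalancedFaces (faceLattice (b B)) := fun B => by
    rw [hbface]; exact hbal z₀
  have hbmem : ∀ B : R, sphereMatrix η (b B) ∈ chirotopeSet M₀ := fun B =>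
    sphereMatrix_mem η (hadm z₀) θ (hbbal B) (hbface B)
  have cb : Continuous b := continuous_pi fun k =>
    continuous_subtype_val.comp ((continuous_apply (ψ.symm k)).comp continuous_subtype_val)
  have hlift : ∀ B C : R, (inscribedSetoid (p z₀ ∘ ψ)).r B C →
      (⟨normalized (sphereMatrix η (b B)), normalized_mem (hbmem B)⟩ : normalizedSet M₀)
        = ⟨normalized (sphereMatrix η (b C)), normalized_mem (hbmem C)⟩ := by
    rintro B C ⟨g, hg, h⟩
    refine Subtype.ext (Eq.symm ?_)
    exact normalized_sphereMatrix_moebius η hg (B := fun k => B.1 (ψ.symm k))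
      (C := fun k => C.1 (ψ.symm k)) (fun k => h (ψ.symm k)) (hbbal B) (hbbal C) (hbmem B)
  set f : C(RealizationSpaceInscribed (p z₀ ∘ ψ), normalizedSet M₀) :=
    ⟨Quotient.lift (fun B : R => (⟨normalized (sphereMatrix η (b B)), normalized_mem (hbmem B)⟩ :
      normalizedSet M₀)) hlift, by
      refine Continuous.quotient_lift (Continuous.subtype_mk ?_ _) _
      exact (continuous_normalized M₀).comp
        ((continuous_sphereMatrix η cb hbbal).subtype_mk hbmem)⟩ with hf
  have hgmem : ∀ z, faceLattice (fun i => p z (ψ i)) = faceLattice (p z₀ ∘ ψ) := fun z =>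
    (faceLattice_comp_eq_iff (p z) (p z₀) ψ).2 (hface z z₀)
  set s : normalizedSet M₀ → R := fun y =>
    ⟨fun i => ⟨p ⟨y.1, y.2.1⟩ (ψ i), (hadm _).norm_lightPoint θ (ψ i)⟩, hgmem _⟩ with hs
  have cs : Continuous s := by
    refine Continuous.subtype_mk (continuous_pi fun i => Continuous.subtype_mk ?_ _) _
    have cy : Continuous fun y : normalizedSet M₀ => (⟨y.1, y.2.1⟩ : chirotopeSet M₀) :=
      continuous_subtype_val.subtype_mk _
    exact (continuous_lightPoint continuous_subtype_val cσ cτ cε hadm θ (ψ i)).comp cy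
  refine ⟨f, ⟨fun y => Quotient.mk _ (s y), continuous_quotient_mk'.comp cs⟩, ?_⟩
  ext y : 1
  refine Subtype.ext ?_
  change normalized (sphereMatrix η (b (s y))) = y.1
  have hbs : b (s y) = p ⟨y.1, y.2.1⟩ := by
    funext k
    simp [hb, hs]
  rw [hbs]
  exact (normalized_sphereMatrix_lightPoint η (hadm _) y.2.1 θ (hbal _)).trans y.2.2

end

theorem mainTheorem7 (n : ℕ) (hn : 4 ≤ n)
    (A : Fin n → EuclideanSpace ℝ (Fin (n - 4))) (hA : InGeneralPosition A) :
    ∃ P : Fin (2 * n + 2) → EuclideanSpace ℝ (Fin (2 * n - 2)),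
      IsVertexConfiguration P ∧ IsInscribed P ∧ IsNeighborly P ∧
      ∃ (X Y : Type) (_ : TopologicalSpace X) (_ : TopologicalSpace Y),
        Nonempty (X ≃ₕ RealizationSpaceInscribed P) ∧
        Nonempty (Y ≃ₕ RealizationSpaceOM A) ∧
        IsRetractOf Y X := by
  have φ : DualLabel (n - 4 + 1) ≃ Fin n := Fintype.equivOfCardEq (by simp; omega)
  have ψ : Fin (2 * n + 2) ≃ PolyLabel (n - 4 + 1) := Fintype.equivOfCardEq (by simp; omega)
  have hU := hA.isUniform
  have hM₀ := RealizesOM.dualCoords_mem φ hU (V := homogenization A) (Or.inl rfl)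
  obtain ⟨P, h1, h2, h3, h4⟩ := exists_inscribed_isRetractOf (D := 2 * n - 2) hM₀ (by omega) ψ
  exact ⟨P, h1, h2, h3, _, _, inferInstance, inferInstance, ⟨.refl _⟩,
    ⟨(normalizedHomotopyEquiv _).trans (realizationSpaceHomeomorph φ hU).toHomotopyEquiv⟩, h4⟩
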